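/- **Conventions.** $\mathbb N_0=\{0,1,2,\dots\}$. A shift space over a finite alphabet $\mathcal A$ is the set of all sequences in $\mathcal A^{\mathbb Z}$ in which no word of some given set $\mathcal F$ of forbidden words occurs (equivalently, a closed shift-invariant subset of $\mathcal A^{\mathbb Z}$). The shift map is $(\sigma x)_i=x_{i+1}$. For non-empty $S\subseteq\mathbb N_0$ the *$S$-gap shift* $\mathsf X(S)\subseteq\{0,1\}^{\mathbb Z}$ is the shift space with forbidden words $\{10^k1\mid k\notin S\}$ if $S$ is infinite, and $\{10^k1\mid k\notin S,\ k<\max S\}\cup\{0^{1+\max S}\}$ if $S$ is finite. A shift space is *sofic* if there is a finite directed graph with labelled edges (loops and multiple edges allowed) such that the shift space is exactly the set of label sequences of bi-infinite walks on the graph. For a shift space $X$, the *suspension flow* $SX$ is the topological quotient of $X\times\mathbb R$ by the equivalence relation generated by $(x,t+1)\sim(\sigma x,t)$; $[x,t]$ is the class of $(x,t)$. Shift spaces $X,Y$ are *flow equivalent*, $X\sim_{FE}Y$, if there is a homeomorphism $\Phi\colon SX\to SY$ such that for every $[x,t]\in SX$ there is a (strictly) increasing function $\phi\colon\mathbb R\to\mathbb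 R$ such that $\Phi([x,t])=[y,t']$ implies $\Phi([x,t+r])=[y,t'+\phi(r)]$ for all $r\in\mathbb R$. **Theorem (classification of non-sofic $S$-gap shifts).** Let $S,R\subseteq\mathbb N_0$ be such that $\mathsf X(S)$ and $\mathsf X(R)$ are not sofic. Then $\mathsf X(S)\sim_{FE}\mathsf X(R)$ if and only if there exist subsets $S'\subseteq S$ and $R'\subseteq R$ with $S\setminus S'$ and $R\setminus R'$ finite such that $|S\setminus S'|=|R\setminus R'|$ and $S'+r=R'$ for some $r\in\mathbb Z$, where $S'+r=\{s+r\mid s\in S'\}$. -/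

import Mathlib

namespace GapShift

open SymbolicDynamics.FullShift

/-! ### Shift spaces given by forbidden words -/

/-- The word `w = w₀ … w_{n-1}` occurs in the bi-infinite sequence `x`. -/
def Occurs {A : Type*} (w : List A) (x : ℤ → A) : Prop :=
  ∃ i : ℤ, ∀ (k : ℕ) (hk : k < w.length), x (i + k) = w[k]

/-- The shift space of all bi-infinite sequences in which no word of `F` occurs.
`Subshift A ℤ` is the type of closed shift-invariant subsets of `ℤ → A`. -/
def ofForbiddenWords {A : Type*} [TopologicalSpace A] [DiscreteTopology A]
    (F : Set (List A)) : Subshift A ℤ where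
  carrier := {x | ∀ w ∈ F, ¬ Occurs w x}
  isClosed := by
    have h : {x : ℤ → A | ∀ w ∈ F, ¬ Occurs w x} =
        ⋂ (w : List A) (_ : w ∈ F) (i : ℤ),
          (⋂ k : Fin w.length, {x : ℤ → A | x (i + (k : ℕ)) = w[k]})ᶜ := by
      ext x
      simp [Occurs, Fin.exists_iff]
    rw [h]
    refine isClosed_iInter fun w => isClosed_iInter fun _ => isClosed_iInter fun i => ?_
    rw [isClosed_compl_iff]
    refine isOpen_iInter_of_finite fun k => ?_
    have hc : Continuous fun x : ℤ → A => x (i + ((k : ℕ) : ℤ)) := continuous_apply _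
    exact (isOpen_discrete ({w[k]} : Set A)).preimage hc
  mapsTo := by
    rintro g x hx w hw ⟨i, hi⟩
    exact hx w hw ⟨g + i, fun k hk => by simpa [add_assoc] using hi k hk⟩

/-- The word `1 0ᵏ 1`. -/
def gapWord (k : ℕ) : List (Fin 2) := 1 :: (List.replicate k 0 ++ [1])

open Classical in
/-- Forbidden words of the `S`-gap shift, for non-empty `S`: all `1 0ᵏ 1` with `k ∉ S` if `S` is
infinite; all `1 0ᵏ 1` with `k ∉ S`, `k < max S`, together with `0 ^ (1 + max S)`, if `S` is finite.
(For `S = ∅` the value carries no meaning.) -/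
noncomputable def gapForbidden (S : Set ℕ) : Set (List (Fin 2)) :=
  if S.Finite then
    {w | ∃ k, k ∉ S ∧ k < sSup S ∧ w = gapWord k} ∪ {List.replicate (1 + sSup S) 0}
  else
    {w | ∃ k, k ∉ S ∧ w = gapWord k}

/-- The `S`-gap shift `X(S)` over the alphabet `{0, 1}`. -/
noncomputable def gapShift (S : Set ℕ) : Subshift (Fin 2) ℤ :=
  ofForbiddenWords (gapForbidden S)

/-! ### Sofic shifts -/

/-- A finite directed graph (multiple edges and loops allowed) with edges labelled in `A`. -/
structure LabeledGraph (A : Type*) where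
  /-- vertices -/
  V : Type
  /-- edges -/
  E : Type
  finV : Finite V
  finE : Finite E
  /-- the vertex at which an edge starts -/
  src : E → V
  /-- the vertex at which an edge terminates -/
  tgt : E → V
  /-- the labelling -/
  label : E → A

/-- The edge shift of the underlying graph, as a set: all bi-infinite walks. -/
def LabeledGraph.edgeShift {A : Type*} (G : LabeledGraph A) : Set (ℤ → G.E) :=
  {e | ∀ i : ℤ, G.tgt (e i) = G.src (e (i + 1))}

/-- A shift space is sofic if it is the set of label sequences of the bi-infinite walks on some
finite labelled graph. -/
def IsSofic {A : Type*} [TopologicalSpace A] (X : Subshift A ℤ) : Prop :=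
  ∃ G : LabeledGraph A, X.carrier = (fun e i => G.label (e i)) '' G.edgeShift

/-! ### Flow equivalence -/

section Flow

variable {A B : Type*} [TopologicalSpace A] [TopologicalSpace B]

/-- The shift map `σ_X : X → X`, `(σ x) i = x (1 + i)`. -/
def shiftMap (X : Subshift A ℤ) (x : X.carrier) : X.carrier :=
  ⟨fun i => x.1 (1 + i), X.mapsTo 1 x.2⟩

/-- The relation `(x, t + 1) ∼ (σ x, t)` on `X × ℝ`. -/
inductive SuspensionRel (X : Subshift A ℤ) : X.carrier × ℝ → X.carrier × ℝ → Prop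
  | step (x : X.carrier) (t : ℝ) : SuspensionRel X (x, t + 1) (shiftMap X x, t)

/-- The suspension flow `SX` of `X`: the quotient of `X × ℝ` by the equivalence relation generated
by `SuspensionRel`. -/
def Suspension (X : Subshift A ℤ) : Type _ := Quot (SuspensionRel X)

/-- `SX` carries the quotient topology of the product topology on `X × ℝ`. -/
instance (X : Subshift A ℤ) : TopologicalSpace (Suspension X) :=
  inferInstanceAs (TopologicalSpace (Quot (SuspensionRel X)))

/-- The class `[x, t]` in `SX`. -/
def Suspension.mk (X : Subshift A ℤ) (x : X.carrier) (t : ℝ) : Suspension X :=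
  Quot.mk (SuspensionRel X) (x, t)

/-- `X` and `Y` are flow equivalent: there is a homeomorphism `SX → SY` that maps flow orbits to
flow orbits and preserves the direction of time. -/
def FlowEquivalent (X : Subshift A ℤ) (Y : Subshift B ℤ) : Prop :=
  ∃ Φ : Suspension X ≃ₜ Suspension Y,
    ∀ (x : X.carrier) (t : ℝ), ∃ φ : ℝ → ℝ, StrictMono φ ∧
      ∀ (y : Y.carrier) (t' : ℝ), Φ (Suspension.mk X x t) = Suspension.mk Y y t' →
        ∀ r : ℝ, Φ (Suspension.mk X x (t + r)) = Suspension.mk Y y (t' + φ r)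

end Flow

end GapShift

/-! Translates give flow equivalence. Inserting zeros after a one only changes the time spent near
that one. If the gap `s` is lengthened by `d s`, with `d` eventually constant, the amount to insert
is visible in a finite window, infinite gaps included; if moreover `s ↦ s + d s` is injective on
`S`, the insertion can be undone. The old shift is then a cross-section of the new one with a
continuous return time, and stretching time gives a flow equivalence (`flowEquivalent_of_tower`,
`flowEquivalent_gapShift_image`). Lengthening the exceptional gaps to fill a block `[M, M + n)` and
translating the other gaps above it brings `S` and `R` to the same gap set
(`flowEquivalent_gapShift_normalForm`).

Conversely, a flow equivalence lifts to the covers `X × ℝ`. Comparing lifts over the deck group `ℤ`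
yields maps `F`, `G` of the shift spaces, inverse up to shifts, with continuous integer cocycles
(`FlowEquivalent.exists_orbitMaps`); by compactness they are local. Three facts then determine the
gap sets.

The zero sequence is sent to itself: otherwise its image is periodic and contains a one, this period
can be repeated any large number of times without creating new gaps, and mapping back produces every
large gap, so `S` would be cofinite and the shift sofic (`OrbitMap.IsLeftInverse.map_zero`).

Long gaps are translated by a constant: a long stretch of zeros becomes one longer or shorter by an
amount depending only on the two tails around it. Going there and back translates large elements of
`S` by the sum of two such amounts, and a non-sofic gap set admits no non-zero eventual
self-translation. Hence the sum is zero for all choices of tails, and the amount is constant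
(`OrbitMap.IsLeftInverse.exists_gap_shift`).

The numbers of short gaps agree: points with finitely many ones and only short gaps correspond to
words over the finite alphabet of short gaps, so there is a bijection of words on the two sides.
Summing `z ^ length` of the image point over all words gives `1 / (1 - ∑ z ^ wt r)` on one side. On
the other, the length grows by an amount depending on a bounded prefix, so a transfer matrix
computes the same series. Cramer's rule turns this into a polynomial identity, and its value at `z =
1` compares the alphabet sizes (`card_eq_of_list_equiv`). -/

namespace GapShift

open SymbolicDynamics.FullShift Topology Set

/-! ### The suspension flow as a covering quotient -/

section Suspension

variable {A : Type*} [TopologicalSpace A]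

/-- The `i`-th power of the shift map. -/
def shiftBy (X : Subshift A ℤ) (i : ℤ) (x : X.carrier) : X.carrier :=
  ⟨fun j => x.1 (i + j), X.mapsTo i x.2⟩

variable {X : Subshift A ℤ}

@[simp] lemma shiftBy_apply (i j : ℤ) (x : X.carrier) : (shiftBy X i x).1 j = x.1 (i + j) := rfl

@[simp] lemma shiftBy_zero (x : X.carrier) : shiftBy X 0 x = x := by
  ext j; simp

lemma shiftBy_shiftBy (i j : ℤ) (x : X.carrier) :
    shiftBy X i (shiftBy X j x) = shiftBy X (i + j) x := by
  ext k; simp only [shiftBy_apply]; rw [← add_assoc, add_comm j i]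

lemma shiftMap_eq (x : X.carrier) : shiftMap X x = shiftBy X 1 x := rfl

lemma continuous_shiftBy (i : ℤ) : Continuous (shiftBy X i) :=
  ((continuous_pi fun j => continuous_apply (i + j)).comp continuous_subtype_val).subtype_mk
    fun x => X.mapsTo i x.2

/-- The orbits of this action are the classes defining the suspension, so `ℤ` is the deck group of
`X × ℝ → SX`. -/
instance : AddAction ℤ (X.carrier × ℝ) where
  vadd k p := (shiftBy X k p.1, p.2 - k)
  zero_vadd p := by
    change (shiftBy X 0 p.1, p.2 - ((0 : ℤ) : ℝ)) = p
    simp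
  add_vadd i j p := by
    change (shiftBy X (i + j) p.1, p.2 - ((i + j : ℤ) : ℝ)) =
      (shiftBy X i (shiftBy X j p.1), p.2 - j - i)
    rw [shiftBy_shiftBy]; congr 1; push_cast; ring

lemma vadd_def (k : ℤ) (p : X.carrier × ℝ) : k +ᵥ p = (shiftBy X k p.1, p.2 - k) := rfl

lemma Suspension.mk_shiftBy (k : ℤ) (x : X.carrier) (t : ℝ) :
    Suspension.mk X (shiftBy X k x) t = Suspension.mk X x (t + k) := by
  have h1 : ∀ (x : X.carrier) (t : ℝ), Suspension.mk X (shiftBy X 1 x) t =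
      Suspension.mk X x (t + 1) := fun x t => (Quot.sound (SuspensionRel.step x t)).symm
  induction k using Int.induction_on generalizing t with
  | zero => simp
  | succ n ih =>
    rw [add_comm, ← shiftBy_shiftBy, h1, ih]; congr 1; push_cast; ring
  | pred n ih =>
    have := h1 (shiftBy X (-n - 1) x) (t - 1)
    rw [shiftBy_shiftBy] at this
    rw [show t = t - 1 + 1 by ring, ← this, show (1 : ℤ) + (-n - 1) = -n by ring, ih]
    congr 1; push_cast; ring

lemma Suspension.mk_eq_mk_iff {x x' : X.carrier} {t t' : ℝ} :
    Suspension.mk X x t = Suspension.mk X x' t' ↔ ∃ k : ℤ, x' = shiftBy X k x ∧ t' = t - k := by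
  constructor
  · intro h
    have h' := Quot.eqvGen_exact h
    have key : ∀ p q, Relation.EqvGen (SuspensionRel X) p q → ∃ k : ℤ, q = k +ᵥ p := by
      intro p q hpq
      induction hpq with
      | rel p q hr =>
        obtain ⟨x, t⟩ := hr
        exact ⟨1, by simp [vadd_def, shiftMap_eq]⟩
      | refl p => exact ⟨0, (zero_vadd ℤ p).symm⟩
      | symm p q _ ih =>
        obtain ⟨k, rfl⟩ := ih
        exact ⟨-k, by simp⟩
      | trans p q r _ _ ih1 ih2 =>
        obtain ⟨k, rfl⟩ := ih1
        obtain ⟨l, rfl⟩ := ih2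
        exact ⟨l + k, by rw [add_vadd]⟩
    obtain ⟨k, hk⟩ := key _ _ h'
    rw [vadd_def, Prod.mk.injEq] at hk
    exact ⟨k, hk⟩
  · rintro ⟨k, rfl, rfl⟩
    rw [Suspension.mk_shiftBy]; simp

/-- The quotient map `X × ℝ → SX`. -/
def suspensionProj (X : Subshift A ℤ) (p : X.carrier × ℝ) : Suspension X :=
  Suspension.mk X p.1 p.2

lemma continuous_suspensionProj : Continuous (suspensionProj X) := continuous_quot_mk

/-- A non-zero integer moves the time coordinate by at least `1`, so a slab of width `2 / 3` is
disjoint from its translates. -/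
lemma isAddQuotientCoveringMap_suspensionProj :
    IsAddQuotientCoveringMap (suspensionProj X) ℤ where
  toIsQuotientMap := isQuotientMap_quot_mk
  continuous_const_vadd k := by
    change Continuous fun p : X.carrier × ℝ => (shiftBy X k p.1, p.2 - k)
    exact ((continuous_shiftBy k).comp continuous_fst).prodMk
      (continuous_snd.sub continuous_const)
  apply_eq_iff_mem_orbit {p q} := by
    rw [suspensionProj, suspensionProj, eq_comm, Suspension.mk_eq_mk_iff, AddAction.mem_orbit_iff]
    simp [vadd_def, Prod.ext_iff, eq_comm]
  disjoint p := by
    refine ⟨univ ×ˢ Ioo (p.2 - 1 / 3) (p.2 + 1 / 3), ?_, ?_⟩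
    · exact prod_mem_nhds Filter.univ_mem (Ioo_mem_nhds (by linarith) (by linarith))
    · rintro k ⟨-, ⟨q, hq, rfl⟩, hq'⟩
      simp only [vadd_def, mem_prod, mem_univ, true_and, mem_Ioo] at hq hq'
      have h1 : (k : ℝ) < 1 := by linarith
      have h2 : (-1 : ℝ) < k := by linarith
      have h3 : k < 1 := by exact_mod_cast h1
      have h4 : -1 < k := by exact_mod_cast h2
      lia

lemma isCoveringMap_suspensionProj : IsCoveringMap (suspensionProj X) :=
  isAddQuotientCoveringMap_suspensionProj.isCoveringMap

lemma exists_eq_mk (z : Suspension X) : ∃ x t, 0 ≤ t ∧ t < 1 ∧ z = Suspension.mk X x t := by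
  obtain ⟨⟨x, t⟩, rfl⟩ := Quot.exists_rep z
  refine ⟨shiftBy X ⌊t⌋ x, Int.fract t, Int.fract_nonneg t, Int.fract_lt_one t, ?_⟩
  rw [Suspension.mk_shiftBy, Int.fract_add_floor]; rfl

instance [Finite A] : CompactSpace X.carrier :=
  isCompact_iff_compactSpace.mp X.isClosed.isCompact

instance [Finite A] : CompactSpace (Suspension X) := by
  have h : IsCompact (suspensionProj X '' (univ ×ˢ Icc 0 1)) :=
    (isCompact_univ.prod isCompact_Icc).image continuous_suspensionProj
  refine ⟨h.of_isClosed_subset isClosed_univ fun z _ => ?_⟩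
  obtain ⟨x, t, h0, h1, rfl⟩ := exists_eq_mk z
  exact ⟨(x, t), ⟨mem_univ _, h0, h1.le⟩, rfl⟩

instance [T2Space A] : T2Space (Suspension X) := by
  rw [t2Space_iff_of_isOpenQuotientMap
    (isAddQuotientCoveringMap_suspensionProj (X := X)).isOpenQuotientMap]
  have h : {q : (X.carrier × ℝ) × (X.carrier × ℝ) | suspensionProj X q.1 = suspensionProj X q.2} =
      ⋃ k : ℤ, {q | q.2 = k +ᵥ q.1} := by
    ext ⟨p, q⟩
    simp [suspensionProj, Suspension.mk_eq_mk_iff, vadd_def, Prod.ext_iff]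
  have := (isAddQuotientCoveringMap_suspensionProj (X := X)).toContinuousConstVAdd
  rw [h]
  -- On a bounded neighbourhood of a pair `(p, q)` only finitely many `k` can satisfy `q.2 = p.2 -
  -- k`.
  refine LocallyFinite.isClosed_iUnion ?_ fun k =>
    isClosed_eq continuous_snd ((continuous_const_vadd k).comp continuous_fst)
  rintro ⟨p, q⟩
  refine ⟨(univ ×ˢ Ioo (p.2 - 1) (p.2 + 1)) ×ˢ (univ ×ˢ Ioo (q.2 - 1) (q.2 + 1)), ?_, ?_⟩
  · exact prod_mem_nhds (prod_mem_nhds Filter.univ_mem (Ioo_mem_nhds (by linarith) (by linarith)))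
      (prod_mem_nhds Filter.univ_mem (Ioo_mem_nhds (by linarith) (by linarith)))
  · refine (finite_Icc (⌊p.2 - q.2 - 2⌋) (⌈p.2 - q.2 + 2⌉)).subset ?_
    rintro k ⟨⟨p', q'⟩, hk, hpq⟩
    simp only [vadd_def, mem_prod, mem_univ, true_and, mem_Ioo, mem_ofPred_eq, Prod.ext_iff]
      at hk hpq
    constructor
    · have := Int.floor_le (p.2 - q.2 - 2)
      exact_mod_cast this.trans (show p.2 - q.2 - 2 ≤ (k : ℝ) by linarith)
    · have := Int.le_ceil (p.2 - q.2 + 2)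
      exact_mod_cast (show (k : ℝ) ≤ p.2 - q.2 + 2 by linarith).trans this

/-- Two lifts of one path to `X × ℝ` with constant first coordinates differ by a deck
transformation. -/
lemma eq_shiftBy_of_mk_eq {I : Set ℝ} (hI : IsPreconnected I) {x x' : X.carrier} {a a' : ℝ → ℝ}
    (ha : ContinuousOn a I) (ha' : ContinuousOn a' I) (hne : I.Nonempty)
    (h : ∀ r ∈ I, Suspension.mk X x (a r) = Suspension.mk X x' (a' r)) :
    ∃ k : ℤ, x' = shiftBy X k x ∧ ∀ r ∈ I, a' r = a r - k := by
  have h' : ∀ r ∈ I, ∃ k : ℤ, x' = shiftBy X k x ∧ a' r = a r - k :=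
    fun r hr => Suspension.mk_eq_mk_iff.mp (h r hr)
  obtain ⟨r₀, hr₀⟩ := hne
  obtain ⟨k, hk, hr₀k⟩ := h' r₀ hr₀
  refine ⟨k, hk, fun r hr => ?_⟩
  have hmaps : MapsTo (fun r => a r - a' r) I (range ((↑) : ℤ → ℝ)) := by
    intro r hr
    obtain ⟨l, -, hl⟩ := h' r hr
    exact ⟨l, by simp only [hl]; ring⟩
  -- The time difference is continuous and integer-valued on a connected set, hence constant.
  have hc := hI.image _ (ha.sub ha')
  have hsub : ((fun r => a r - a' r) '' I).Subsingleton :=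
    (Set.countable_range ((↑) : ℤ → ℝ)).isTotallyDisconnected _ hmaps.image_subset hc
  have := hsub (mem_image_of_mem _ hr) (mem_image_of_mem _ hr₀)
  linarith

end Suspension

/-! ### Lifting maps into suspensions -/

section Lift

/-- Local inverses of `p` lift `h` near each point. The base has a basis of clopen sets, so finitely
many such lifts can be made disjoint and glued without any compatibility. -/
lemma exists_continuous_lift {Z E W : Type*} [TopologicalSpace Z] [TopologicalSpace E]
    [TopologicalSpace W] [CompactSpace Z] [T2Space Z] [TotallyDisconnectedSpace Z] {p : E → W}
    (hp : IsLocalHomeomorph p) (hs : Function.Surjective p) {h : Z → W} (hh : Continuous h) :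
    ∃ H : Z → E, Continuous H ∧ ∀ z, p (H z) = h z := by
  classical
  suffices ∃ (V : Set Z) (H : Z → E), IsOpen V ∧ univ ⊆ V ∧ ContinuousOn H V ∧
      ∀ z ∈ V, p (H z) = h z by
    obtain ⟨V, H, -, hV, hH, hpH⟩ := this
    rw [univ_subset_iff] at hV
    subst hV
    exact ⟨H, continuousOn_univ.mp hH, fun z => hpH z (mem_univ z)⟩
  suffices ∃ (V : Set Z) (H : Z → E), IsClopen V ∧ univ ⊆ V ∧ ContinuousOn H V ∧
      ∀ z ∈ V, p (H z) = h z by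
    obtain ⟨V, H, h1, h2⟩ := this
    exact ⟨V, H, h1.isOpen, h2⟩
  refine isCompact_univ.induction_on (p := fun s => ∃ (V : Set Z) (H : Z → E), IsClopen V ∧
    s ⊆ V ∧ ContinuousOn H V ∧ ∀ z ∈ V, p (H z) = h z) ?_ ?_ ?_ ?_
  · exact ⟨∅, fun z => (hs (h z)).choose, isClopen_empty, subset_rfl, continuousOn_empty _,
      fun z hz => hz.elim⟩
  · rintro s t hst ⟨V, H, h1, h2, h3⟩
    exact ⟨V, H, h1, hst.trans h2, h3⟩
  · rintro s t ⟨V, H, hV, hsV, hHc, hH⟩ ⟨V', H', hV', htV, hHc', hH'⟩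
    refine ⟨V ∪ (V' \ V), fun z => if z ∈ V then H z else H' z, ?_, ?_, ?_, ?_⟩
    · exact hV.union (hV'.diff hV)
    · rw [union_sdiff_self]; exact union_subset_union hsV htV
    · refine ContinuousOn.union_of_isOpen ?_ ?_ hV.isOpen (hV'.diff hV).isOpen
      · exact hHc.congr fun z hz => by simp [hz]
      · exact (hHc'.mono sdiff_subset).congr fun z hz => by simp [hz.2]
    · intro z hz
      by_cases hzV : z ∈ V
      · simp [hzV, hH]
      · have : z ∈ V' := by simpa [hzV] using hz
        simp [hzV, hH' z this]
  · intro z _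
    obtain ⟨e, he⟩ := hs (h z)
    obtain ⟨φ, heφ, hφ⟩ := hp e
    have hopen : IsOpen (h ⁻¹' φ.target) := φ.open_target.preimage hh
    have hz : z ∈ h ⁻¹' φ.target := by
      rw [mem_preimage, ← he, hφ]; exact φ.map_source heφ
    obtain ⟨V, hV, hzV, hVs⟩ := compact_exists_isClopen_in_isOpen hopen hz
    refine ⟨V, mem_nhdsWithin_of_mem_nhds (hV.isOpen.mem_nhds hzV), V, fun z => φ.symm (h z), hV,
      subset_rfl, ?_, ?_⟩
    · exact φ.continuousOn_symm.comp hh.continuousOn fun z hz => hVs hz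
    · intro z hz
      rw [hφ]; exact φ.right_inv (hVs hz)

variable {A B : Type*} [TopologicalSpace A] [TopologicalSpace B] [DiscreteTopology A] [Finite A]
  [DiscreteTopology B]
  {X : Subshift A ℤ} {Y : Subshift B ℤ}

/-- A continuous map between suspensions lifts to a continuous map of the covering spaces, with
first coordinate constant along flow lines. -/
lemma exists_suspension_lift {Φ : Suspension X → Suspension Y} (hΦ : Continuous Φ) :
    ∃ (F : X.carrier → Y.carrier) (ψ : X.carrier → ℝ → ℝ), Continuous F ∧
      Continuous (fun p : X.carrier × ℝ => ψ p.1 p.2) ∧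
      ∀ x r, Φ (Suspension.mk X x r) = Suspension.mk Y (F x) (ψ x r) := by
  have hcov := isCoveringMap_suspensionProj (X := Y)
  have hsurj : Function.Surjective (suspensionProj Y) := fun z => by
    obtain ⟨x, t, -, -, rfl⟩ := exists_eq_mk z
    exact ⟨(x, t), rfl⟩
  obtain ⟨H, hHc, hH⟩ := exists_continuous_lift hcov.isLocalHomeomorph hsurj
    (h := fun x : X.carrier => Φ (Suspension.mk X x 0))
    (hΦ.comp (continuous_suspensionProj.comp (Continuous.prodMk_left 0)))
  -- Scaling time by `s ∈ [0, 1]` joins `X × ℝ` to the section at time zero, where a lift is known;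
  -- homotopy lifting carries it to `s = 1`.
  let Θ : C(unitInterval × (X.carrier × ℝ), Suspension Y) :=
    ⟨fun q => Φ (suspensionProj X (q.2.1, q.1 * q.2.2)), hΦ.comp (continuous_suspensionProj.comp
      (by fun_prop))⟩
  let H0 : C(X.carrier × ℝ, Y.carrier × ℝ) := ⟨fun p => H p.1, hHc.comp continuous_fst⟩
  have h0 : ∀ a, Θ (0, a) = suspensionProj Y (H0 a) := by
    intro a
    have := hH a.1
    simp only [suspensionProj] at this
    simp [Θ, H0, suspensionProj, this]
  let G := hcov.liftHomotopy Θ H0 h0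
  have hG : ∀ s a, suspensionProj Y (G (s, a)) = Θ (s, a) := fun s a =>
    congrFun (hcov.liftHomotopy_lifts Θ H0 h0) (s, a)
  have hG0 : ∀ a, G (0, a) = H a.1 := fun a => hcov.liftHomotopy_zero Θ H0 h0 a
  -- The first coordinate of the lift runs along a path in a totally disconnected space.
  have hconst : ∀ a, (G (1, a)).1 = (H a.1).1 := by
    intro a
    rw [← hG0 a]
    have hc : Continuous fun s : unitInterval => (G (s, a)).1 := by fun_prop
    exact (isPreconnected_univ.image _ hc.continuousOn).subsingleton
      (mem_image_of_mem _ (mem_univ _)) (mem_image_of_mem _ (mem_univ _))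
  refine ⟨fun x => (H x).1, fun x r => (G (1, (x, r))).2, hHc.fst, by fun_prop, fun x r => ?_⟩
  change _ = Suspension.mk Y (H (x, r).1).1 _
  rw [← hconst (x, r)]
  have := hG 1 (x, r)
  simp only [Θ, ContinuousMap.coe_mk, Icc.coe_one, one_mul] at this
  exact this.symm

end Lift

/-! ### Flow equivalences and their lifts -/

lemma strictMono_of_strictMonoOn_Icc {f : ℝ → ℝ} {δ : ℝ} (hδ : 0 < δ)
    (h : ∀ n : ℤ, StrictMonoOn f (Icc (δ * n) (δ * (n + 1)))) : StrictMono f := by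
  have key : ∀ (m : ℕ) (r r' : ℝ), r < r' → r' ≤ δ * (⌊r / δ⌋ + 1 + m) → f r < f r' := by
    intro m
    induction m with
    | zero =>
      intro r r' hr hr'
      have h1 : δ * ⌊r / δ⌋ ≤ r := by
        have := mul_le_mul_of_nonneg_left (Int.floor_le (r / δ)) hδ.le
        rwa [mul_div_cancel₀ _ hδ.ne'] at this
      refine h ⌊r / δ⌋ ⟨h1, ?_⟩ ⟨h1.trans hr.le, ?_⟩ hr
      · simp at hr'; linarith
      · simpa using hr'
    | succ m ih =>
      intro r r' hr hr'
      rcases le_or_gt r' (δ * (⌊r / δ⌋ + 1 + m)) with hle | hlt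
      · exact ih r r' hr hle
      · have hrm : r < δ * (⌊r / δ⌋ + 1 + m) := by
          have h2 := mul_lt_mul_of_pos_left (Int.lt_floor_add_one (r / δ)) hδ
          rw [mul_div_cancel₀ _ hδ.ne'] at h2
          nlinarith [Nat.cast_nonneg (α := ℝ) m]
        refine (ih r _ hrm le_rfl).trans (h (⌊r / δ⌋ + 1 + m) ⟨?_, ?_⟩ ⟨?_, ?_⟩ hlt)
        · push_cast; exact le_rfl
        · push_cast; nlinarith
        · push_cast; exact hlt.le
        · push_cast at hr' ⊢; linarith
  intro r r' hr
  obtain ⟨m, hm⟩ := exists_nat_ge ((r' - δ * (⌊r / δ⌋ + 1)) / δ)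
  refine key m r r' hr ?_
  rw [div_le_iff₀ hδ] at hm
  linarith

section FlowEq

variable {A B C : Type*} [TopologicalSpace A] [TopologicalSpace B] [TopologicalSpace C]
  {X : Subshift A ℤ} {Y : Subshift B ℤ} {Z : Subshift C ℤ}

/-- `(F, ψ)` is a lift of `Φ` to the covering spaces, strictly increasing in time. -/
structure IsMonotoneLift (Φ : Suspension X → Suspension Y) (F : X.carrier → Y.carrier)
    (ψ : X.carrier → ℝ → ℝ) : Prop where
  continuous_base : Continuous F
  continuous_time : Continuous (fun p : X.carrier × ℝ => ψ p.1 p.2)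
  map_mk : ∀ x r, Φ (Suspension.mk X x r) = Suspension.mk Y (F x) (ψ x r)
  strictMono : ∀ x, StrictMono (ψ x)

lemma IsMonotoneLift.continuous_time_apply {Φ : Suspension X → Suspension Y}
    {F : X.carrier → Y.carrier} {ψ : X.carrier → ℝ → ℝ} (h : IsMonotoneLift Φ F ψ)
    (x : X.carrier) : Continuous (ψ x) :=
  h.continuous_time.comp (Continuous.prodMk_right x)

lemma IsMonotoneLift.flowEquivalent {Φ : Suspension X ≃ₜ Suspension Y} {F : X.carrier → Y.carrier}
    {ψ : X.carrier → ℝ → ℝ} (h : IsMonotoneLift Φ F ψ) : FlowEquivalent X Y := by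
  refine ⟨Φ, fun x t => ⟨fun r => ψ x (t + r) - ψ x t, fun r r' hr => ?_, fun y t' hy r => ?_⟩⟩
  · have := h.strictMono x (add_lt_add_right hr t)
    simpa using this
  · rw [h.map_mk, Suspension.mk_eq_mk_iff] at hy
    obtain ⟨k, rfl, rfl⟩ := hy
    rw [h.map_mk, Suspension.mk_shiftBy]
    congr 1; ring

lemma FlowEquivalent.trans (h : FlowEquivalent X Y) (h' : FlowEquivalent Y Z) :
    FlowEquivalent X Z := by
  obtain ⟨Φ, hΦ⟩ := h
  obtain ⟨Ψ, hΨ⟩ := h'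
  refine ⟨Φ.trans Ψ, fun x t => ?_⟩
  obtain ⟨φ, hφ, hφ'⟩ := hΦ x t
  obtain ⟨y, t', -, -, hy⟩ := exists_eq_mk (Φ (Suspension.mk X x t))
  obtain ⟨φ', hφ'm, hφ''⟩ := hΨ y t'
  refine ⟨φ' ∘ φ, hφ'm.comp hφ, fun z t'' hz r => ?_⟩
  simp only [Homeomorph.trans_apply] at hz ⊢
  rw [hφ' y t' hy, hφ'' z t'' (hy ▸ hz)]
  rfl

lemma uncountable_Icc {a b : ℝ} (hab : a < b) : ¬ (Icc a b).Countable := by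
  intro h
  have := h.measure_zero MeasureTheory.volume
  rw [Real.volume_Icc, ENNReal.ofReal_eq_zero] at this
  linarith

/-- The lift is locally injective, hence locally strictly monotone. Were it decreasing somewhere,
its difference from the increasing `φ`, not assumed continuous, would be injective and
integer-valued on an interval, which is uncountable. -/
lemma strictMono_lift_of_flow {Φ : Suspension X → Suspension Y} (hinj : Function.Injective Φ)
    {x : X.carrier} {y : Y.carrier} {a : ℝ → ℝ} (ha : Continuous a)
    (h : ∀ r, Φ (Suspension.mk X x r) = Suspension.mk Y y (a r))
    (hflow : ∀ t, ∃ φ : ℝ → ℝ, StrictMono φ ∧ ∀ (y : Y.carrier) (t' : ℝ),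
      Φ (Suspension.mk X x t) = Suspension.mk Y y t' →
        ∀ r : ℝ, Φ (Suspension.mk X x (t + r)) = Suspension.mk Y y (t' + φ r)) :
    StrictMono a := by
  -- On an interval shorter than `1` two times on one flow line with the same class coincide, so
  -- injectivity of `Φ` passes to `a`.
  refine strictMono_of_strictMonoOn_Icc (δ := 1 / 2) (by norm_num) fun n => ?_
  set u : ℝ := 1 / 2 * n with hu
  have hu' : 1 / 2 * ((n : ℝ) + 1) = u + 1 / 2 := by rw [hu]; ring
  rw [hu']
  have hinjOn : InjOn a (Icc u (u + 1 / 2)) := by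
    intro r hr r' hr' he
    have h1 : Suspension.mk X x r = Suspension.mk X x r' := hinj (by rw [h, h, he])
    obtain ⟨k, -, hk⟩ := Suspension.mk_eq_mk_iff.mp h1
    have h2 : (k : ℝ) < 1 := by linarith [hr.2, hr'.1]
    have h3 : (-1 : ℝ) < k := by linarith [hr.1, hr'.2]
    have h4 : k < 1 := by exact_mod_cast h2
    have h5 : -1 < k := by exact_mod_cast h3
    obtain rfl : k = 0 := by lia
    simp [hk]
  rcases ha.continuousOn.strictMonoOn_of_injOn_Icc' (by linarith) hinjOn with hm | hm
  · exact hm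
  exfalso
  obtain ⟨φ, hφ, hφ'⟩ := hflow u
  have hint : ∀ r, ∃ k : ℤ, a u + φ r - a (u + r) = k := by
    intro r
    have := hφ' y (a u) (h u) r
    rw [h, Suspension.mk_eq_mk_iff] at this
    obtain ⟨k, -, hk⟩ := this
    exact ⟨-k, by push_cast; linarith⟩
  have hanti : StrictMonoOn (fun r => a u + φ r - a (u + r)) (Icc 0 (1 / 2)) := by
    intro r hr r' hr' hrr
    have h1 := hφ hrr
    have h2 := hm (a := u + r) ⟨by linarith [hr.1], by linarith [hr.2]⟩ (b := u + r')
      ⟨by linarith [hr'.1], by linarith [hr'.2]⟩ (by linarith)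
    simp only
    linarith
  have hmaps : MapsTo (fun r => a u + φ r - a (u + r)) (Icc 0 (1 / 2)) (range ((↑) : ℤ → ℝ)) :=
    fun r _ => (hint r).imp fun k hk => hk.symm
  exact uncountable_Icc (by norm_num)
    (hmaps.countable_of_injOn hanti.injOn (Set.countable_range _))

variable [DiscreteTopology A] [Finite A] [DiscreteTopology B] [Finite B]

lemma FlowEquivalent.exists_lifts (h : FlowEquivalent X Y) :
    ∃ (Φ : Suspension X ≃ₜ Suspension Y) (F : X.carrier → Y.carrier) (ψ : X.carrier → ℝ → ℝ)
      (G : Y.carrier → X.carrier) (χ : Y.carrier → ℝ → ℝ),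
      IsMonotoneLift Φ F ψ ∧ IsMonotoneLift Φ.symm G χ := by
  obtain ⟨Φ, hΦ⟩ := h
  obtain ⟨F, ψ, hF, hψ, hl⟩ := exists_suspension_lift Φ.continuous
  obtain ⟨G, χ, hG, hχ, hl'⟩ := exists_suspension_lift Φ.symm.continuous
  have hmono : ∀ x, StrictMono (ψ x) := fun x => strictMono_lift_of_flow Φ.injective
    (hψ.comp (Continuous.prodMk_right x)) (hl x) (hΦ x)
  refine ⟨Φ, F, ψ, G, χ, ⟨hF, hψ, hl, hmono⟩, ⟨hG, hχ, hl', fun y t t' htt => ?_⟩⟩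
  -- The composite of both time lifts is `t ↦ t - k`. As one factor is increasing, so is the other,
  -- without flow data for the inverse.
  have hcomp : ∀ t ∈ univ, Suspension.mk Y y (id t) =
      Suspension.mk Y (F (G y)) (ψ (G y) (χ y t)) := by
    intro t _
    rw [← hl, ← hl', Homeomorph.apply_symm_apply]; rfl
  obtain ⟨k, -, hk⟩ := eq_shiftBy_of_mk_eq isPreconnected_univ continuousOn_id
    ((hψ.comp (Continuous.prodMk_right (G y))).comp
      (hχ.comp (Continuous.prodMk_right y))).continuousOn univ_nonempty hcomp
  by_contra hcon
  have h1 := (hmono (G y)).monotone (not_lt.mp hcon)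
  have h2 := hk t (mem_univ t)
  have h3 := hk t' (mem_univ t')
  simp only [Function.comp_apply, id] at h2 h3
  linarith

/-- The definition imposes the order condition only on `Φ`; the lifts supply it for the inverse. -/
lemma FlowEquivalent.symm (h : FlowEquivalent X Y) : FlowEquivalent Y X := by
  obtain ⟨Φ, F, ψ, G, χ, -, h'⟩ := h.exists_lifts
  exact h'.flowEquivalent

end FlowEq

/-! ### Orbit maps with integer cocycles -/

section Cocycle

variable {A B : Type*} [TopologicalSpace A] [TopologicalSpace B]

/-- A continuous map of shift spaces sending orbits to orbits, with a continuous cocycle of time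
changes that grows in the direction of time. -/
structure OrbitMap (X : Subshift A ℤ) (Y : Subshift B ℤ) where
  /-- the map -/
  F : X.carrier → Y.carrier
  /-- the cocycle -/
  N : ℤ → X.carrier → ℤ
  continuous_F : Continuous F
  continuous_N : ∀ i, Continuous (N i)
  N_add : ∀ i j x, N (i + j) x = N i x + N j (shiftBy X i x)
  F_shift : ∀ i x, F (shiftBy X i x) = shiftBy Y (N i x) (F x)
  growth : ∀ L : ℤ, ∃ n : ℕ, ∀ i : ℤ, n ≤ i → ∀ x, L ≤ N i x

variable {X : Subshift A ℤ} {Y : Subshift B ℤ}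

/-- `d` inverts `c` up to shifts. -/
def OrbitMap.IsLeftInverse (d : OrbitMap Y X) (c : OrbitMap X Y) : Prop :=
  ∃ k : X.carrier → ℤ, (∀ x, d.F (c.F x) = shiftBy X (k x) x) ∧
    ∀ i x, d.N (c.N i x) (c.F x) = i + k (shiftBy X i x) - k x

/-- The lifts starting at `x` and at its `i`-th shift cover the same flow line, so they differ by a
deck transformation; its integer is the cocycle. -/
lemma IsMonotoneLift.exists_orbitMap [Finite A] {Φ : Suspension X → Suspension Y}
    {F : X.carrier → Y.carrier} {ψ : X.carrier → ℝ → ℝ} (h : IsMonotoneLift Φ F ψ) :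
    ∃ c : OrbitMap X Y, c.F = F ∧ ∀ (i : ℤ) x r, ψ x (i + r) = ψ (shiftBy X i x) r + c.N i x := by
  have hex : ∀ (i : ℤ) (x : X.carrier), ∃ k : ℤ, F (shiftBy X i x) = shiftBy Y k (F x) ∧
      ∀ r, ψ x (i + r) = ψ (shiftBy X i x) r + k := by
    intro i x
    obtain ⟨k, hk, hk'⟩ := eq_shiftBy_of_mk_eq (I := univ) isPreconnected_univ
      (x := F x) (x' := F (shiftBy X i x)) (a := fun r => ψ x (i + r))
      (a' := ψ (shiftBy X i x)) ((h.continuous_time_apply x).comp (by fun_prop)).continuousOn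
      (h.continuous_time_apply _).continuousOn univ_nonempty (fun r _ => by
        rw [← h.map_mk, ← h.map_mk, Suspension.mk_shiftBy, add_comm])
    exact ⟨k, hk, fun r => by rw [hk' r (mem_univ r)]; ring⟩
  choose N hN hN' using hex
  have hN0 : ∀ i x, (N i x : ℝ) = ψ x i - ψ (shiftBy X i x) 0 := fun i x => by
    have := hN' i x 0
    rw [add_zero] at this
    linarith
  have hc0 : ∀ r, Continuous fun x => ψ x r := fun r =>
    h.continuous_time.comp (Continuous.prodMk_left r)
  refine ⟨⟨F, N, h.continuous_base, fun i => ?_, fun i j x => ?_, hN, fun L => ?_⟩, rfl, hN'⟩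
  · rw [Int.isClosedEmbedding_coe_real.isEmbedding.continuous_iff]
    have : ((↑) : ℤ → ℝ) ∘ N i = fun x => ψ x i - ψ (shiftBy X i x) 0 := funext (hN0 i)
    rw [this]
    exact (hc0 _).sub ((hc0 _).comp (continuous_shiftBy i))
  · have h1 := hN' i x j
    have h2 := hN0 j (shiftBy X i x)
    have h3 := hN0 (i + j) x
    rw [shiftBy_shiftBy, add_comm j i] at h2
    push_cast at h3
    exact_mod_cast (show (N (i + j) x : ℝ) = N i x + N j (shiftBy X i x) by linarith)
  · rcases isEmpty_or_nonempty X.carrier with he | hne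
    · exact ⟨0, fun i _ x => he.elim x⟩
    -- By compactness each unit of time advances the image by at least a fixed `δ > 0`, which gives
    -- uniform growth.
    obtain ⟨x₁, -, hx₁⟩ := isCompact_univ.exists_isMinOn (univ_nonempty (α := X.carrier))
      ((hc0 1).sub (hc0 0)).continuousOn
    set δ : ℝ := ψ x₁ 1 - ψ x₁ 0 with hδ
    have hδ0 : 0 < δ := sub_pos.mpr (h.strictMono x₁ one_pos)
    have hstep : ∀ x, δ ≤ ψ x 1 - ψ x 0 := fun x => hx₁ (mem_univ x)
    obtain ⟨x₂, -, hx₂⟩ := isCompact_univ.exists_isMinOn (univ_nonempty (α := X.carrier))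
      (hc0 0).continuousOn
    obtain ⟨x₃, -, hx₃⟩ := isCompact_univ.exists_isMaxOn (univ_nonempty (α := X.carrier))
      (hc0 0).continuousOn
    have hgrow : ∀ (n : ℕ) x, ψ x 0 + n * δ ≤ ψ x n := by
      intro n
      induction n with
      | zero => intro x; simp
      | succ n ih =>
        intro x
        have h1 := ih x
        have h2 := hstep (shiftBy X n x)
        have h3 := hN' n x 0
        have h4 := hN' n x 1
        push_cast at h3 h4 ⊢
        rw [add_zero] at h3
        linarith
    obtain ⟨m, hm⟩ := exists_nat_ge ((L + ψ x₃ 0 - ψ x₂ 0) / δ)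
    rw [div_le_iff₀ hδ0] at hm
    refine ⟨m, fun i hi x => ?_⟩
    lift i to ℕ using (Int.natCast_nonneg m).trans hi
    have hi' : (m : ℝ) ≤ i := by exact_mod_cast hi
    have h1 := hgrow i x
    have h2 : ψ x₂ 0 ≤ ψ x 0 := hx₂ (mem_univ x)
    have h3 : ψ (shiftBy X i x) 0 ≤ ψ x₃ 0 := hx₃ (mem_univ _)
    have h4 := hN0 i x
    have h5 := mul_le_mul_of_nonneg_right hi' hδ0.le
    push_cast at h4
    exact_mod_cast (show (L : ℝ) ≤ N i x by linarith)

/-- The composite of the two lifts covers the identity, so on each flow line it is a deck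
transformation `k x`. -/
lemma IsMonotoneLift.isLeftInverse {Φ : Suspension X ≃ Suspension Y}
    {F : X.carrier → Y.carrier} {ψ : X.carrier → ℝ → ℝ} {G : Y.carrier → X.carrier}
    {χ : Y.carrier → ℝ → ℝ} (h : IsMonotoneLift Φ F ψ) (h' : IsMonotoneLift Φ.symm G χ)
    {c : OrbitMap X Y} {d : OrbitMap Y X} (hcF : c.F = F) (hdG : d.F = G)
    (hc : ∀ (i : ℤ) x r, ψ x (i + r) = ψ (shiftBy X i x) r + c.N i x)
    (hd : ∀ (i : ℤ) y r, χ y (i + r) = χ (shiftBy Y i y) r + d.N i y) : d.IsLeftInverse c := by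
  subst hcF hdG
  have hex : ∀ x, ∃ k : ℤ, d.F (c.F x) = shiftBy X k x ∧
      ∀ r ∈ univ, (χ (c.F x) ∘ ψ x) r = id r - k := fun x =>
    eq_shiftBy_of_mk_eq isPreconnected_univ continuousOn_id
      ((h'.continuous_time_apply _).comp (h.continuous_time_apply x)).continuousOn univ_nonempty
      fun r _ => by
        rw [Function.comp_apply, ← h'.map_mk, ← h.map_mk]
        exact (Φ.symm_apply_apply _).symm
  choose k hk hk' using hex
  refine ⟨k, hk, fun i x => ?_⟩
  have h1 := hk' x i (mem_univ _)
  have h2 := hk' (shiftBy X i x) 0 (mem_univ _)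
  have h3 := hc i x 0
  rw [add_zero] at h3
  have h4 := hd (c.N i x) (c.F x) (ψ (shiftBy X i x) 0)
  simp only [Function.comp_apply, id] at h1 h2
  rw [← c.F_shift, add_comm (c.N i x : ℝ), ← h3, h1, h2] at h4
  exact_mod_cast (show (d.N (c.N i x) (c.F x) : ℝ) = i + k (shiftBy X i x) - k x by linarith)

lemma FlowEquivalent.exists_orbitMaps [DiscreteTopology A] [Finite A] [DiscreteTopology B]
    [Finite B] (h : FlowEquivalent X Y) :
    ∃ (c : OrbitMap X Y) (d : OrbitMap Y X), d.IsLeftInverse c ∧ c.IsLeftInverse d := by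
  obtain ⟨Φ, F, ψ, G, χ, h1, h2⟩ := h.exists_lifts
  obtain ⟨c, hcF, hc⟩ := h1.exists_orbitMap
  obtain ⟨d, hdG, hd⟩ := h2.exists_orbitMap
  exact ⟨c, d, IsMonotoneLift.isLeftInverse (Φ := Φ.toEquiv) h1 h2 hcF hdG hc hd,
    IsMonotoneLift.isLeftInverse (Φ := Φ.symm.toEquiv) h2 h1 hdG hcF hd hc⟩

end Cocycle

/-! ### Flow equivalence from a return-time tower -/

section Tower

variable {A B : Type*} [TopologicalSpace A] [TopologicalSpace B]
  {X : Subshift A ℤ} {Y : Subshift B ℤ}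

/-- The map `X × ℝ → SY` that stretches the unit of time over `x` by the factor `τ x`. -/
noncomputable def towerMap (f : X.carrier → Y.carrier) (τ : X.carrier → ℕ)
    (p : X.carrier × ℝ) : Suspension Y :=
  Suspension.mk Y (f (shiftBy X ⌊p.2⌋ p.1)) (τ (shiftBy X ⌊p.2⌋ p.1) * Int.fract p.2)

variable {f : X.carrier → Y.carrier} {τ : X.carrier → ℕ}

/-- The right endpoint is included: there `hshift` makes consecutive pieces agree, so they paste to
a continuous map. -/
lemma towerMap_eq (hshift : ∀ x, f (shiftBy X 1 x) = shiftBy Y (τ x) (f x)) (x : X.carrier)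
    (n : ℤ) {r : ℝ} (hr : r ∈ Icc (n : ℝ) (n + 1)) : towerMap f τ (x, r) =
      Suspension.mk Y (f (shiftBy X n x)) (τ (shiftBy X n x) * (r - n)) := by
  rcases hr.2.lt_or_eq with h | h
  · have hfl : ⌊r⌋ = n := Int.floor_eq_iff.mpr ⟨hr.1, h⟩
    simp only [towerMap, hfl, Int.fract]
  · have hfl : ⌊r⌋ = n + 1 := by rw [h]; simp
    have : Int.fract r = 0 := by rw [h]; simp
    simp only [towerMap, hfl, this, mul_zero]
    rw [add_comm n 1, ← shiftBy_shiftBy, hshift, Suspension.mk_shiftBy, h]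
    congr 1; push_cast; ring

lemma continuous_towerMap (hf : Continuous f) (hτ : Continuous τ)
    (hshift : ∀ x, f (shiftBy X 1 x) = shiftBy Y (τ x) (f x)) : Continuous (towerMap f τ) := by
  refine LocallyFinite.continuous
    (f := fun n : ℤ => {p : X.carrier × ℝ | p.2 ∈ Icc (n : ℝ) (n + 1)})
    ?_ ?_ ?_ ?_
  · rintro ⟨x, t⟩
    refine ⟨univ ×ˢ Ioo (t - 1) (t + 1), prod_mem_nhds Filter.univ_mem
      (Ioo_mem_nhds (by linarith) (by linarith)), (finite_Icc ⌊t - 2⌋ ⌈t + 2⌉).subset ?_⟩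
    rintro n ⟨⟨y, r⟩, hn, hr⟩
    simp only [mem_ofPred_eq, mem_Icc, mem_prod, mem_univ, true_and, mem_Ioo] at hn hr
    constructor
    · have := Int.floor_le (t - 2)
      exact_mod_cast this.trans (show t - 2 ≤ (n : ℝ) by linarith)
    · have := Int.le_ceil (t + 2)
      exact_mod_cast (show (n : ℝ) ≤ t + 2 by linarith).trans this
  · refine eq_univ_of_forall fun p => mem_iUnion.mpr ⟨⌊p.2⌋, Int.floor_le _, ?_⟩
    exact (Int.lt_floor_add_one p.2).le
  · exact fun n => isClosed_Icc.preimage continuous_snd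
  · intro n
    refine ContinuousOn.congr (f := fun p : X.carrier × ℝ => suspensionProj Y (f (shiftBy X n p.1),
      τ (shiftBy X n p.1) * (p.2 - n))) ?_ fun p hp => towerMap_eq hshift p.1 n hp
    refine (continuous_suspensionProj.comp ?_).continuousOn
    have h1 : Continuous fun p : X.carrier × ℝ => shiftBy X n p.1 :=
      (continuous_shiftBy n).comp continuous_fst
    have h2 : Continuous fun p : X.carrier × ℝ => (τ (shiftBy X n p.1) : ℝ) :=
      continuous_of_discreteTopology.comp (hτ.comp h1)
    exact (hf.comp h1).prodMk (h2.mul (continuous_snd.sub continuous_const))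

lemma towerMap_shift (x : X.carrier) (t : ℝ) :
    towerMap f τ (x, t + 1) = towerMap f τ (shiftMap X x, t) := by
  simp [towerMap, shiftMap_eq, shiftBy_shiftBy]

/-- The map of suspensions induced by `towerMap`. -/
noncomputable def towerSuspensionMap (f : X.carrier → Y.carrier) (τ : X.carrier → ℕ) :
    Suspension X → Suspension Y :=
  Quot.lift (towerMap f τ) (by rintro _ _ ⟨x, t⟩; exact towerMap_shift x t)

lemma towerSuspensionMap_mk (x : X.carrier) (t : ℝ) :
    towerSuspensionMap f τ (Suspension.mk X x t) = towerMap f τ (x, t) := rfl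

lemma towerSuspensionMap_mk_of_mem (hshift : ∀ x, f (shiftBy X 1 x) = shiftBy Y (τ x) (f x))
    {x : X.carrier} {t : ℝ} (h0 : 0 ≤ t) (h1 : t ≤ 1) :
    towerSuspensionMap f τ (Suspension.mk X x t) = Suspension.mk Y (f x) (τ x * t) := by
  rw [towerSuspensionMap_mk, towerMap_eq hshift x 0 (by simpa using ⟨h0, h1⟩)]
  simp

lemma towerSuspensionMap_bijective (hτ1 : ∀ x, 1 ≤ τ x)
    (hshift : ∀ x, f (shiftBy X 1 x) = shiftBy Y (τ x) (f x))
    (hsurj : ∀ y, ∃ x, ∃ j : ℕ, j < τ x ∧ y = shiftBy Y j (f x))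
    (hinj : ∀ x x' (j : ℕ), j < τ x → f x' = shiftBy Y j (f x) → j = 0 ∧ x = x') :
    Function.Bijective (towerSuspensionMap f τ) := by
  have hτ0 : ∀ x, (0 : ℝ) < τ x := fun x => by exact_mod_cast hτ1 x
  constructor
  · have key : ∀ (x x' : X.carrier) (t t' : ℝ) (k : ℕ), t < 1 → 0 ≤ t' →
        f x' = shiftBy Y k (f x) → τ x' * t' = τ x * t - k → x = x' ∧ t = t' := by
      intro x x' t t' k ht ht' hk hk'
      have hkτ : (k : ℝ) < τ x := by
        have := mul_nonneg (hτ0 x').le ht'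
        nlinarith [hτ0 x]
      obtain ⟨rfl, rfl⟩ := hinj x x' k (by exact_mod_cast hkτ) hk
      refine ⟨rfl, mul_left_cancel₀ (hτ0 x).ne' ?_⟩
      rw [hk']; simp
    intro z z' hzz
    obtain ⟨x, t, h0, h1, rfl⟩ := exists_eq_mk z
    obtain ⟨x', t', h0', h1', rfl⟩ := exists_eq_mk z'
    rw [towerSuspensionMap_mk_of_mem hshift h0 h1.le,
      towerSuspensionMap_mk_of_mem hshift h0' h1'.le] at hzz
    obtain ⟨k, hk, hk'⟩ := Suspension.mk_eq_mk_iff.mp hzz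
    obtain ⟨k, rfl | rfl⟩ := k.eq_nat_or_neg
    · obtain ⟨rfl, rfl⟩ := key x x' t t' k h1 h0' hk (by simpa using hk')
      rfl
    · obtain ⟨rfl, rfl⟩ := key x' x t' t k h1' h0
        (by rw [hk, shiftBy_shiftBy]; simp) (by rw [hk']; push_cast; ring)
      rfl
  · intro w
    obtain ⟨y, u, h0, h1, rfl⟩ := exists_eq_mk w
    obtain ⟨x, j, hj, rfl⟩ := hsurj y
    have hj' : (j : ℝ) + 1 ≤ τ x := by exact_mod_cast hj
    refine ⟨Suspension.mk X x ((u + j) / τ x), ?_⟩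
    rw [towerSuspensionMap_mk_of_mem hshift (by positivity) (by
      rw [div_le_one (hτ0 x)]; linarith), mul_div_cancel₀ _ (hτ0 x).ne', Suspension.mk_shiftBy]
    rfl

variable [DiscreteTopology A] [Finite A] [DiscreteTopology B]

/-- The image of `f` is a cross-section of `Y` with return time `τ`, and each `y` lies on exactly
one level of the tower above it. The stretching map is a continuous bijection from a compact to a
Hausdorff space, and its time lift is affine of slope `τ > 0` on each unit interval. -/
theorem flowEquivalent_of_tower (hf : Continuous f) (hτ : Continuous τ) (hτ1 : ∀ x, 1 ≤ τ x)
    (hshift : ∀ x, f (shiftBy X 1 x) = shiftBy Y (τ x) (f x))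
    (hsurj : ∀ y, ∃ x, ∃ j : ℕ, j < τ x ∧ y = shiftBy Y j (f x))
    (hinj : ∀ x x' (j : ℕ), j < τ x → f x' = shiftBy Y j (f x) → j = 0 ∧ x = x') :
    FlowEquivalent X Y := by
  have hcont : Continuous (towerSuspensionMap f τ) :=
    continuous_quot_lift _ (continuous_towerMap hf hτ hshift)
  let e := Equiv.ofBijective _ (towerSuspensionMap_bijective hτ1 hshift hsurj hinj)
  let Φ : Suspension X ≃ₜ Suspension Y := Continuous.homeoOfEquivCompactToT2 (f := e) hcont
  have hΦ : ∀ x r, Φ (Suspension.mk X x r) = towerMap f τ (x, r) := fun x r => rfl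
  obtain ⟨F, ψ, hF, hψ, hl⟩ := exists_suspension_lift Φ.continuous
  refine IsMonotoneLift.flowEquivalent (Φ := Φ) (F := F) (ψ := ψ) ⟨hF, hψ, hl, fun x => ?_⟩
  refine strictMono_of_strictMonoOn_Icc one_pos fun n => ?_
  rw [one_mul, one_mul]
  obtain ⟨k, -, hk⟩ := eq_shiftBy_of_mk_eq (isPreconnected_Icc (a := (n : ℝ)) (b := n + 1))
    (x := f (shiftBy X n x)) (x' := F x) (a := fun r => τ (shiftBy X n x) * (r - n)) (a' := ψ x)
    (by fun_prop) (hψ.comp (Continuous.prodMk_right x)).continuousOn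
    ⟨n, by simp⟩ (fun r hr => by rw [← towerMap_eq hshift x n hr, ← hΦ, hl])
  intro r hr r' hr' hrr
  rw [hk r hr, hk r' hr']
  have : (0 : ℝ) < τ (shiftBy X n x) := by exact_mod_cast hτ1 _
  nlinarith

end Tower

/-! ### Gap shifts -/

section Gap

/-- Two consecutive ones of `x`, the first at position `i`, are separated by `k` zeros. -/
def HasGap (x : ℤ → Fin 2) (i : ℤ) (k : ℕ) : Prop :=
  x i = 1 ∧ (∀ j, i < j → j < i + k + 1 → x j = 0) ∧ x (i + k + 1) = 1

lemma eq_zero_iff_ne_one {a : Fin 2} : a = 0 ↔ a ≠ 1 := by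
  fin_cases a <;> simp

lemma eq_zero_or_eq_one (a : Fin 2) : a = 0 ∨ a = 1 := by
  fin_cases a <;> simp

lemma occurs_gapWord_iff {x : ℤ → Fin 2} {k : ℕ} : Occurs (gapWord k) x ↔ ∃ i, HasGap x i k := by
  refine exists_congr fun i => ?_
  have hlen : (gapWord k).length = k + 2 := by simp [gapWord]
  have hget : ∀ (j : ℕ) (hj : j < (gapWord k).length), (gapWord k)[j] =
      if j = 0 ∨ j = k + 1 then 1 else 0 := by
    intro j hj
    rw [hlen] at hj
    rcases j with _ | j
    · simp [gapWord]
    · simp only [gapWord, List.getElem_cons_succ, Nat.add_eq_zero_iff, one_ne_zero, and_false,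
        Nat.add_right_cancel_iff, false_or]
      rcases (show j < k ∨ j = k by lia) with h | rfl
      · rw [List.getElem_append_left (by simpa using h)]
        simp [h.ne]
      · rw [List.getElem_append_right (by simp)]
        simp
  constructor
  · intro h
    refine ⟨?_, fun j hj hj' => ?_, ?_⟩
    · have := h 0 (by lia)
      rw [hget] at this
      simpa using this
    · have := h (j - i).toNat (by lia)
      rw [hget, if_neg (by lia), show i + ((j - i).toNat : ℤ) = j by lia] at this
      exact this
    · have := h (k + 1) (by lia)
      rw [hget] at this
      simpa [add_assoc] using this
  · rintro ⟨h1, h2, h3⟩ j hj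
    rw [hget]
    split_ifs with h
    · rcases h with rfl | rfl
      · simpa using h1
      · simpa [add_assoc] using h3
    · exact h2 _ (by lia) (by lia)

lemma mem_gapShift_iff {S : Set ℕ} (hS : S.Infinite) {x : ℤ → Fin 2} :
    x ∈ (gapShift S).carrier ↔ ∀ i k, HasGap x i k → k ∈ S := by
  have h : x ∈ (gapShift S).carrier ↔ ∀ w ∈ gapForbidden S, ¬ Occurs w x := Iff.rfl
  rw [h, gapForbidden, if_neg hS]
  constructor
  · intro h i k hk
    by_contra hkS
    exact h _ ⟨k, hkS, rfl⟩ (occurs_gapWord_iff.mpr ⟨i, hk⟩)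
  · rintro h w ⟨k, hk, rfl⟩ hw
    obtain ⟨i, hi⟩ := occurs_gapWord_iff.mp hw
    exact hk (h i k hi)

lemma mem_gapShift_iff_of_finite {S : Set ℕ} (hS : S.Finite) (hne : S.Nonempty) {x : ℤ → Fin 2} :
    x ∈ (gapShift S).carrier ↔ (∀ i k, HasGap x i k → k ∈ S) ∧
      ∀ i, ∃ j : ℕ, j ≤ sSup S ∧ x (i + j) = 1 := by
  have h : x ∈ (gapShift S).carrier ↔ ∀ w ∈ gapForbidden S, ¬ Occurs w x := Iff.rfl
  rw [h, gapForbidden, if_pos hS]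
  have hrep : ∀ i, (∀ (k : ℕ) (hk : k < (List.replicate (1 + sSup S) (0 : Fin 2)).length),
      x (i + k) = (List.replicate (1 + sSup S) (0 : Fin 2))[k]) ↔ ∀ k ≤ sSup S, x (i + k) = 0 := by
    intro i
    simp only [List.length_replicate, List.getElem_replicate]
    exact ⟨fun h k hk => h k (by lia), fun h k hk => h k (by lia)⟩
  have hbdd : BddAbove S := hS.bddAbove
  constructor
  · intro h
    have h2 : ∀ i, ∃ j : ℕ, j ≤ sSup S ∧ x (i + j) = 1 := by
      intro i
      by_contra hcon
      push Not at hcon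
      exact h _ (Or.inr rfl) ⟨i, (hrep i).mpr fun k hk => eq_zero_iff_ne_one.mpr (hcon k hk)⟩
    refine ⟨fun i k hk => ?_, h2⟩
    by_contra hkS
    refine h _ (Or.inl ⟨k, hkS, ?_, rfl⟩) (occurs_gapWord_iff.mpr ⟨i, hk⟩)
    obtain ⟨j, hj, hj1⟩ := h2 (i + 1)
    have hkle : k ≤ sSup S := by
      by_contra hlt
      have := hk.2.1 (i + 1 + j) (by lia) (by lia)
      rw [this] at hj1
      exact absurd hj1 (by decide)
    exact lt_of_le_of_ne hkle fun he => hkS (he ▸ Nat.sSup_mem hne hbdd)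
  · rintro ⟨h1, h2⟩ w (⟨k, hk, -, rfl⟩ | rfl) hw
    · obtain ⟨i, hi⟩ := occurs_gapWord_iff.mp hw
      exact hk (h1 i k hi)
    · obtain ⟨i, hi⟩ := hw
      obtain ⟨j, hj, hj1⟩ := h2 i
      rw [(hrep i).mp hi j hj] at hj1
      exact absurd hj1 (by decide)

end Gap

/-! ### Sofic gap shifts -/

section Sofic

/-- Edges of the graph are the admissible triples of letter, source state and target state. -/
lemma isSofic_of_states {A : Type} [TopologicalSpace A] [Finite A] {X : Subshift A ℤ} {n : ℕ}
    (E : A → ℕ → ℕ → Prop)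
    (h : ∀ x, x ∈ X.carrier ↔ ∃ s : ℤ → ℕ, (∀ i, s i < n) ∧ ∀ i, E (x i) (s i) (s (i + 1))) :
    IsSofic X := by
  refine ⟨⟨Fin n, {p : A × Fin n × Fin n // E p.1 p.2.1 p.2.2}, inferInstance, inferInstance,
    fun e => e.1.2.1, fun e => e.1.2.2, fun e => e.1.1⟩, ?_⟩
  ext x
  rw [h]
  constructor
  · rintro ⟨s, hs, hE⟩
    exact ⟨fun i => ⟨(x i, ⟨s i, hs i⟩, ⟨s (i + 1), hs (i + 1)⟩), hE i⟩, fun i => rfl, rfl⟩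
  · rintro ⟨e, he, rfl⟩
    refine ⟨fun i => (e i).1.2.1, fun i => (e i).1.2.1.2, fun i => ?_⟩
    have h1 := (e i).2
    have h2 := he i
    simp only at h2
    rw [h2] at h1
    exact h1

/-- The number of zeros directly before position `i`, if a one precedes them. -/
lemma exists_count (x : ℤ → Fin 2) : ∃ d : ℤ → ℕ, ∀ i, (∃ j < i, x j = 1) →
    x (i - 1 - d i) = 1 ∧ ∀ j, i - 1 - d i < j → j < i → x j = 0 := by
  classical
  have hex : ∀ i, ∃ d : ℕ, (∃ j < i, x j = 1) →
      x (i - 1 - d) = 1 ∧ ∀ j, i - 1 - d < j → j < i → x j = 0 := by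
    intro i
    by_cases h : ∃ j < i, x j = 1
    · obtain ⟨j, hj, hj1⟩ := h
      have hne : ∃ d : ℕ, x (i - 1 - d) = 1 := ⟨(i - 1 - j).toNat, by
        rw [show i - 1 - ((i - 1 - j).toNat : ℤ) = j by lia]; exact hj1⟩
      refine ⟨Nat.find hne, fun _ => ⟨Nat.find_spec hne, fun l hl hl' => ?_⟩⟩
      have := Nat.find_min hne (m := (i - 1 - l).toNat) (by lia)
      rw [show i - 1 - ((i - 1 - l).toNat : ℤ) = l by lia] at this
      exact eq_zero_iff_ne_one.mpr this
    · exact ⟨0, fun h' => absurd h' h⟩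
  choose d hd using hex
  exact ⟨d, hd⟩

lemma count_succ {x : ℤ → Fin 2} {i : ℤ} {d d' : ℕ} (hx : x i = 0)
    (h : x (i - 1 - d) = 1 ∧ ∀ j, i - 1 - d < j → j < i → x j = 0)
    (h' : x (i + 1 - 1 - d') = 1 ∧ ∀ j, i + 1 - 1 - d' < j → j < i + 1 → x j = 0) :
    d' = d + 1 := by
  have hne : (0 : Fin 2) ≠ 1 := by decide
  rcases lt_trichotomy d' (d + 1) with hlt | heq | hgt
  · rcases Nat.eq_zero_or_pos d' with rfl | hpos
    · simp [hx] at h'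
    · exact absurd ((h.2 (i + 1 - 1 - d') (by lia) (by lia)).symm.trans h'.1) hne
  · exact heq
  · exact absurd ((h'.2 (i - 1 - d) (by lia) (by lia)).symm.trans h.1) hne

lemma count_succ_one {x : ℤ → Fin 2} {i : ℤ} {d' : ℕ} (hx : x i = 1)
    (h' : x (i + 1 - 1 - d') = 1 ∧ ∀ j, i + 1 - 1 - d' < j → j < i + 1 → x j = 0) : d' = 0 := by
  by_contra hne
  have := h'.2 i (by lia) (by lia)
  rw [hx] at this
  exact absurd this (by decide)

/-- The state is the number of zeros read since the last one; it never exceeds `sSup S`. -/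
lemma isSofic_gapShift_of_finite_of_nonempty {S : Set ℕ} (hS : S.Finite) (hne : S.Nonempty) :
    IsSofic (gapShift S) := by
  have h01 : (0 : Fin 2) ≠ 1 := by decide
  refine isSofic_of_states (n := sSup S + 1)
    (fun a v v' => (a = 0 ∧ v' = v + 1) ∨ (a = 1 ∧ v ∈ S ∧ v' = 0)) fun x => ?_
  rw [mem_gapShift_iff_of_finite hS hne]
  constructor
  · rintro ⟨h1, h2⟩
    obtain ⟨d, hd⟩ := exists_count x
    have hprev : ∀ i, ∃ j < i, x j = 1 := fun i => by
      obtain ⟨j, hj, hj1⟩ := h2 (i - 1 - sSup S)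
      exact ⟨_, by lia, hj1⟩
    refine ⟨d, fun i => ?_, fun i => ?_⟩
    · by_contra hlt
      obtain ⟨j, hj, hj1⟩ := h2 (i - 1 - sSup S)
      have := (hd i (hprev i)).2 (i - 1 - sSup S + j) (by lia) (by lia)
      exact h01 (this.symm.trans hj1)
    · rcases eq_zero_or_eq_one (x i) with hx | hx
      · exact Or.inl ⟨hx, count_succ hx (hd i (hprev i)) (hd (i + 1) (hprev _))⟩
      · refine Or.inr ⟨hx, h1 (i - 1 - d i) (d i) ⟨(hd i (hprev i)).1, fun j hj hj' =>
          (hd i (hprev i)).2 j hj (by lia), ?_⟩, count_succ_one hx (hd (i + 1) (hprev _))⟩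
        rw [show i - 1 - d i + d i + 1 = i by ring]; exact hx
  · rintro ⟨s, hs, hE⟩
    have hzero : ∀ i, x i = 0 → s (i + 1) = s i + 1 := fun i hi =>
      (hE i).elim (fun h => h.2) fun h => absurd (hi.symm.trans h.1) h01
    have hone : ∀ i, x i = 1 → s i ∈ S ∧ s (i + 1) = 0 := fun i hi =>
      (hE i).elim (fun h => absurd (h.1.symm.trans hi) h01) fun h => h.2
    have hrun : ∀ (i : ℤ) (k : ℕ), (∀ j, i ≤ j → j < i + k → x j = 0) → s (i + k) = s i + k := by
      intro i k
      induction k with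
      | zero => simp
      | succ k ih =>
        intro h
        have := hzero (i + k) (h _ (by lia) (by lia))
        rw [ih fun j hj hj' => h j hj (by lia)] at this
        rw [show i + ((k + 1 : ℕ) : ℤ) = i + k + 1 by push_cast; ring, this]; ring
    constructor
    · rintro i k ⟨h1, h2, h3⟩
      have := hrun (i + 1) k fun j hj hj' => h2 j (by lia) (by lia)
      rw [(hone i h1).2, zero_add, show i + 1 + (k : ℤ) = i + k + 1 by ring] at this
      exact this ▸ (hone _ h3).1
    · intro i
      by_contra hcon
      push Not at hcon
      have := hrun i (sSup S + 1) fun j hj hj' => by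
        have := hcon (j - i).toNat (by lia)
        rw [show i + ((j - i).toNat : ℤ) = j by lia] at this
        exact eq_zero_iff_ne_one.mpr this
      have := hs (i + (sSup S + 1 : ℕ))
      lia

lemma isSofic_gapShift_of_finite {S : Set ℕ} (hS : S.Finite) : IsSofic (gapShift S) := by
  rcases S.eq_empty_or_nonempty with rfl | hne
  · have h : gapForbidden ∅ = gapForbidden {0} := by
      simp [gapForbidden]
    have h' : gapShift ∅ = gapShift {0} := by rw [gapShift, gapShift, h]
    rw [h']
    exact isSofic_gapShift_of_finite_of_nonempty (finite_singleton 0) (singleton_nonempty 0)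
  · exact isSofic_gapShift_of_finite_of_nonempty hS hne

/-- The state counts zeros since the last one, and wraps from `K + p` back to `K`; this does not
affect membership in `S`. -/
lemma isSofic_gapShift_of_eventually_periodic {S : Set ℕ} (hS : S.Infinite) {p K : ℕ} (hp : 0 < p)
    (hper : ∀ k, K ≤ k → (k ∈ S ↔ k + p ∈ S)) : IsSofic (gapShift S) := by
  classical
  have h01 : (0 : Fin 2) ≠ 1 := by decide
  have hperm : ∀ (t k : ℕ), K ≤ k → (k ∈ S ↔ k + p * t ∈ S) := by
    intro t
    induction t with
    | zero => simp
    | succ t ih =>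
      intro k hk
      rw [ih k hk, hper _ (by lia), Nat.mul_succ, add_assoc]
  let next : ℕ → ℕ := fun v => if v + 1 < K + p then v + 1 else K
  let st : ℕ → ℕ := fun k => next^[k] 0
  have hst_succ : ∀ k, st (k + 1) = next (st k) := fun k => Function.iterate_succ_apply' _ _ _
  have hst : ∀ k, st k < K + p ∧ ∃ t, k = st k + p * t ∧ (t ≠ 0 → K ≤ st k) := by
    intro k
    induction k with
    | zero => exact ⟨by simp [st]; lia, 0, by simp [st], by simp⟩
    | succ k ih =>
      obtain ⟨h1, t, h2, h3⟩ := ih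
      rw [hst_succ]
      simp only [next]
      split_ifs with h
      · exact ⟨h, t, by lia, fun ht => by have := h3 ht; lia⟩
      · exact ⟨by lia, t + 1, by rw [Nat.mul_succ]; lia, fun _ => le_rfl⟩
  have hstS : ∀ k, st k ∈ S ↔ k ∈ S := by
    intro k
    obtain ⟨h1, t, h2, h3⟩ := hst k
    rcases eq_or_ne t 0 with rfl | ht
    · rw [Nat.mul_zero, add_zero] at h2
      rw [← h2]
    · rw [hperm t _ (h3 ht), ← h2]
  refine isSofic_of_states (n := K + p)
    (fun a v v' => (a = 0 ∧ v' = next v) ∨ (a = 1 ∧ v ∈ S ∧ v' = 0)) fun x => ?_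
  rw [mem_gapShift_iff hS]
  constructor
  · intro hx
    -- Where no one precedes, there is nothing to count from. The state then runs round the cycle,
    -- phased so that a first one, at `i₁`, is met in the state of `k₀ ∈ S`.
    obtain ⟨k₀, hk₀S, hk₀⟩ := hS.exists_gt K
    obtain ⟨d, hd⟩ := exists_count x
    have hi₁ : ∃ i₁ : ℤ, ∀ i, x i = 1 → (∀ j < i, x j ≠ 1) → i = i₁ := by
      by_cases h : ∃ i, x i = 1 ∧ ∀ j < i, x j ≠ 1
      · obtain ⟨i₁, h1, h2⟩ := h
        refine ⟨i₁, fun i hi hi' => ?_⟩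
        rcases lt_trichotomy i i₁ with hlt | heq | hgt
        · exact absurd hi (h2 i hlt)
        · exact heq
        · exact absurd h1 (hi' i₁ hgt)
      · exact ⟨0, fun i hi hi' => absurd ⟨i, hi, hi'⟩ h⟩
    obtain ⟨i₁, hi₁⟩ := hi₁
    have hpos : (0 : ℤ) < p := by exact_mod_cast hp
    let cyc : ℤ → ℕ := fun m => K + ((m - K) % p).toNat
    have hcyc_lt : ∀ m, cyc m < K + p := fun m => by
      have := Int.emod_lt_of_pos (m - K) hpos
      simp only [cyc]; lia
    have hcyc_succ : ∀ m, cyc (m + 1) = next (cyc m) := by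
      intro m
      have h0 := Int.emod_nonneg (m - K) hpos.ne'
      have h1 := Int.emod_lt_of_pos (m - K) hpos
      have h2 : (m + 1 - K) % p = ((m - K) % p + 1) % p := by
        rw [Int.emod_add_emod]; congr 1; ring
      simp only [cyc, next, h2]
      split_ifs with h
      · rw [Int.emod_eq_of_lt (by lia) (by lia)]; lia
      · rw [show (m - K) % p + 1 = p by lia, Int.emod_self]; simp
    have hcyc_k₀ : cyc k₀ ∈ S := by
      have h0 := Int.emod_nonneg ((k₀ : ℤ) - K) hpos.ne'
      have h1 := Int.emod_add_mul_ediv ((k₀ : ℤ) - K) p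
      have h2 : 0 ≤ ((k₀ : ℤ) - K) / p := Int.ediv_nonneg (by lia) hpos.le
      obtain ⟨t, ht⟩ := Int.eq_ofNat_of_zero_le h2
      rw [ht] at h1
      rw [hperm t _ (by simp only [cyc]; lia)]
      have : cyc k₀ + p * t = k₀ := by simp only [cyc]; zify; lia
      rwa [this]
    refine ⟨fun i => if ∃ j < i, x j = 1 then st (d i) else cyc (i - i₁ + k₀), fun i => ?_,
      fun i => ?_⟩
    · dsimp only
      split_ifs
      · exact (hst _).1
      · exact hcyc_lt _
    · dsimp only
      rcases eq_zero_or_eq_one (x i) with hxi | hxi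
      · refine Or.inl ⟨hxi, ?_⟩
        by_cases h : ∃ j < i, x j = 1
        · have h' : ∃ j < i + 1, x j = 1 := h.imp fun j hj => ⟨by lia, hj.2⟩
          rw [if_pos h, if_pos h', count_succ hxi (hd i h) (hd (i + 1) h'), hst_succ]
        · have h' : ¬ ∃ j < i + 1, x j = 1 := by
            rintro ⟨j, hj, hj1⟩
            rcases (show j < i ∨ j = i by lia) with hlt | rfl
            · exact h ⟨j, hlt, hj1⟩
            · exact h01 (hxi.symm.trans hj1)
          rw [if_neg h, if_neg h', ← hcyc_succ]
          congr 1; ring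
      · refine Or.inr ⟨hxi, ?_, ?_⟩
        · by_cases h : ∃ j < i, x j = 1
          · rw [if_pos h, hstS]
            refine hx (i - 1 - d i) (d i) ⟨(hd i h).1, fun j hj hj' =>
              (hd i h).2 j hj (by lia), ?_⟩
            rw [show i - 1 - d i + d i + 1 = i by ring]; exact hxi
          · rw [if_neg h, ← hi₁ i hxi fun j hj hj1 => h ⟨j, hj, hj1⟩]
            simpa using hcyc_k₀
        · have h' : ∃ j < i + 1, x j = 1 := ⟨i, by lia, hxi⟩
          rw [if_pos h', count_succ_one hxi (hd (i + 1) h')]; rfl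
  · rintro ⟨s, hs, hE⟩ i k ⟨h1, h2, h3⟩
    have hrun : ∀ j ≤ k, s (i + 1 + j) = st j := by
      intro j
      induction j with
      | zero =>
        intro _
        rcases hE i with h | h
        · exact absurd (h.1.symm.trans h1) h01
        · simpa [st] using h.2.2
      | succ j ih =>
        intro hj
        rcases hE (i + 1 + j) with h | h
        · rw [ih (by lia), ← hst_succ] at h
          rw [← h.2]; congr 1; push_cast; ring
        · exact absurd ((h2 (i + 1 + j) (by lia) (by lia)).symm.trans h.1) h01
    rcases hE (i + k + 1) with h | h
    · exact absurd (h.1.symm.trans h3) h01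
    · rw [← hstS, ← hrun k le_rfl, show i + 1 + (k : ℤ) = i + k + 1 by ring]
      exact h.2.1

lemma infinite_of_not_isSofic {S : Set ℕ} (hS : ¬ IsSofic (gapShift S)) : S.Infinite :=
  fun h => hS (isSofic_gapShift_of_finite h)

/-- A non-sofic gap set is not eventually mapped into itself by a non-zero translation. -/
lemma eq_zero_of_eventually_add_mem {S : Set ℕ} (hS : ¬ IsSofic (gapShift S)) {c : ℤ} {K : ℕ}
    (h : ∀ s ∈ S, K ≤ s → ∃ t ∈ S, (t : ℤ) = s + c) : c = 0 := by
  by_contra hc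
  have hinf := infinite_of_not_isSofic hS
  set p := c.natAbs with hp
  have hp0 : 0 < p := Int.natAbs_pos.mpr hc
  -- In each residue class modulo `|c|` membership is eventually constant: for `c < 0` absence
  -- propagates upwards, for `c > 0` presence does. So `S` would be eventually periodic.
  have key : ∀ r < p, ∃ L, ∀ k, L ≤ k → k % p = r → (k ∈ S ↔ k + p ∈ S) := by
    intro r hr
    rcases lt_or_gt_of_ne hc with hneg | hpos
    · have hstep : ∀ k, K ≤ k → k + p ∈ S → k ∈ S := by
        intro k hk hkS
        obtain ⟨t, ht, ht'⟩ := h (k + p) hkS (by lia)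
        obtain rfl : t = k := by lia
        exact ht
      by_cases hout : ∃ k, K ≤ k ∧ k % p = r ∧ k ∉ S
      · obtain ⟨k, hk, hkr, hkS⟩ := hout
        have hout' : ∀ t : ℕ, k + p * t ∉ S := by
          intro t
          induction t with
          | zero => simpa using hkS
          | succ t ih => exact fun hmem => ih (hstep _ (by lia)
              (by rwa [Nat.mul_succ, ← add_assoc] at hmem))
        refine ⟨k, fun l hl hlr => ?_⟩
        obtain ⟨t, rfl⟩ : ∃ t, l = k + p * t := by
          have := (Nat.modEq_iff_dvd' hl).mp (show k % p = l % p by rw [hkr, hlr])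
          obtain ⟨t, ht⟩ := this
          exact ⟨t, by lia⟩
        have h1 := hout' t
        have h2 := hout' (t + 1)
        rw [Nat.mul_succ, ← add_assoc] at h2
        simp [h1, h2]
      · push Not at hout
        refine ⟨K, fun l hl hlr => ?_⟩
        have h1 := hout l hl hlr
        have h2 := hout (l + p) (by lia) (by simpa using hlr)
        simp [h1, h2]
    · have hstep : ∀ k, K ≤ k → k ∈ S → k + p ∈ S := by
        intro k hk hkS
        obtain ⟨t, ht, ht'⟩ := h k hkS hk
        obtain rfl : t = k + p := by lia
        exact ht
      by_cases hin : ∃ k, K ≤ k ∧ k % p = r ∧ k ∈ S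
      · obtain ⟨k, hk, hkr, hkS⟩ := hin
        have hin' : ∀ t : ℕ, k + p * t ∈ S := by
          intro t
          induction t with
          | zero => simpa using hkS
          | succ t ih => rw [Nat.mul_succ, ← add_assoc]; exact hstep _ (by lia) ih
        refine ⟨k, fun l hl hlr => ?_⟩
        obtain ⟨t, rfl⟩ : ∃ t, l = k + p * t := by
          have := (Nat.modEq_iff_dvd' hl).mp (show k % p = l % p by rw [hkr, hlr])
          obtain ⟨t, ht⟩ := this
          exact ⟨t, by lia⟩
        have h1 := hin' t
        have h2 := hin' (t + 1)
        rw [Nat.mul_succ, ← add_assoc] at h2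
        simp [h1, h2]
      · push Not at hin
        refine ⟨K, fun l hl hlr => ?_⟩
        have h1 := hin l hl hlr
        have h2 := hin (l + p) (by lia) (by simpa using hlr)
        simp [h1, h2]
  have key' : ∀ r, ∃ L, r < p → ∀ k, L ≤ k → k % p = r → (k ∈ S ↔ k + p ∈ S) := by
    intro r
    by_cases hr : r < p
    · exact (key r hr).imp fun L hL _ => hL
    · exact ⟨0, fun h => absurd h hr⟩
  choose L hL using key'
  refine hS (isSofic_gapShift_of_eventually_periodic hinf hp0
    (K := (Finset.range p).sup L) fun k hk => ?_)
  have hlt := Nat.mod_lt k hp0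
  exact hL (k % p) hlt k ((Finset.le_sup (Finset.mem_range.mpr hlt)).trans hk) rfl

end Sofic

/-! ### Locally constant functions on shift spaces -/

section Window

variable {A : Type*} [TopologicalSpace A] [DiscreteTopology A] {X : Subshift A ℤ}
  {Z : Type*} [TopologicalSpace Z]

lemma continuous_of_window {h : X.carrier → Z} (n : ℕ)
    (H : ∀ x x' : X.carrier, (∀ j : ℤ, -n ≤ j → j ≤ n → x.1 j = x'.1 j) → h x = h x') :
    Continuous h := by
  rw [continuous_iff_continuousAt]
  intro x
  have hU : {x' : X.carrier | ∀ j ∈ Finset.Icc (-n : ℤ) n, x'.1 j = x.1 j} ∈ 𝓝 x :=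
    ((isOpen_cylinder (Finset.Icc (-n : ℤ) n) x.1).preimage
      continuous_subtype_val).mem_nhds fun j _ => rfl
  have hev : (fun _ => h x) =ᶠ[𝓝 x] h := Filter.eventually_of_mem hU fun x' hx' =>
    H x x' fun j h1 h2 => (hx' j (Finset.mem_Icc.mpr ⟨h1, h2⟩)).symm
  exact continuousAt_const.congr hev

lemma exists_window [Finite A] [DiscreteTopology Z] {h : X.carrier → Z} (hh : Continuous h) :
    ∃ n : ℕ, ∀ x x' : X.carrier, (∀ j : ℤ, -n ≤ j → j ≤ n → x.1 j = x'.1 j) → h x = h x' := by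
  have hloc : ∀ x : X.carrier, ∃ n : ℕ, ∀ x' : X.carrier,
      (∀ j : ℤ, -n ≤ j → j ≤ n → x'.1 j = x.1 j) → h x' = h x := by
    intro x
    have hopen : IsOpen (h ⁻¹' {h x}) := (isOpen_discrete _).preimage hh
    obtain ⟨V, hV, hVx⟩ := isOpen_induced_iff.mp hopen
    have hxV : x.1 ∈ V := by
      have : x ∈ Subtype.val ⁻¹' V := hVx ▸ rfl
      exact this
    obtain ⟨I, u, hu, hIu⟩ := isOpen_pi_iff.mp hV x.1 hxV
    refine ⟨I.sup Int.natAbs, fun x' hx' => ?_⟩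
    have : x' ∈ Subtype.val ⁻¹' V := hIu fun j hj => by
      have := Finset.le_sup (f := Int.natAbs) hj
      rw [hx' j (by lia) (by lia)]
      exact (hu j hj).2
    rw [hVx] at this
    exact this
  choose n hn using hloc
  have hcov : (univ : Set X.carrier) ⊆ ⋃ x, {x' : X.carrier | ∀ j ∈ Finset.Icc (-n x : ℤ) (n x),
      x'.1 j = x.1 j} := fun x _ => mem_iUnion.mpr ⟨x, fun j _ => rfl⟩
  obtain ⟨t, ht⟩ := isCompact_univ.elim_finite_subcover _ (fun x =>
    (isOpen_cylinder (Finset.Icc (-n x : ℤ) (n x)) x.1).preimage continuous_subtype_val) hcov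
  refine ⟨t.sup n, fun x x' hxx => ?_⟩
  obtain ⟨z, hz⟩ := mem_iUnion.mp (ht (mem_univ x))
  obtain ⟨hzt, hzx⟩ := mem_iUnion.mp hz
  have hle : n z ≤ t.sup n := Finset.le_sup hzt
  have hzx' : ∀ j : ℤ, -n z ≤ j → j ≤ n z → x.1 j = z.1 j := fun j h1 h2 =>
    hzx j (Finset.mem_Icc.mpr ⟨h1, h2⟩)
  rw [hn z x hzx', hn z x' fun j h1 h2 => by
    rw [← hxx j (by lia) (by lia), hzx' j h1 h2]]

end Window

/-! ### Lengthening the gaps -/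

section Expansion

lemma HasGap.unique {x : ℤ → Fin 2} {i : ℤ} {k l : ℕ} (h : HasGap x i k) (h' : HasGap x i l) :
    k = l := by
  have h01 : (0 : Fin 2) ≠ 1 := by decide
  rcases lt_trichotomy k l with hlt | heq | hgt
  · exact absurd ((h'.2.1 (i + k + 1) (by lia) (by lia)).symm.trans h.2.2) h01
  · exact heq
  · exact absurd ((h.2.1 (i + l + 1) (by lia) (by lia)).symm.trans h'.2.2) h01

lemma exists_hasGap {x : ℤ → Fin 2} {i j : ℤ} (hi : x i = 1) (hij : i < j) (hj : x j = 1) :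
    ∃ k : ℕ, i + k + 1 ≤ j ∧ HasGap x i k := by
  classical
  have hex : ∃ k : ℕ, x (i + k + 1) = 1 := ⟨(j - i - 1).toNat, by
    rw [show i + ((j - i - 1).toNat : ℤ) + 1 = j by lia]; exact hj⟩
  refine ⟨Nat.find hex, ?_, hi, fun l hl hl' => ?_, Nat.find_spec hex⟩
  · have := Nat.find_min' hex (m := (j - i - 1).toNat) (by
      rw [show i + ((j - i - 1).toNat : ℤ) + 1 = j by lia]; exact hj)
    lia
  · have := Nat.find_min hex (m := (l - i - 1).toNat) (by lia)
    rw [show i + ((l - i - 1).toNat : ℤ) + 1 = l by lia] at this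
    exact eq_zero_iff_ne_one.mpr this

lemma hasGap_shift {x : ℤ → Fin 2} {m i : ℤ} {k : ℕ} :
    HasGap (fun j => x (m + j)) i k ↔ HasGap x (m + i) k := by
  simp only [HasGap]
  refine and_congr Iff.rfl (and_congr ⟨fun h j hj hj' => ?_, fun h j hj hj' => ?_⟩ ?_)
  · have := h (j - m) (by lia) (by lia)
    rwa [add_sub_cancel] at this
  · exact h (m + j) (by lia) (by lia)
  · rw [add_assoc, add_assoc, add_assoc]

lemma le_apply_of_step {e : ℤ → ℤ} {w : ℤ → ℕ} (h : ∀ i, e (i + 1) = e i + 1 + w i)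
    {i : ℤ} (hi : 0 ≤ i) : e 0 + i ≤ e i := by
  induction i, hi using Int.leInduction with
  | base => simp
  | succ i _ ih => rw [h]; lia

lemma apply_le_of_step {e : ℤ → ℤ} {w : ℤ → ℕ} (h : ∀ i, e (i + 1) = e i + 1 + w i)
    {i : ℤ} (hi : i ≤ 0) : e i ≤ e 0 + i := by
  induction i, hi using Int.leInductionDown with
  | base => simp
  | pred i _ ih =>
    have := h (i - 1)
    rw [sub_add_cancel] at this
    lia

lemma exists_between_of_step {e : ℤ → ℤ} {w : ℤ → ℕ}
    (h : ∀ i, e (i + 1) = e i + 1 + w i) (m : ℤ) : ∃ i, e i ≤ m ∧ m < e (i + 1) := by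
  have hb : ∃ b : ℤ, ∀ z : ℤ, e z ≤ m → z ≤ b := by
    refine ⟨max (m - e 0) 0, fun z hz => ?_⟩
    rcases le_or_gt 0 z with h0 | h0
    · have := le_apply_of_step h h0; lia
    · lia
  have hex : ∃ z : ℤ, e z ≤ m := ⟨min (m - e 0) 0, by
    have := apply_le_of_step h (i := min (m - e 0) 0) (by lia); lia⟩
  obtain ⟨i, hi, hi'⟩ := Int.exists_greatest_of_bdd hb hex
  refine ⟨i, hi, ?_⟩
  by_contra hcon
  have := hi' (i + 1) (by lia)
  lia

/-- The sequence `y` arises from `x` by inserting `w i` zeros after position `i`, which is moved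
to position `e i`; zeros are inserted only after ones. -/
structure IsExpansion (x y : ℤ → Fin 2) (e : ℤ → ℤ) (w : ℤ → ℕ) : Prop where
  step : ∀ i, e (i + 1) = e i + 1 + w i
  zero : ∀ i, x i = 0 → w i = 0
  one_iff : ∀ m, y m = 1 ↔ ∃ i, e i = m ∧ x i = 1

namespace IsExpansion

variable {x y : ℤ → Fin 2} {e : ℤ → ℤ} {w : ℤ → ℕ} (h : IsExpansion x y e w)

include h

lemma strictMono : StrictMono e := strictMono_int_of_lt_succ fun i => by
  rw [h.step]; lia

lemma apply (i : ℤ) : y (e i) = x i := by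
  rcases eq_zero_or_eq_one (x i) with hx | hx
  · rw [hx, eq_zero_iff_ne_one]
    intro hy
    obtain ⟨j, hj, hj1⟩ := (h.one_iff _).mp hy
    rw [h.strictMono.injective hj, hx] at hj1
    exact absurd hj1 (by decide)
  · rw [hx]; exact (h.one_iff _).mpr ⟨i, rfl, hx⟩

lemma add_of_zero (i : ℤ) (k : ℕ) (hz : ∀ j, i < j → j < i + k + 1 → x j = 0) :
    e (i + k + 1) = e i + w i + k + 1 := by
  induction k with
  | zero =>
    have := h.step i
    simp only [Nat.cast_zero, add_zero]
    lia
  | succ k ih =>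
    have h1 := ih fun j hj hj' => hz j hj (by lia)
    have h2 := h.step (i + k + 1)
    rw [h.zero _ (hz (i + k + 1) (by lia) (by lia))] at h2
    push_cast
    rw [← add_assoc, h2, h1]
    push_cast; ring

lemma hasGap_iff {i : ℤ} {t : ℕ} : HasGap y (e i) t ↔ ∃ s, HasGap x i s ∧ t = s + w i := by
  constructor
  · rintro ⟨h1, h2, h3⟩
    obtain ⟨j, hj, hj1⟩ := (h.one_iff _).mp h3
    rw [h.apply] at h1
    have hij : i < j := h.strictMono.lt_iff_lt.mp (by lia)
    obtain ⟨s, hs, hgap⟩ := exists_hasGap h1 hij hj1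
    have hadd := h.add_of_zero i s hgap.2.1
    refine ⟨s, hgap, ?_⟩
    rcases hs.lt_or_eq with hlt | heq
    · have := h2 (e (i + s + 1)) (by lia) (by rw [← hj]; exact h.strictMono hlt)
      rw [h.apply, hgap.2.2] at this
      exact absurd this (by decide)
    · rw [heq, hj] at hadd; lia
  · rintro ⟨s, ⟨h1, h2, h3⟩, rfl⟩
    have hadd := h.add_of_zero i s h2
    have heq : e i + ((s + w i : ℕ) : ℤ) + 1 = e (i + s + 1) := by rw [hadd]; push_cast; ring
    refine ⟨by rw [h.apply, h1], fun m hm hm' => ?_, by rw [heq, h.apply, h3]⟩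
    rw [eq_zero_iff_ne_one]
    intro hy
    obtain ⟨j, rfl, hj1⟩ := (h.one_iff _).mp hy
    rw [heq] at hm'
    rw [h2 j (h.strictMono.lt_iff_lt.mp hm) (h.strictMono.lt_iff_lt.mp hm')] at hj1
    exact absurd hj1 (by decide)

end IsExpansion

open Classical in
/-- The number of zeros to be inserted after position `i`: `d s` if `i` starts a gap coded by
`s ∈ S`, which has length `g s`, and `a` if no gap starts at the one at `i`. -/
noncomputable def insertion (S : Set ℕ) (g d : ℕ → ℕ) (a : ℕ) (x : ℤ → Fin 2) (i : ℤ) : ℕ :=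
  if x i = 1 then
    if h : ∃ s ∈ S, HasGap x i (g s) then d h.choose else a
  else 0

variable {S : Set ℕ} {g d : ℕ → ℕ} {a : ℕ} {x : ℤ → Fin 2} {i : ℤ}

lemma insertion_of_zero (hx : x i = 0) : insertion S g d a x i = 0 := by
  rw [insertion, if_neg (by rw [hx]; decide)]

lemma insertion_of_hasGap (hg : InjOn g S) {s : ℕ} (hs : s ∈ S) (h : HasGap x i (g s)) :
    insertion S g d a x i = d s := by
  have hex : ∃ s ∈ S, HasGap x i (g s) := ⟨s, hs, h⟩
  rw [insertion, if_pos h.1, dif_pos hex,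
    hg hex.choose_spec.1 hs (hex.choose_spec.2.unique h)]

lemma insertion_of_not_hasGap (hx : x i = 1) (h : ∀ s ∈ S, ¬ HasGap x i (g s)) :
    insertion S g d a x i = a := by
  rw [insertion, if_pos hx, dif_neg (by push Not; exact h)]

lemma insertion_congr (hg : InjOn g S) {x' : ℤ → Fin 2} {i' : ℤ} (hx : x i = x' i')
    (h : ∀ s ∈ S, HasGap x i (g s) ↔ HasGap x' i' (g s)) :
    insertion S g d a x i = insertion S g d a x' i' := by
  rcases eq_zero_or_eq_one (x i) with h0 | h1
  · rw [insertion_of_zero h0, insertion_of_zero (hx ▸ h0)]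
  by_cases hex : ∃ s ∈ S, HasGap x i (g s)
  · obtain ⟨s, hs, hgap⟩ := hex
    rw [insertion_of_hasGap hg hs hgap, insertion_of_hasGap hg hs ((h s hs).mp hgap)]
  · push Not at hex
    rw [insertion_of_not_hasGap h1 hex, insertion_of_not_hasGap (hx ▸ h1)
      fun s hs hgap => hex s hs ((h s hs).mpr hgap)]

lemma insertion_shift (hg : InjOn g S) (m : ℤ) : insertion S g d a (fun j => x (m + j)) i =
    insertion S g d a x (m + i) :=
  insertion_congr hg rfl fun _ _ => hasGap_shift

/-- Membership in the range of an expansion map can be read off from the expanded sequence. -/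
lemma IsExpansion.mem_range_iff {y : ℤ → Fin 2} {e : ℤ → ℤ} {w : ℤ → ℕ}
    (h : IsExpansion x y e w) (hw : ∀ i, w i = insertion S g d a y (e i)) {m : ℤ} :
    m ∈ range e ↔ ∀ m', y m' = 1 → m' < m → m' + insertion S g d a y m' < m := by
  constructor
  · rintro ⟨j, rfl⟩ m' hm' hlt
    obtain ⟨i, rfl, hi⟩ := (h.one_iff _).mp hm'
    rw [← hw]
    have h1 := h.step i
    have h2 := h.strictMono.monotone (show i + 1 ≤ j from h.strictMono.lt_iff_lt.mp hlt)
    lia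
  · intro H
    obtain ⟨i, hi, hi'⟩ := exists_between_of_step h.step m
    rw [h.step, hw] at hi'
    rcases hi.lt_or_eq with hlt | heq
    · exfalso
      rcases eq_zero_or_eq_one (x i) with hx | hx
      · rw [insertion_of_zero (by rw [h.apply, hx])] at hi'; lia
      · have := H (e i) (by rw [h.apply, hx]) hlt
        lia
    · exact ⟨i, heq⟩

lemma eq_of_strictMono_of_range_eq {e e' : ℤ → ℤ} (he : StrictMono e) (he' : StrictMono e')
    (hr : range e = range e') (h0 : e 0 = e' 0) : e = e' := by
  have key : ∀ {e e' : ℤ → ℤ}, StrictMono e → StrictMono e' → range e = range e' → ∀ i,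
      e i = e' i → e' (i + 1) ≤ e (i + 1) ∧ e (i - 1) ≤ e' (i - 1) := by
    intro e e' he he' hr i hi
    constructor
    · obtain ⟨k, hk⟩ : e (i + 1) ∈ range e' := hr ▸ mem_range_self _
      rw [← hk]
      have : i < k := he'.lt_iff_lt.mp (by rw [hk, ← hi]; exact he (by lia))
      exact he'.monotone this
    · obtain ⟨k, hk⟩ : e (i - 1) ∈ range e' := hr ▸ mem_range_self _
      rw [← hk]
      have : k < i := he'.lt_iff_lt.mp (by rw [hk, ← hi]; exact he (by lia))
      exact he'.monotone (by lia)
  funext i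
  induction i using Int.induction_on with
  | zero => exact h0
  | succ n ih => exact le_antisymm (key he' he hr.symm _ ih.symm).1 (key he he' hr _ ih).1
  | pred n ih => exact le_antisymm (key he he' hr _ ih).2 (key he' he hr.symm _ ih.symm).2

/-- A right inverse of `f` continues the orbit backwards. -/
lemma exists_int_orbit {α : Type*} {f : α → α} (hf : Function.Surjective f) (a : α) :
    ∃ e : ℤ → α, e 0 = a ∧ ∀ i, e (i + 1) = f (e i) := by
  obtain ⟨b, hb⟩ := hf.hasRightInverse
  refine ⟨fun i => match i with
    | Int.ofNat n => f^[n] a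
    | Int.negSucc n => b^[n + 1] a, rfl, fun i => ?_⟩
  match i with
  | Int.ofNat n => exact Function.iterate_succ_apply' f n a
  | Int.negSucc 0 => exact (hb a).symm
  | Int.negSucc (n + 1) =>
    change b^[n + 1] a = f (b^[n + 2] a)
    rw [Function.iterate_succ_apply' b (n + 1), hb]

/-- The partial sums of `w` over `ℤ`, normalized to vanish at `0`. -/
lemma exists_cumulative (w : ℤ → ℕ) : ∃ e : ℤ → ℤ, e 0 = 0 ∧ ∀ i, e (i + 1) = e i + 1 + w i := by
  have hf : Function.Surjective fun p : ℤ × ℤ => (p.1 + 1, p.2 + 1 + w p.1) := fun q =>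
    ⟨(q.1 - 1, q.2 - 1 - w (q.1 - 1)), by ext <;> simp; ring⟩
  obtain ⟨e, he0, he⟩ := exists_int_orbit hf (0, 0)
  have h1 : ∀ i, (e i).1 = i := by
    intro i
    induction i using Int.induction_on with
    | zero => rw [he0]
    | succ n ih => rw [he, ih]
    | pred n ih =>
      have := he (-n - 1)
      rw [sub_add_cancel] at this
      rw [this] at ih
      dsimp only at ih
      lia
  refine ⟨fun i => (e i).2, by simp [he0], fun i => ?_⟩
  simp only [he, h1]

lemma eq_of_step {e e' : ℤ → ℤ} {w : ℤ → ℕ} (he : ∀ i, e (i + 1) = e i + 1 + w i)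
    (he' : ∀ i, e' (i + 1) = e' i + 1 + w i) (i : ℤ) : e i - e 0 = e' i - e' 0 := by
  induction i using Int.induction_on with
  | zero => simp
  | succ n ih => rw [he, he']; lia
  | pred n ih =>
    have h1 := he (-n - 1)
    have h2 := he' (-n - 1)
    rw [sub_add_cancel] at h1 h2
    lia

end Expansion

/-! ### Flow equivalence by insertion of zeros -/

section ExpansionFlow

variable {S : Set ℕ} {d : ℕ → ℕ} {a : ℕ} {x y : ℤ → Fin 2} {e : ℤ → ℤ} {w : ℤ → ℕ}

/-- Injectivity of `s ↦ s + d s` lets the old gap be recovered from the new one, so the expanded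
sequence itself shows what was inserted. -/
lemma IsExpansion.insertion_eq (h : IsExpansion x y e w) (hS : S.Infinite)
    (hinj : InjOn (fun s => s + d s) S) (hx : x ∈ (gapShift S).carrier)
    (hw : ∀ i, w i = insertion S id d a x i) (i : ℤ) :
    w i = insertion S (fun s => s + d s) d a y (e i) := by
  rw [mem_gapShift_iff hS] at hx
  rcases eq_zero_or_eq_one (x i) with h0 | h1
  · rw [hw, insertion_of_zero h0, insertion_of_zero (by rw [h.apply, h0])]
  by_cases hex : ∃ s, HasGap x i s
  · obtain ⟨s, hs⟩ := hex
    have hsS := hx i s hs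
    have hwi := (hw i).trans (insertion_of_hasGap (injOn_id S) hsS hs)
    rw [hwi, insertion_of_hasGap hinj hsS]
    exact h.hasGap_iff.mpr ⟨s, hs, by rw [hwi]⟩
  · push Not at hex
    rw [hw, insertion_of_not_hasGap (g := id) h1 fun s _ => hex s, insertion_of_not_hasGap]
    · rw [h.apply, h1]
    · intro s _ hgap
      obtain ⟨s', hs', -⟩ := h.hasGap_iff.mp hgap
      exact hex s' hs'

lemma IsExpansion.mem_gapShift (h : IsExpansion x y e w) (hS : S.Infinite)
    (hT : ((fun s => s + d s) '' S).Infinite) (hx : x ∈ (gapShift S).carrier)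
    (hw : ∀ i, w i = insertion S id d a x i) :
    y ∈ (gapShift ((fun s => s + d s) '' S)).carrier := by
  rw [mem_gapShift_iff hS] at hx
  rw [mem_gapShift_iff hT]
  intro m t ht
  obtain ⟨i, rfl, -⟩ := (h.one_iff m).mp ht.1
  obtain ⟨s, hs, rfl⟩ := h.hasGap_iff.mp ht
  exact ⟨s, hx i s hs, by
    simp only [hw, insertion_of_hasGap (injOn_id S) (hx i s hs) hs]⟩

lemma IsExpansion.mem_gapShift_of_insertion (h : IsExpansion x y e w) (hS : S.Infinite)
    (hinj : InjOn (fun s => s + d s) S) (hT : ((fun s => s + d s) '' S).Infinite)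
    (hy : y ∈ (gapShift ((fun s => s + d s) '' S)).carrier)
    (hw : ∀ i, w i = insertion S (fun s => s + d s) d a y (e i)) :
    x ∈ (gapShift S).carrier ∧ ∀ i, w i = insertion S id d a x i := by
  rw [mem_gapShift_iff hT] at hy
  have key : ∀ i s, HasGap x i s → s ∈ S ∧ w i = d s := by
    intro i s hs
    have hgap : HasGap y (e i) (s + w i) := h.hasGap_iff.mpr ⟨s, hs, rfl⟩
    obtain ⟨s', hs', he⟩ := hy _ _ hgap
    have hwi := hw i
    rw [insertion_of_hasGap (g := fun s => s + d s) hinj hs' (by simpa only [he] using hgap)] at hwi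
    dsimp only at he
    obtain rfl : s' = s := by lia
    exact ⟨hs', hwi⟩
  refine ⟨(mem_gapShift_iff hS).mpr fun i s hs => (key i s hs).1, fun i => ?_⟩
  rcases eq_zero_or_eq_one (x i) with h0 | h1
  · rw [insertion_of_zero h0, h.zero i h0]
  by_cases hex : ∃ s, HasGap x i s
  · obtain ⟨s, hs⟩ := hex
    rw [(key i s hs).2, insertion_of_hasGap (injOn_id S) (key i s hs).1 hs]
  · push Not at hex
    rw [insertion_of_not_hasGap (g := id) h1 fun s _ => hex s, hw, insertion_of_not_hasGap]
    · rw [h.apply, h1]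
    · intro s _ hgap
      obtain ⟨s', hs', -⟩ := h.hasGap_iff.mp hgap
      exact hex s' hs'

/-- Deleting the inserted blocks undoes an expansion. The last two conditions place position `0` of
`y` in the stretch belonging to index `0`, that is, at a level of the tower. -/
lemma exists_isExpansion (hinj : InjOn (fun s => s + d s) S)
    (hT : ((fun s => s + d s) '' S).Infinite)
    (hy : y ∈ (gapShift ((fun s => s + d s) '' S)).carrier) :
    ∃ x e w, IsExpansion x y e w ∧ (∀ i, w i = insertion S (fun s => s + d s) d a y (e i)) ∧
      e 0 ≤ 0 ∧ 0 < e 0 + 1 + w 0 := by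
  rw [mem_gapShift_iff hT] at hy
  set ins := insertion S (fun s => s + d s) d a y with hins
  have hpos : ∀ m, 0 < ins m → y m = 1 := by
    intro m hm
    by_contra hne
    rw [hins, insertion_of_zero (eq_zero_iff_ne_one.mpr hne)] at hm
    exact lt_irrefl _ hm
  have hA : ∀ m m', y m = 1 → y m' = 1 → m < m' → m + ins m < m' := by
    intro m m' hm hm' hlt
    obtain ⟨t, ht, hgap⟩ := exists_hasGap hm hlt hm'
    obtain ⟨s, hs, rfl⟩ := hy m t hgap
    rw [hins, insertion_of_hasGap hinj hs hgap]
    push_cast at ht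
    lia
  -- The positions outside all inserted blocks; `m ↦ m + 1 + ins m` is the successor on them.
  let K : Set ℤ := {m | ∀ m', y m' = 1 → m' < m → m' + ins m' < m}
  have hone : ∀ m, y m = 1 → m ∈ K := fun m hm m' hm' hlt => hA m' m hm' hm hlt
  have hnx : ∀ m ∈ K, m + 1 + ins m ∈ K := by
    intro m hm m' hm' hlt
    rcases lt_trichotomy m' m with h | rfl | h
    · have := hm m' hm' h; lia
    · lia
    · have := hA m m' (hpos m (by lia)) hm' h; lia
  -- Either `m - 1` is kept, or it lies in the block inserted after some earlier one.
  have hP : ∀ m, ∃ k ∈ K, k < m ∧ m ≤ k + 1 + ins k := by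
    intro m
    by_cases hm : m - 1 ∈ K
    · exact ⟨m - 1, hm, by lia, by lia⟩
    · simp only [K, mem_ofPred_eq] at hm
      push Not at hm
      obtain ⟨m', hm', hlt, hle⟩ := hm
      exact ⟨m', hone m' hm', by lia, by lia⟩
  have hsurj : Function.Surjective fun k : K => (⟨k.1 + 1 + ins k.1, hnx k.1 k.2⟩ : K) := by
    rintro ⟨m, hm⟩
    obtain ⟨k, hk, hkm, hmk⟩ := hP m
    refine ⟨⟨k, hk⟩, Subtype.ext ?_⟩
    dsimp only
    rcases Nat.eq_zero_or_pos (ins k) with h0 | h1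
    · lia
    · have := hm k (hpos k h1) hkm; lia
  -- At `m = 1` this reads `k₀ ≤ 0 < k₀ + 1 + ins k₀`.
  obtain ⟨k₀, hk₀, hk₀', hk₀''⟩ := hP 1
  obtain ⟨e, he0, he⟩ := exists_int_orbit hsurj ⟨k₀, hk₀⟩
  have hstep : ∀ i, (e (i + 1)).1 = (e i).1 + 1 + ins (e i).1 := fun i => by rw [he i]
  have hbetween := fun m => exists_between_of_step (e := fun i => (e i).1)
    (w := fun i => ins (e i).1) hstep m
  refine ⟨fun i => y (e i).1, fun i => (e i).1, fun i => ins (e i).1,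
    ⟨hstep, fun i hi => insertion_of_zero hi, fun m => ⟨fun hm => ?_, ?_⟩⟩, fun i => rfl, ?_, ?_⟩
  · obtain ⟨i, hi, hi'⟩ := hbetween m
    refine ⟨i, ?_, ?_⟩
    · by_contra hne
      have hlt : (e i).1 < m := lt_of_le_of_ne hi hne
      rw [hstep] at hi'
      have := hone m hm (e i).1 (hpos _ (by lia)) hlt
      lia
    · by_contra hne
      rcases hi.lt_or_eq with hlt | heq
      · rw [hstep] at hi'
        have := hone m hm (e i).1 (hpos _ (by lia)) hlt
        lia
      · exact hne (heq ▸ hm)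
  · rintro ⟨i, rfl, hi⟩
    exact hi
  · dsimp only; rw [he0]; dsimp only; lia
  · dsimp only; rw [he0]; dsimp only; lia

/-- Long and infinite gaps receive the same number `a` of zeros, so only gaps shorter than `s₀` have
to be told apart. This makes the expansion continuous. -/
lemma insertion_eq_of_agree {s₀ : ℕ} (hd : ∀ s, s₀ ≤ s → d s = a) {x' : ℤ → Fin 2} {i : ℤ}
    (hagree : ∀ j, i ≤ j → j ≤ i + s₀ → x j = x' j) :
    insertion S id d a x i = insertion S id d a x' i := by
  have hgap : ∀ {x x' : ℤ → Fin 2}, (∀ j, i ≤ j → j ≤ i + s₀ → x j = x' j) →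
      ∀ s < s₀, HasGap x i s → HasGap x' i s := by
    rintro x x' hxx s hs ⟨h1, h2, h3⟩
    refine ⟨?_, fun j hj hj' => ?_, ?_⟩
    · rw [← hxx i le_rfl (by lia), h1]
    · rw [← hxx j (by lia) (by lia), h2 j hj hj']
    · rw [← hxx _ (by lia) (by lia), h3]
  have hlarge : ∀ {x : ℤ → Fin 2}, x i = 1 → (∀ s < s₀, s ∈ S → ¬ HasGap x i s) →
      insertion S id d a x i = a := by
    intro x hx hno
    by_cases hex : ∃ s ∈ S, HasGap x i s
    · obtain ⟨s, hs, hgs⟩ := hex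
      rw [insertion_of_hasGap (injOn_id S) hs hgs]
      exact hd s (not_lt.mp fun hlt => hno s hlt hs hgs)
    · push Not at hex
      exact insertion_of_not_hasGap hx hex
  have hi := hagree i le_rfl (by lia)
  rcases eq_zero_or_eq_one (x i) with h0 | h1
  · rw [insertion_of_zero h0, insertion_of_zero (hi ▸ h0)]
  by_cases hex : ∃ s < s₀, s ∈ S ∧ HasGap x i s
  · obtain ⟨s, hs, hsS, hgs⟩ := hex
    rw [insertion_of_hasGap (injOn_id S) hsS hgs,
      insertion_of_hasGap (injOn_id S) hsS (hgap hagree s hs hgs)]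
  · push Not at hex
    rw [hlarge h1 hex, hlarge (hi ▸ h1) fun s hs hsS hgs =>
      hex s hs hsS (hgap (fun j hj hj' => (hagree j hj hj').symm) s hs hgs)]

/-- Lengthening the gap `s` by `d s`, where `d` is eventually constant, gives a flow equivalent
gap shift. -/
theorem flowEquivalent_gapShift_image (hS : S.Infinite) {s₀ : ℕ} (hd : ∀ s, s₀ ≤ s → d s = a)
    (hinj : InjOn (fun s => s + d s) S) :
    FlowEquivalent (gapShift S) (gapShift ((fun s => s + d s) '' S)) := by
  classical
  have hT : ((fun s => s + d s) '' S).Infinite := hS.image hinj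
  set T := (fun s => s + d s) '' S with hTdef
  let w : (gapShift S).carrier → ℤ → ℕ := fun x => insertion S id d a x.1
  choose c hc0 hc using fun x => exists_cumulative (w x)
  have hcm : ∀ x, StrictMono (c x) := fun x =>
    strictMono_int_of_lt_succ fun i => by rw [hc]; lia
  let y : (gapShift S).carrier → ℤ → Fin 2 := fun x m => if ∃ i, c x i = m ∧ x.1 i = 1 then 1 else 0
  have hyone : ∀ x m, y x m = 1 ↔ ∃ i, c x i = m ∧ x.1 i = 1 := fun x m => by simp [y]
  have hexp : ∀ x, IsExpansion x.1 (y x) (c x) (w x) := fun x =>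
    ⟨hc x, fun i hi => insertion_of_zero hi, hyone x⟩
  let f : (gapShift S).carrier → (gapShift T).carrier := fun x =>
    ⟨y x, (hexp x).mem_gapShift hS hT x.2 fun i => rfl⟩
  have hext : ∀ u v : ℤ → Fin 2, (∀ m, u m = 1 ↔ v m = 1) → u = v := by
    intro u v huv
    funext m
    rcases eq_zero_or_eq_one (u m) with h0 | h1
    · rw [h0, eq_comm, eq_zero_iff_ne_one, Ne, ← huv, h0]; decide
    · rw [h1, (huv m).mp h1]
  -- The letter at `0` together with the zeros inserted after it takes time `1 + w x 0`.
  refine flowEquivalent_of_tower (f := f) (τ := fun x => 1 + w x 0) ?_ ?_ (fun x => by lia) ?_ ?_ ?_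
  · refine Continuous.subtype_mk (continuous_pi fun m => ?_) _
    -- Expansion never reduces distances from `0`, so a letter landing at `m` comes from `[-|m|,
    -- |m|]`; a further `s₀` letters fix the insertions.
    refine continuous_of_window (m.natAbs + s₀) fun x x' hxx => ?_
    have hw : ∀ i : ℤ, -m.natAbs ≤ i → i ≤ m.natAbs → w x i = w x' i := fun i h1 h2 =>
      insertion_eq_of_agree hd fun j hj hj' => hxx j (by lia) (by lia)
    have hcx : ∀ n : ℕ, n ≤ m.natAbs → c x n = c x' n ∧ c x (-n) = c x' (-n) := by
      intro n
      induction n with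
      | zero => simp [hc0]
      | succ n ih =>
        intro hn
        obtain ⟨h1, h2⟩ := ih (by lia)
        constructor
        · push_cast
          rw [hc, hc, h1, hw n (by lia) (by lia)]
        · have h3 := hc x (-n - 1)
          have h4 := hc x' (-n - 1)
          rw [sub_add_cancel] at h3 h4
          rw [hw _ (by lia) (by lia)] at h3
          push_cast
          rw [neg_add, ← sub_eq_add_neg]
          lia
    have hcx' : ∀ i : ℤ, -m.natAbs ≤ i → i ≤ m.natAbs → c x i = c x' i := by
      intro i h1 h2
      rcases i.eq_nat_or_neg with ⟨n, rfl | rfl⟩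
      · exact (hcx n (by lia)).1
      · exact (hcx n (by lia)).2
    have hbound : ∀ (x : (gapShift S).carrier) i, c x i = m → -m.natAbs ≤ i ∧ i ≤ m.natAbs := by
      intro x i hi
      rcases le_or_gt 0 i with h0 | h0
      · have := le_apply_of_step (hc x) h0
        rw [hc0] at this; lia
      · have := apply_le_of_step (hc x) h0.le
        rw [hc0] at this; lia
    change y x m = y x' m
    simp only [y]
    congr 1
    refine propext (exists_congr fun i => ⟨?_, ?_⟩)
    · rintro ⟨hi, hi1⟩
      obtain ⟨h1, h2⟩ := hbound x i hi
      rw [← hcx' i h1 h2, ← hxx i (by lia) (by lia)]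
      exact ⟨hi, hi1⟩
    · rintro ⟨hi, hi1⟩
      obtain ⟨h1, h2⟩ := hbound x' i hi
      rw [hcx' i h1 h2, hxx i (by lia) (by lia)]
      exact ⟨hi, hi1⟩
  · refine continuous_of_window s₀ fun x x' hxx => ?_
    rw [show w x 0 = w x' 0 from insertion_eq_of_agree hd fun j hj hj' =>
      hxx j (by lia) (by lia)]
  · intro x
    have hwx : ∀ i, w (shiftBy _ 1 x) i = w x (1 + i) := fun i =>
      insertion_shift (x := x.1) (injOn_id S) 1
    have hcx : ∀ i, c (shiftBy _ 1 x) i = c x (1 + i) - (1 + w x 0 : ℕ) := by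
      intro i
      have := eq_of_step (e := c (shiftBy _ 1 x)) (e' := fun i => c x (1 + i)) (hc _)
        (fun i => by rw [hwx, ← add_assoc, hc]) i
      have h1 := hc x 0
      simp only [hc0, add_zero, zero_add, sub_zero] at this h1
      rw [this, h1]; push_cast; ring
    refine Subtype.ext (hext _ _ fun m => ?_)
    change y (shiftBy _ 1 x) m = 1 ↔ y x ((1 + w x 0 : ℕ) + m) = 1
    rw [hyone, hyone]
    constructor
    · rintro ⟨i, rfl, hi⟩
      exact ⟨1 + i, by rw [hcx]; ring, hi⟩
    · rintro ⟨i, hi, hi1⟩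
      exact ⟨i - 1, by rw [hcx, add_sub_cancel, hi]; ring, by simpa using hi1⟩
  · intro v
    obtain ⟨x, e, u, hx, hu, he0, he1⟩ := exists_isExpansion (a := a) hinj hT v.2
    obtain ⟨hxS, hux⟩ := hx.mem_gapShift_of_insertion hS hinj hT v.2 hu
    have hce : ∀ i, c ⟨x, hxS⟩ i = e i - e 0 := by
      intro i
      have := eq_of_step (hc ⟨x, hxS⟩) (e' := e) (fun i => by rw [hx.step, hux]) i
      rw [hc0] at this; lia
    refine ⟨⟨x, hxS⟩, (-e 0).toNat, ?_, ?_⟩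
    · have : w ⟨x, hxS⟩ 0 = u 0 := (hux 0).symm
      rw [this]; lia
    · refine Subtype.ext (hext _ _ fun m => ?_)
      change v.1 m = 1 ↔ y ⟨x, hxS⟩ ((-e 0).toNat + m) = 1
      rw [hyone, hx.one_iff]
      refine exists_congr fun i => and_congr ?_ Iff.rfl
      rw [hce]; lia
  · intro x x' j hj hff
    have hy' : ∀ m, y x' m = y x (j + m) := fun m => congrFun (congrArg Subtype.val hff) m
    have h' := hexp x'
    have h : IsExpansion x.1 (y x') (fun i => c x i - j) (w x) := by
      refine ⟨fun i => by rw [hc]; ring, fun i hi => insertion_of_zero hi, fun m => ?_⟩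
      rw [hy', hyone]
      refine exists_congr fun i => and_congr ?_ Iff.rfl
      constructor <;> intro h <;> lia
    -- Both expansions produce the same sequence, which determines the set of kept positions. Since
    -- `j` lies below the first return, the kept position at `0` must have index `0`.
    have hr' := fun m => h'.mem_range_iff (m := m) (h'.insertion_eq hS hinj x'.2 fun i => rfl)
    have hr := fun m => h.mem_range_iff (m := m) (h.insertion_eq hS hinj x.2 fun i => rfl)
    have hrange : range (c x') = range (fun i => c x i - j) :=
      Set.ext fun m => (hr' m).trans (hr m).symm
    have h0 : (0 : ℤ) ∈ range (fun i => c x i - j) := by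
      rw [← hrange]; exact ⟨0, hc0 x'⟩
    obtain ⟨i, hi⟩ := h0
    dsimp only at hi
    have hc1 := hc x 0
    rw [hc0] at hc1
    have hi0 : -1 < i := (hcm x).lt_iff_lt.mp (by
      have := apply_le_of_step (hc x) (i := -1) (by lia)
      rw [hc0] at this; lia)
    have hi1 : i < 0 + 1 := (hcm x).lt_iff_lt.mp (by lia)
    obtain rfl : i = 0 := by lia
    rw [hc0] at hi
    obtain rfl : j = 0 := by lia
    refine ⟨rfl, Subtype.ext (funext fun i => ?_)⟩
    have heq := eq_of_strictMono_of_range_eq (hcm x') h.strictMono hrange (by simp [hc0])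
    rw [← h.apply, ← h'.apply, heq]

end ExpansionFlow

/-- Send the exceptional gaps, all below `M`, bijectively onto the block `[M, M + n)` and lengthen
every other gap by `a`; `ha` keeps these above the block, so the map is injective. -/
lemma flowEquivalent_gapShift_normalForm {S S' : Set ℕ} (hS : S.Infinite) (hS' : S' ⊆ S)
    (hfin : (S \ S').Finite) {M a : ℕ} (hM : ∀ s ∈ S \ S', s < M)
    (ha : ∀ s ∈ S', M + (S \ S').ncard ≤ s + a) :
    FlowEquivalent (gapShift S)
      (gapShift ((fun s => s + a) '' S' ∪ Ico M (M + (S \ S').ncard))) := by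
  classical
  rw [ncard_eq_toFinset_card _ hfin] at ha ⊢
  set n := hfin.toFinset.card
  let idx := hfin.toFinset.equivFin
  let d : ℕ → ℕ := fun s => if h : s ∈ hfin.toFinset then M + idx ⟨s, h⟩ - s else a
  have hdF : ∀ s (h : s ∈ hfin.toFinset), s + d s = M + idx ⟨s, h⟩ := by
    intro s h
    have := hM s (hfin.mem_toFinset.mp h)
    simp only [d, dif_pos h]
    exact Nat.add_sub_of_le (this.le.trans (Nat.le_add_right _ _))
  have hdS' : ∀ s, s ∉ hfin.toFinset → d s = a := fun s h => by simp only [d, dif_neg h]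
  have hnot : ∀ s ∈ S', s ∉ hfin.toFinset := fun s hs h => (hfin.mem_toFinset.mp h).2 hs
  have hmem : ∀ s ∈ S, s ∉ hfin.toFinset → s ∈ S' := fun s hs h => by
    by_contra hs'
    exact h (hfin.mem_toFinset.mpr ⟨hs, hs'⟩)
  have himage : (fun s => s + d s) '' S = (fun s => s + a) '' S' ∪ Ico M (M + n) := by
    ext t
    constructor
    · rintro ⟨s, hs, rfl⟩
      dsimp only
      by_cases h : s ∈ hfin.toFinset
      · rw [hdF s h]
        exact Or.inr ⟨by lia, by have := (idx ⟨s, h⟩).2; lia⟩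
      · rw [hdS' s h]
        exact Or.inl ⟨s, hmem s hs h, rfl⟩
    · rintro (⟨s, hs, rfl⟩ | ⟨h1, h2⟩)
      · exact ⟨s, hS' hs, by simp only [hdS' s (hnot s hs)]⟩
      · obtain ⟨⟨s, hs⟩, hi⟩ := idx.surjective ⟨t - M, by lia⟩
        refine ⟨s, (hfin.mem_toFinset.mp hs).1, ?_⟩
        dsimp only
        rw [hdF s hs, hi]
        dsimp only; lia
  rw [← himage]
  refine flowEquivalent_gapShift_image hS (s₀ := M) (a := a) (fun s hs => hdS' s fun h => ?_) ?_
  · exact absurd (hM s (hfin.mem_toFinset.mp h)) (by lia)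
  · intro s hs t ht hst
    dsimp only at hst
    by_cases h : s ∈ hfin.toFinset <;> by_cases h' : t ∈ hfin.toFinset
    · rw [hdF s h, hdF t h', Nat.add_left_cancel_iff, ← Fin.ext_iff] at hst
      simpa using idx.injective hst
    · rw [hdF s h, hdS' t h'] at hst
      have := ha t (hmem t ht h')
      have := (idx ⟨s, h⟩).2
      lia
    · rw [hdF t h', hdS' s h] at hst
      have := ha s (hmem s hs h)
      have := (idx ⟨t, h'⟩).2
      lia
    · rw [hdS' s h, hdS' t h'] at hst
      lia

theorem flowEquivalent_of_translate {S R S' R' : Set ℕ} (hS : S.Infinite) (hR : R.Infinite)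
    (hS' : S' ⊆ S) (hR' : R' ⊆ R) (hfS : (S \ S').Finite) (hfR : (R \ R').Finite)
    (hcard : (S \ S').ncard = (R \ R').ncard) {r : ℤ}
    (hr : (fun s : ℕ => (s : ℤ) + r) '' S' = (fun s : ℕ => (s : ℤ)) '' R') :
    FlowEquivalent (gapShift S) (gapShift R) := by
  obtain ⟨M, hM⟩ := (hfS.union hfR).bddAbove
  set n := (S \ S').ncard
  -- Large enough for `S' + a` to lie above the block, and for `b = a - r` to be a natural number
  -- with `S' + a = R' + b`.
  obtain ⟨a, ha1, ha2⟩ : ∃ a : ℕ, M + 1 + n ≤ a ∧ r ≤ a :=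
    ⟨max (M + 1 + n) r.toNat, le_max_left _ _,
      (Int.self_le_toNat r).trans (by exact_mod_cast le_max_right _ _)⟩
  obtain ⟨b, hb⟩ := Int.eq_ofNat_of_zero_le (sub_nonneg.mpr ha2)
  have himage : (fun s => s + a) '' S' = (fun s => s + b) '' R' := by
    ext t
    constructor
    · rintro ⟨s, hs, rfl⟩
      obtain ⟨u, hu, hu'⟩ : (s : ℤ) + r ∈ (fun s : ℕ => (s : ℤ)) '' R' := hr ▸ ⟨s, hs, rfl⟩
      exact ⟨u, hu, by dsimp only at hu' ⊢; lia⟩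
    · rintro ⟨u, hu, rfl⟩
      obtain ⟨s, hs, hs'⟩ : (u : ℤ) ∈ (fun s : ℕ => (s : ℤ) + r) '' S' := hr ▸ ⟨u, hu, rfl⟩
      exact ⟨s, hs, by dsimp only at hs' ⊢; lia⟩
  have h1 := flowEquivalent_gapShift_normalForm hS hS' hfS (M := M + 1) (a := a)
    (fun s hs => Nat.lt_succ_of_le (hM (Or.inl hs))) (fun s _ => by lia)
  have h2 := flowEquivalent_gapShift_normalForm hR hR' hfR (M := M + 1) (a := b)
    (fun s hs => Nat.lt_succ_of_le (hM (Or.inr hs))) (fun s hs => by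
      obtain ⟨u, -, hu⟩ : s + b ∈ (fun s => s + a) '' S' := himage ▸ ⟨s, hs, rfl⟩
      dsimp only at hu; lia)
  rw [← himage, ← hcard] at h2
  exact h1.trans h2.symm

/-! ### Counting letters by weights of lists -/

section Count

variable {E E' : Type*}

lemma summable_list_prod [Fintype E] {q : E → ℝ} (hq0 : ∀ a, 0 ≤ q a) (hq1 : ∑ a, q a < 1) :
    Summable fun W : List E => (W.map q).prod := by
  rw [← List.equivSigmaTuple.symm.summable_iff]
  have hfib : ∀ n : ℕ, (fun f : Fin n → E =>
      ((fun W : List E => (W.map q).prod) ∘ List.equivSigmaTuple.symm) ⟨n, f⟩) =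
      fun f => ∏ i, q (f i) := by
    intro n
    funext f
    simp [List.equivSigmaTuple, List.map_ofFn, List.prod_ofFn]
  rw [summable_sigma_of_nonneg]
  · refine ⟨fun n => (hasSum_fintype _).summable, ?_⟩
    have : (fun n : ℕ => ∑' f : Fin n → E,
        ((fun W : List E => (W.map q).prod) ∘ List.equivSigmaTuple.symm) ⟨n, f⟩) =
        fun n => (∑ a, q a) ^ n := by
      funext n
      rw [hfib, tsum_fintype, Fintype.sum_pow]
    rw [this]
    exact summable_geometric_of_lt_one (Finset.sum_nonneg fun a _ => hq0 a) hq1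
  · rintro ⟨n, f⟩
    rw [congrFun (hfib n) f]
    exact Finset.prod_nonneg fun i _ => hq0 _

/-- A list is empty or consists of a head and a tail. -/
def listEquivSum (E : Type*) : Unit ⊕ (E × List E) ≃ List E where
  toFun := Sum.elim (fun _ => []) fun p => p.1 :: p.2
  invFun W := match W with
    | [] => Sum.inl ()
    | a :: W => Sum.inr (a, W)
  left_inv p := by rcases p with _ | ⟨a, W⟩ <;> rfl
  right_inv W := by rcases W with _ | ⟨a, W⟩ <;> rfl

lemma tsum_list [Fintype E] {f : List E → ℝ} (hf : Summable f) :
    ∑' W, f W = f [] + ∑ a, ∑' W, f (a :: W) := by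
  have hinj : Function.Injective fun p : E × List E => p.1 :: p.2 := by
    rintro ⟨a, W⟩ ⟨b, V⟩ h
    simpa using h
  have h2 : Summable fun p : E × List E => f (p.1 :: p.2) := hf.comp_injective hinj
  have h3 : HasSum (f ∘ listEquivSum E) (f [] + ∑' p : E × List E, f (p.1 :: p.2)) :=
    HasSum.sum (hasSum_unique _) h2.hasSum
  rw [(Equiv.hasSum_iff (listEquivSum E)).mp h3 |>.tsum_eq, h2.tsum_prod, tsum_fintype]

/-- Splitting off the first letter gives `T = 1 + (∑ q) T` for the sum `T` over all lists. -/
lemma tsum_list_prod [Fintype E] {q : E → ℝ} (hq0 : ∀ a, 0 ≤ q a) (hq1 : ∑ a, q a < 1) :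
    (1 - ∑ a, q a) * ∑' W : List E, (W.map q).prod = 1 := by
  have hs := summable_list_prod hq0 hq1
  have h := tsum_list hs
  simp only [List.map_nil, List.prod_nil, List.map_cons, List.prod_cons, tsum_mul_left,
    ← Finset.sum_mul] at h
  rw [sub_mul, one_mul]
  linarith

/-! ### Transfer matrices of prefix automata -/

open Polynomial Matrix

/-- The states of an automaton remembering the first `m` letters of a list. -/
abbrev Prefix (E : Type*) (m : ℕ) : Type _ := {W : List E // W.length ≤ m}

noncomputable instance [Fintype E] (m : ℕ) : Fintype (Prefix E m) :=
  (List.finite_length_le E m).fintype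

/-- The first `m` letters of a list. -/
def prefixOf (m : ℕ) (W : List E) : Prefix E m := ⟨W.take m, List.length_take_le m W⟩

lemma prefixOf_cons_congr {m : ℕ} {a : E} {W W' : List E} (h : W.take m = W'.take m) :
    prefixOf m (a :: W) = prefixOf m (a :: W') := by
  refine Subtype.ext ?_
  simp only [prefixOf]
  rcases m with _ | m
  · simp
  · have := congrArg (List.take m) h
    simp only [List.take_take] at this
    rw [min_eq_left (by lia)] at this
    simp [this]

variable [Fintype E] [DecidableEq E]

/-- The transfer matrix of the automaton, with weights `z ^ G v a`, subtracted from `z ^ C`. -/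
noncomputable def transferMatrix (m C : ℕ) (G : Prefix E m → E → ℕ) :
    Matrix (Prefix E m) (Prefix E m) ℝ[X] :=
  fun v' v => (if v' = v then X ^ C else 0) -
    ∑ a, if prefixOf m (a :: v.1) = v' then X ^ G v a else 0

lemma transferMatrix_eval (m C : ℕ) (G : Prefix E m → E → ℕ) (z : ℝ) (v' v : Prefix E m) :
    (transferMatrix m C G).map (Polynomial.eval z) v' v = (if v' = v then z ^ C else 0) -
      ∑ a, if prefixOf m (a :: v.1) = v' then z ^ G v a else 0 := by
  simp only [transferMatrix, Matrix.map_apply, eval_sub, eval_finsetSum]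
  congr 1
  · split_ifs <;> simp
  · refine Finset.sum_congr rfl fun a _ => ?_
    split_ifs <;> simp

/-- A left null vector `f` at `z = 1` satisfies `f v = ∑ f (prefixOf m (a :: v))`. Prepending a
letter pushes the old ones back, so each use of this equation shows that `f` depends on one letter
fewer. Thus `f` is constant, and `f = |E| f` with `|E| > 1` gives `f = 0`. -/
lemma det_transferMatrix_one_ne_zero (m C : ℕ) (G : Prefix E m → E → ℕ)
    (hE : 1 < Fintype.card E) : ((transferMatrix m C G).map (Polynomial.eval 1)).det ≠ 0 := by
  intro hdet
  obtain ⟨f, hf0, hf⟩ := Matrix.exists_vecMul_eq_zero_iff.mpr hdet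
  have hfv : ∀ v, f v = ∑ a, f (prefixOf m (a :: v.1)) := by
    intro v
    have h1 := congrFun hf v
    simp only [Matrix.vecMul, dotProduct, transferMatrix_eval, one_pow, mul_sub, Pi.zero_apply,
      Finset.sum_sub_distrib, Finset.mul_sum, mul_ite, mul_one, mul_zero] at h1
    rw [Finset.sum_comm] at h1
    simp only [Finset.sum_ite_eq', Finset.sum_ite_eq, Finset.mem_univ, if_true] at h1
    linarith
  have hconst : ∀ j ≤ m, ∀ v v' : Prefix E m, v.1.take (m - j) = v'.1.take (m - j) →
      f v = f v' := by
    intro j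
    induction j with
    | zero =>
      intro _ v v' h
      rw [Nat.sub_zero, List.take_of_length_le v.2, List.take_of_length_le v'.2] at h
      rw [Subtype.ext h]
    | succ j ih =>
      intro hj v v' h
      rw [hfv v, hfv v']
      refine Finset.sum_congr rfl fun a _ => ih (by lia) _ _ ?_
      simp only [prefixOf, List.take_take, min_eq_left (Nat.sub_le m j)]
      rw [show m - j = m - (j + 1) + 1 by lia, List.take_succ_cons, List.take_succ_cons, h]
  have hconst' : ∀ v v', f v = f v' := fun v v' => hconst m le_rfl v v' (by simp)
  refine hf0 (funext fun v => ?_)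
  have h1 := hfv v
  rw [Finset.sum_congr rfl fun a _ => hconst' (prefixOf m (a :: v.1)) v, Finset.sum_const,
    Finset.card_univ, nsmul_eq_mul] at h1
  have h2 : (1 : ℝ) < Fintype.card E := by exact_mod_cast hE
  have h3 : ((Fintype.card E : ℝ) - 1) * f v = 0 := by linarith
  exact (mul_eq_zero.mp h3).resolve_left (by linarith)

variable [Fintype E']

lemma eval_det_transferMatrix (m C : ℕ) (G : Prefix E m → E → ℕ) (z : ℝ) :
    (transferMatrix m C G).det.eval z = ((transferMatrix m C G).map (Polynomial.eval z)).det :=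
  (Polynomial.evalRingHom z).map_det (transferMatrix m C G)

lemma eval_adjugate_transferMatrix (m C : ℕ) (G : Prefix E m → E → ℕ) (z : ℝ)
    (v o : Prefix E m) : ((transferMatrix m C G).adjugate v o).eval z =
      ((transferMatrix m C G).map (Polynomial.eval z)).adjugate v o :=
  congrFun (congrFun ((Polynomial.evalRingHom z).map_adjugate (transferMatrix m C G)) v) o

/-- Let `u v` be the sum of `z ^ ℓ W` over lists with prefix `v`. Removing the first letter shows
that the transfer matrix sends `u` to a multiple of the basis vector at the empty prefix. Cramer's
rule computes the total `∑ u`, which through `β` is the inverse of `1 - ∑ z ^ wt r`. Small `z`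
ensures convergence. -/
lemma det_transferMatrix_eq (β : List E ≃ List E') (wt : E' → ℕ) (hwt : ∀ r, 1 ≤ wt r)
    (ℓ : List E → ℕ) (hℓ : ∀ W, ℓ W = ((β W).map wt).sum) (m C : ℕ) (G : Prefix E m → E → ℕ)
    (hG : ∀ a W, ℓ (a :: W) + C = G (prefixOf m W) a + ℓ W) {z : ℝ} (hz0 : 0 < z)
    (hz1 : z * Fintype.card E' < 1) (hz2 : z < 1) :
    ((transferMatrix m C G).map (Polynomial.eval z)).det = (1 - ∑ r, z ^ wt r) *
      (z ^ (C + ℓ []) *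
        ∑ v, ((transferMatrix m C G).map (Polynomial.eval z)).adjugate v (prefixOf m [])) := by
  let M := transferMatrix m C G
  let o : Prefix E m := prefixOf m []
  have hq0 : ∀ r, 0 ≤ z ^ wt r := fun r => pow_nonneg hz0.le _
  have hq1 : ∑ r, z ^ wt r < 1 := by
    refine lt_of_le_of_lt (Finset.sum_le_sum (g := fun _ => z) fun r _ => ?_) ?_
    · exact pow_le_of_le_one hz0.le hz2.le (by have := hwt r; lia)
    · rw [Finset.sum_const, Finset.card_univ, nsmul_eq_mul, mul_comm]; exact hz1
  have hprod : ∀ W, z ^ ℓ W = ((β W).map fun r => z ^ wt r).prod := by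
    intro W
    rw [hℓ]
    induction β W with
    | nil => simp
    | cons r V ih => simp [pow_add, ih]
  have hsum : Summable fun W => z ^ ℓ W := by
    simp only [hprod]
    exact (β.summable_iff (f := fun V => (V.map fun r => z ^ wt r).prod)).mpr
      (summable_list_prod hq0 hq1)
  have hK : (1 - ∑ r, z ^ wt r) * ∑' W, z ^ ℓ W = 1 := by
    simp only [hprod]
    rw [β.tsum_eq (fun V => (V.map fun r => z ^ wt r).prod)]
    exact tsum_list_prod hq0 hq1
  let u : Prefix E m → ℝ := fun v => ∑' W, if prefixOf m W = v then z ^ ℓ W else 0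
  have hsumu : ∀ v, Summable fun W => if prefixOf m W = v then z ^ ℓ W else 0 := fun v =>
    Summable.of_nonneg_of_le (fun W => by split_ifs <;> positivity)
      (fun W => by split_ifs <;> [exact le_rfl; positivity]) hsum
  have hu : ∑ v, u v = ∑' W, z ^ ℓ W := by
    rw [← Summable.tsum_finsetSum fun v _ => hsumu v]
    simp
  have hrec : ∀ v', z ^ C * u v' = (if o = v' then z ^ (C + ℓ []) else 0) +
      ∑ v, (∑ a, if prefixOf m (a :: v.1) = v' then z ^ G v a else 0) * u v := by
    intro v'
    simp only [u]
    rw [tsum_list (hsumu v'), mul_add, Finset.mul_sum]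
    congr 1
    · rw [mul_ite, mul_zero, pow_add]
    · simp only [Finset.sum_mul]
      rw [Finset.sum_comm]
      refine Finset.sum_congr rfl fun a _ => ?_
      rw [← tsum_mul_left]
      have : ∀ W, (z ^ C * if prefixOf m (a :: W) = v' then z ^ ℓ (a :: W) else 0) =
          ∑ v, (if prefixOf m (a :: v.1) = v' then z ^ G v a else 0) *
            (if prefixOf m W = v then z ^ ℓ W else 0) := by
        intro W
        simp only [mul_ite, mul_zero, Finset.sum_ite_eq, Finset.mem_univ, if_true]
        rw [prefixOf_cons_congr (W := (prefixOf m W).1) (W' := W) (by simp [prefixOf])]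
        split_ifs
        · rw [← pow_add, ← pow_add, ← hG, add_comm]
        · simp
      simp only [this]
      rw [Summable.tsum_finsetSum fun v _ => (hsumu v).mul_left _]
      simp only [tsum_mul_left]
  have hMu : (M.map (Polynomial.eval z)) *ᵥ u = Pi.single o (z ^ (C + ℓ [])) := by
    funext v'
    simp only [Matrix.mulVec, dotProduct, M, transferMatrix_eval, sub_mul,
      Finset.sum_sub_distrib, ite_mul, zero_mul, Finset.sum_ite_eq, Finset.mem_univ, if_true]
    rw [hrec]
    simp [Pi.single_apply, eq_comm]
  have hdet : (M.map (Polynomial.eval z)).det • u =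
      (M.map (Polynomial.eval z)).adjugate *ᵥ Pi.single o (z ^ (C + ℓ [])) := by
    rw [← hMu, Matrix.mulVec_mulVec, Matrix.adjugate_mul, Matrix.smul_mulVec, Matrix.one_mulVec]
  have hdet' := congrArg (fun f : Prefix E m → ℝ => ∑ v, f v) hdet
  simp only [Pi.smul_apply, smul_eq_mul, ← Finset.mul_sum, hu, Matrix.mulVec_single,
    MulOpposite.smul_eq_mul_unop, MulOpposite.unop_op, Matrix.col_apply, ← Finset.sum_mul]
    at hdet'
  calc (M.map (Polynomial.eval z)).det
      = (1 - ∑ r, z ^ wt r) * ((M.map (Polynomial.eval z)).det * ∑' W, z ^ ℓ W) := by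
        rw [mul_left_comm, hK, mul_one]
    _ = _ := by rw [hdet', mul_comm (∑ v, _)]

/-- A weight-preserving bijection between the lists over two finite alphabets, where on the first
side the increment of the weight by a new letter depends only on boundedly many letters, forces
the alphabets to have the same size. -/
theorem card_eq_of_list_equiv (β : List E ≃ List E') (wt : E' → ℕ) (hwt : ∀ r, 1 ≤ wt r)
    (ℓ : List E → ℕ) (hℓ : ∀ W, ℓ W = ((β W).map wt).sum) (m : ℕ)
    (h : ∀ a W W', W.take m = W'.take m → (ℓ (a :: W) : ℤ) - ℓ W = ℓ (a :: W') - ℓ W')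
    (hE : 1 < Fintype.card E) : Fintype.card E' = Fintype.card E := by
  -- Increments of `ℓ` may be negative; the common factor `z ^ C` makes all exponents natural
  -- numbers.
  let C : ℕ := Finset.univ.sup fun v : Prefix E m => ℓ v.1
  have hC : ∀ v : Prefix E m, ℓ v.1 ≤ C := fun v =>
    Finset.le_sup (f := fun v : Prefix E m => ℓ v.1) (Finset.mem_univ v)
  let G : Prefix E m → E → ℕ := fun v a => ℓ (a :: v.1) + C - ℓ v.1
  let M := transferMatrix m C G
  let P : ℝ[X] := 1 - ∑ r, X ^ wt r
  let o : Prefix E m := prefixOf m []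
  have hPeval : ∀ z, P.eval z = 1 - ∑ r, z ^ wt r := fun z => by
    simp [P, eval_finsetSum]
  have hG : ∀ a W, ℓ (a :: W) + C = G (prefixOf m W) a + ℓ W := by
    intro a W
    have h1 := h a W (W.take m) (by simp)
    have h2 := hC (prefixOf m W)
    simp only [G, prefixOf] at h2 ⊢
    lia
  have hident : ∀ z : ℝ, 0 < z → z * Fintype.card E' < 1 → z < 1 →
      (M.det).eval z = (P * X ^ (C + ℓ []) * ∑ v, M.adjugate v o).eval z := by
    intro z hz0 hz1 hz2
    rw [eval_mul, eval_mul, eval_finsetSum, eval_pow, eval_X, hPeval, mul_assoc]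
    simp only [M, eval_det_transferMatrix, eval_adjugate_transferMatrix]
    exact det_transferMatrix_eq β wt hwt ℓ hℓ m C G hG hz0 hz1 hz2
  -- An identity on an interval of small `z` is one of polynomials, so it may be evaluated at `1`,
  -- outside the region of convergence.
  have hpoly : M.det = P * X ^ (C + ℓ []) * ∑ v, M.adjugate v o := by
    refine Polynomial.eq_of_infinite_eval_eq _ _ ?_
    set ε : ℝ := 1 / (Fintype.card E' + 2) with hε
    have hpos : (0 : ℝ) < Fintype.card E' + 2 := by positivity
    refine (Ioo_infinite (show (0 : ℝ) < ε by positivity)).mono fun z hz => hident z hz.1 ?_ ?_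
    · have h1 := hz.2
      rw [hε, lt_div_iff₀ hpos] at h1
      nlinarith [hz.1]
    · have h1 := hz.2
      rw [hε, lt_div_iff₀ hpos] at h1
      have : (0 : ℝ) ≤ Fintype.card E' := Nat.cast_nonneg _
      nlinarith [hz.1]
  have hdet0 := det_transferMatrix_one_ne_zero m C G hE
  -- At `z = 1` all column sums equal `1 - |E|`. Multiplying by the adjugate gives `det = (1 - |E|)
  -- * ∑ adjugate`, to be compared with `det = (1 - |E'|) * ∑ adjugate`.
  have hcol : (fun _ => (1 : ℝ)) ᵥ* (M.map (Polynomial.eval 1)) =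
      fun _ => 1 - (Fintype.card E : ℝ) := by
    funext v
    simp only [Matrix.vecMul, dotProduct, M, transferMatrix_eval, one_pow, one_mul,
      Finset.sum_sub_distrib]
    rw [Finset.sum_comm]
    simp
  have hadj := congrArg (fun f => f ᵥ* (M.map (Polynomial.eval 1)).adjugate) hcol
  simp only [Matrix.vecMul_vecMul, Matrix.mul_adjugate, Matrix.vecMul_smul, Matrix.vecMul_one]
    at hadj
  have hadj' := congrFun hadj o
  simp only [Pi.smul_apply, smul_eq_mul, mul_one, Matrix.vecMul, dotProduct, ← Finset.mul_sum]
    at hadj'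
  have h1 := congrArg (Polynomial.eval 1) hpoly
  rw [eval_mul, eval_mul, eval_finsetSum, eval_pow, eval_X, one_pow, mul_one, hPeval] at h1
  simp only [M, ← eval_adjugate_transferMatrix, ← eval_det_transferMatrix] at hadj' hdet0
  simp only [one_pow, Finset.sum_const, Finset.card_univ, nsmul_eq_mul, mul_one] at h1
  have h2 : ((Fintype.card E' : ℝ) - Fintype.card E) * M.det.eval 1 = 0 := by
    have h3 : (1 - (Fintype.card E : ℝ)) * M.det.eval 1 =
        (1 - (Fintype.card E' : ℝ)) * M.det.eval 1 := by
      calc _ = (1 - (Fintype.card E' : ℝ)) * ((1 - (Fintype.card E : ℝ)) *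
            ∑ v, (M.adjugate v o).eval 1) := by rw [h1]; ring
        _ = _ := by rw [← hadj']
    linarith
  have h3 := (mul_eq_zero.mp h2).resolve_right hdet0
  exact_mod_cast sub_eq_zero.mp h3

end Count

/-! ### Locality of orbit maps -/

namespace OrbitMap

variable {A B : Type*} [TopologicalSpace A] [TopologicalSpace B] {X : Subshift A ℤ}
  {Y : Subshift B ℤ} (c : OrbitMap X Y)

@[simp] lemma N_zero (x : X.carrier) : c.N 0 x = 0 := by
  have := c.N_add 0 0 x
  rw [add_zero, shiftBy_zero] at this
  lia

lemma N_neg (i : ℤ) (x : X.carrier) : c.N (-i) x = -c.N i (shiftBy X (-i) x) := by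
  have := c.N_add (-i) i x
  rw [neg_add_cancel, N_zero] at this
  lia

lemma N_sub (i j : ℤ) (x : X.carrier) : c.N (i - j) (shiftBy X j x) = c.N i x - c.N j x := by
  have := c.N_add j (i - j) x
  rw [add_sub_cancel] at this
  lia

lemma F_shift_apply (i m : ℤ) (x : X.carrier) :
    (c.F (shiftBy X i x)).1 m = (c.F x).1 (c.N i x + m) := by
  rw [c.F_shift, shiftBy_apply]

lemma N_of_fixed {x : X.carrier} {p : ℤ} (hx : shiftBy X p x = x) (k : ℤ) :
    c.N (p * k) x = k * c.N p x := by
  have hk : ∀ n : ℕ, c.N (p * n) x = n * c.N p x ∧ shiftBy X (p * n) x = x := by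
    intro n
    induction n with
    | zero => simp
    | succ n ih =>
      have h1 : shiftBy X (p * (n + 1)) x = x := by
        rw [mul_add, mul_one, add_comm, ← shiftBy_shiftBy, ih.2, hx]
      refine ⟨?_, by exact_mod_cast h1⟩
      push_cast
      rw [mul_add, mul_one, c.N_add, ih.2, ih.1]
      ring
  obtain ⟨n, rfl | rfl⟩ := k.eq_nat_or_neg
  · exact (hk n).1
  · have h1 : shiftBy X (p * -n) x = x := by
      conv_lhs => rw [← (hk n).2]
      rw [shiftBy_shiftBy, mul_neg, neg_add_cancel, shiftBy_zero]
    rw [mul_neg] at h1 ⊢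
    rw [N_neg, h1, (hk n).1]
    ring

/-- The cocycle and the map depend only on coordinates up to distance `w`. -/
structure IsWindow (w : ℤ) : Prop where
  nonneg : 0 ≤ w
  N_congr : ∀ (i : ℤ) (x x' : X.carrier),
    (∀ j, min 0 i - w ≤ j → j ≤ max 0 i + w → x.1 j = x'.1 j) → c.N i x = c.N i x'
  left : ∀ x x' : X.carrier, (∀ j ≤ w, x.1 j = x'.1 j) → ∀ j ≤ 0, (c.F x).1 j = (c.F x').1 j
  right : ∀ x x' : X.carrier, (∀ j, -w ≤ j → x.1 j = x'.1 j) →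
    ∀ j, 0 ≤ j → (c.F x).1 j = (c.F x').1 j

/-- The cocycle starts at `0`, grows without bound and jumps by at most `C`, so it passes near `j`.
-/
lemma exists_index_right {C : ℤ} (hC : ∀ x, |c.N 1 x| ≤ C) (x : X.carrier) {j : ℤ} (hj : 0 ≤ j) :
    ∃ i, 0 ≤ i ∧ |j - c.N i x| ≤ C := by
  have hex : ∃ n : ℕ, j ≤ c.N n x := by
    obtain ⟨n, hn⟩ := c.growth j
    exact ⟨n, hn n le_rfl x⟩
  classical
  have hspec := Nat.find_spec hex
  have hmin := fun n => Nat.find_min hex (m := n)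
  set n := Nat.find hex
  refine ⟨n, by lia, ?_⟩
  have hC0 : 0 ≤ C := (abs_nonneg _).trans (hC x)
  rcases Nat.eq_zero_or_pos n with h0 | h0
  · rw [h0] at hspec ⊢
    simp only [Nat.cast_zero, N_zero] at hspec ⊢
    rw [abs_le]; lia
  · have h1 := hmin (n - 1) (by lia)
    have h2 := c.N_add (n - 1 : ℕ) 1 x
    rw [show ((n - 1 : ℕ) : ℤ) + 1 = n by lia] at h2
    have h3 := abs_le.mp (hC (shiftBy X (n - 1 : ℕ) x))
    rw [abs_le]; lia

lemma exists_index_left {C : ℤ} (hC : ∀ x, |c.N 1 x| ≤ C) (x : X.carrier) {j : ℤ} (hj : j ≤ 0) :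
    ∃ i, i ≤ 0 ∧ |j - c.N i x| ≤ C := by
  have hex : ∃ n : ℕ, c.N (-n) x ≤ j := by
    obtain ⟨n, hn⟩ := c.growth (-j)
    refine ⟨n, ?_⟩
    rw [N_neg]
    have := hn n le_rfl (shiftBy X (-n) x)
    lia
  classical
  have hspec := Nat.find_spec hex
  have hmin := fun n => Nat.find_min hex (m := n)
  set n := Nat.find hex
  refine ⟨-n, by lia, ?_⟩
  have hC0 : 0 ≤ C := (abs_nonneg _).trans (hC x)
  rcases Nat.eq_zero_or_pos n with h0 | h0
  · rw [h0] at hspec ⊢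
    simp only [Nat.cast_zero, neg_zero, N_zero] at hspec ⊢
    rw [abs_le]; lia
  · have h1 := hmin (n - 1) (by lia)
    have h2 := c.N_add (-n) 1 x
    rw [show (-n : ℤ) + 1 = -((n - 1 : ℕ) : ℤ) by lia] at h2
    have h3 := abs_le.mp (hC (shiftBy X (-n) x))
    rw [abs_le]; lia

/-- By compactness `N 1` and the coordinates of `F` in `[-C, C]` have finite windows. The cocycle
identity extends this to all `N i`, and each coordinate of `F x` is within `C` of some `N i x`, so
it is read off near `i`. -/
lemma exists_isWindow [DiscreteTopology A] [Finite A] [DiscreteTopology B] :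
    ∃ w, c.IsWindow w := by
  obtain ⟨n, hn⟩ := exists_window (c.continuous_N 1)
  obtain ⟨C, hC⟩ : ∃ C : ℤ, ∀ x, |c.N 1 x| ≤ C := by
    have hc : CompactSpace X.carrier := isCompact_iff_compactSpace.mp X.isClosed.isCompact
    obtain ⟨C, hC⟩ := (isCompact_range (c.continuous_N 1).abs).bddAbove
    exact ⟨C, fun x => hC ⟨x, rfl⟩⟩
  have hF : ∀ m : ℤ, ∃ n : ℕ, ∀ x x' : X.carrier,
      (∀ j : ℤ, -n ≤ j → j ≤ n → x.1 j = x'.1 j) → (c.F x).1 m = (c.F x').1 m := fun m =>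
    exists_window (h := fun x => (c.F x).1 m)
      ((continuous_apply m).comp (continuous_subtype_val.comp c.continuous_F))
  choose l hl using hF
  let w : ℕ := n + (Finset.Icc (-C) C).sup l
  have hw : ∀ m, |m| ≤ C → l m ≤ w := fun m hm =>
    (Finset.le_sup (Finset.mem_Icc.mpr (abs_le.mp hm))).trans (Nat.le_add_left _ _)
  have hN : ∀ (i : ℤ) (x x' : X.carrier),
      (∀ j, min 0 i - w ≤ j → j ≤ max 0 i + w → x.1 j = x'.1 j) → c.N i x = c.N i x' := by
    intro i x x'
    induction i with
    | zero => simp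
    | succ i ih =>
      intro h
      rw [c.N_add, c.N_add, ih fun j _ _ => h j (by lia) (by lia),
        hn (shiftBy X i x) (shiftBy X i x') fun j _ _ => h _ (by lia) (by lia)]
    | pred i ih =>
      intro h
      have h1 := ih fun j _ _ => h j (by lia) (by lia)
      have h2 := hn (shiftBy X (-i - 1) x) (shiftBy X (-i - 1) x') fun j _ _ =>
        h _ (by lia) (by lia)
      have h3 := c.N_add (-i - 1) 1 x
      have h4 := c.N_add (-i - 1) 1 x'
      rw [sub_add_cancel] at h3 h4
      lia
  have hFi : ∀ (i m : ℤ) (x x' : X.carrier), |m| ≤ C →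
      (∀ j, min 0 i - w ≤ j → j ≤ max 0 i + w → x.1 j = x'.1 j) →
      (c.F x).1 (c.N i x + m) = (c.F x').1 (c.N i x + m) := by
    intro i m x x' hm h
    rw [← F_shift_apply, hN i x x' h, ← F_shift_apply]
    have := hw m hm
    exact hl m _ _ fun j _ _ => h _ (by lia) (by lia)
  refine ⟨w, by lia, hN, fun x x' h j hj => ?_, fun x x' h j hj => ?_⟩
  · obtain ⟨i, hi, hij⟩ := c.exists_index_left hC x hj
    have := hFi i (j - c.N i x) x x' hij fun j _ _ => h j (by lia)
    rwa [add_sub_cancel] at this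
  · obtain ⟨i, hi, hij⟩ := c.exists_index_right hC x hj
    have := hFi i (j - c.N i x) x x' hij fun j _ _ => h j (by lia)
    rwa [add_sub_cancel] at this

variable {c} {w : ℤ} (hw : c.IsWindow w)
include hw

lemma IsWindow.left_at {x x' : X.carrier} (t t' : ℤ)
    (h : ∀ j ≤ w, x.1 (t + j) = x'.1 (t' + j)) {m : ℤ} (hm : m ≤ 0) :
    (c.F x).1 (c.N t x + m) = (c.F x').1 (c.N t' x' + m) := by
  rw [← F_shift_apply, ← F_shift_apply]
  exact hw.left _ _ h m hm

lemma IsWindow.right_at {x x' : X.carrier} (t t' : ℤ)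
    (h : ∀ j, -w ≤ j → x.1 (t + j) = x'.1 (t' + j)) {m : ℤ} (hm : 0 ≤ m) :
    (c.F x).1 (c.N t x + m) = (c.F x').1 (c.N t' x' + m) := by
  rw [← F_shift_apply, ← F_shift_apply]
  exact hw.right _ _ h m hm

end OrbitMap

/-! ### Gaps in the image of a spliced sequence -/

/-- `x` follows `x₁` up to `k`, and `x₂` placed at `k` from `0` on. -/
def IsSplice {A : Type*} (k : ℤ) (x x₁ x₂ : ℤ → A) : Prop :=
  (∀ j ≤ k, x j = x₁ j) ∧ ∀ j, -k ≤ j → x (k + j) = x₂ j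

lemma isSplice_of_eq {A : Type*} {k : ℤ} {x₁ x₂ q : ℤ → A} (h1 : ∀ j, 0 ≤ j → x₁ j = q j)
    (h2 : ∀ j ≤ 0, x₂ j = q j) (hq : ∀ j, q (j + k) = q j) :
    IsSplice k (fun j => if j ≤ k then x₁ j else x₂ (j - k)) x₁ x₂ := by
  refine ⟨fun j hj => if_pos hj, fun j hj => ?_⟩
  simp only
  split_ifs with h
  · rw [h1 _ (by lia), h2 _ (by lia), add_comm, hq]
  · rw [add_sub_cancel_left]

lemma exists_last_one {x : ℤ → Fin 2} (h : ∃ j, x j = 1) {e : ℤ} (he : ∀ m, 0 ≤ m → x (e + m) = 0) :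
    ∃ a, a < e ∧ x a = 1 ∧ ∀ j, a < j → x j = 0 := by
  have hlt : ∀ j, x j = 1 → j < e := by
    intro j hj
    by_contra hcon
    have := he (j - e) (by lia)
    rw [add_sub_cancel, eq_zero_iff_ne_one] at this
    exact this hj
  obtain ⟨a, ha, ha'⟩ := Int.exists_greatest_of_bdd ⟨e, fun j hj => (hlt j hj).le⟩ h
  refine ⟨a, hlt a ha, ha, fun j hj => eq_zero_iff_ne_one.mpr fun h1 => ?_⟩
  have := ha' j h1
  lia

lemma exists_first_one {x : ℤ → Fin 2} (h : ∃ j, x j = 1) {e : ℤ} (he : ∀ m ≤ 0, x (e + m) = 0) :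
    ∃ b, e < b ∧ x b = 1 ∧ ∀ j, j < b → x j = 0 := by
  have hlt : ∀ j, x j = 1 → e < j := by
    intro j hj
    by_contra hcon
    have := he (j - e) (by lia)
    rw [add_sub_cancel, eq_zero_iff_ne_one] at this
    exact this hj
  obtain ⟨a, ha, ha'⟩ := Int.exists_least_of_bdd ⟨e, fun j hj => (hlt j hj).le⟩ h
  refine ⟨a, hlt a ha, ha, fun j hj => eq_zero_iff_ne_one.mpr fun h1 => ?_⟩
  have := ha' j h1
  lia

lemma shiftBy_mul_eq {A : Type*} [TopologicalSpace A] {X : Subshift A ℤ} {x : X.carrier} {p : ℤ}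
    (hx : shiftBy X p x = x) (k : ℤ) : shiftBy X (p * k) x = x := by
  induction k with
  | zero => simp
  | succ k ih => rw [mul_add, mul_one, add_comm, ← shiftBy_shiftBy, ih, hx]
  | pred k ih =>
    conv_lhs => rw [← hx]
    rw [shiftBy_shiftBy, ← mul_add_one, sub_add_cancel, ih]

namespace OrbitMap

variable {A : Type*} [TopologicalSpace A] {X : Subshift A ℤ} {Y : Subshift (Fin 2) ℤ}
  {c : OrbitMap X Y}

/-- The image of the splice follows that of `x₁` to beyond its last one and, up to translation, that
of `x₂` from before its first one. Each further period of `q` adds `N p q = 1` zero between them, so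
the gap is `k` plus a term depending on the tails. -/
lemma IsWindow.exists_hasGap_of_isSplice {w : ℤ} (hw : c.IsWindow w) {q : X.carrier} {p : ℤ}
    (hp : 1 ≤ p) (hq : shiftBy X p q = q) (hFq : ∀ j, (c.F q).1 j = 0) (hN : c.N p q = 1) :
    ∃ K : ℤ, 1 ≤ K ∧ ∀ x₁ x₂ : X.carrier, (∀ j, 0 ≤ j → x₁.1 j = q.1 j) →
      (∀ j ≤ 0, x₂.1 j = q.1 j) → (∃ j, (c.F x₁).1 j = 1) → (∃ j, (c.F x₂).1 j = 1) →
      ∃ b : ℤ, ∀ k, K ≤ k → ∀ x : X.carrier, IsSplice (p * k) x.1 x₁.1 x₂.1 →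
        ∃ (i : ℤ) (g : ℕ), (g : ℤ) = k + b ∧ HasGap (c.F x).1 i g := by
  have hw0 := hw.nonneg
  set δ := c.N w q - c.N (-w) q with hδ
  -- The term `2 * w` keeps the two windows apart; `|δ|`, with `δ` the image time of `q` over `[-w,
  -- w]`, makes the two controlled halves of the image overlap.
  refine ⟨1 + 2 * w + |δ|, by have := abs_nonneg δ; lia, fun x₁ x₂ h1 h2 hn1 hn2 => ?_⟩
  have hC : ∀ m, 0 ≤ m → (c.F x₁).1 (c.N w x₁ + m) = 0 := fun m hm => by
    rw [hw.right_at (x' := q) w w (fun j hj => h1 _ (by lia)) hm, hFq]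
  have hD : ∀ m ≤ 0, (c.F x₂).1 (c.N (-w) x₂ + m) = 0 := fun m hm => by
    rw [hw.left_at (x' := q) (-w) (-w) (fun j hj => h2 _ (by lia)) hm, hFq]
  obtain ⟨a, hae, ha1, ha0⟩ := exists_last_one hn1 hC
  obtain ⟨b, hbe, hb1, hb0⟩ := exists_first_one hn2 hD
  refine ⟨b + c.N w x₁ - c.N (-w) x₂ - δ - a - 1, fun k hk x hx => ?_⟩
  have hδk := le_abs_self δ
  have hδ0 := abs_nonneg δ
  have hpk : k ≤ p * k := le_mul_of_one_le_left (by lia) hp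
  have hNq : ∀ (n i : ℤ), c.N (p * n + i) q = n + c.N i q := fun n i => by
    rw [c.N_add, shiftBy_mul_eq hq, c.N_of_fixed hq, hN, mul_one]
  have ht1 : c.N (p * k - w) x = c.N w x₁ + k - δ := by
    rw [hw.N_congr (p * k - w) x x₁ fun j _ _ => hx.1 j (by lia)]
    have h3 := c.N_sub (p * k - w) w x₁
    have h4 := c.N_sub (p * k - w) w q
    rw [hw.N_congr (p * k - w - w) (shiftBy X w x₁) (shiftBy X w q)
      fun j _ _ => h1 _ (by lia)] at h3
    have h5 := hNq k (-w)
    rw [← sub_eq_add_neg] at h5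
    lia
  have ht2 : c.N (w - p * k) x₂ = c.N (-w) x₂ - k + δ := by
    have h3 := c.N_sub (w - p * k) (-w) x₂
    have h4 := c.N_sub (w - p * k) (-w) q
    rw [hw.N_congr (w - p * k - -w) (shiftBy X (-w) x₂) (shiftBy X (-w) q)
      fun j _ _ => h2 _ (by lia)] at h3
    have h5 := hNq (-k) w
    rw [mul_neg, neg_add_eq_sub] at h5
    lia
  have hL : ∀ j ≤ c.N w x₁ + k - δ, (c.F x).1 j = (c.F x₁).1 j := by
    intro j hj
    have := hw.left_at (x := x) (x' := x₁) (p * k - w) (p * k - w)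
      (fun j hj => hx.1 _ (by lia)) (m := j - (c.N w x₁ + k - δ)) (by lia)
    rwa [← hw.N_congr (p * k - w) x x₁ fun j _ _ => hx.1 j (by lia), ht1, add_sub_cancel] at this
  have hR : ∀ j, c.N w x₁ ≤ j →
      (c.F x).1 j = (c.F x₂).1 (c.N (-w) x₂ - k + δ + (j - c.N w x₁)) := by
    intro j hj
    have := hw.right_at (x := x) (x' := x₂) w (w - p * k)
      (fun j hj => by
        rw [← hx.2 _ (by lia)]
        lia) (m := j - c.N w x₁) (by lia)
    rwa [hw.N_congr w x x₁ fun j _ _ => hx.1 j (by lia), ht2, add_sub_cancel] at this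
  refine ⟨a, (k + (b + c.N w x₁ - c.N (-w) x₂ - δ - a - 1)).toNat, by lia, ?_,
    fun j hj hj' => ?_, ?_⟩
  · rw [hL a (by lia), ha1]
  · rcases le_total j (c.N w x₁ + k - δ) with h | h
    · rw [hL j h, ha0 j hj]
    · rw [hR j (by lia), hb0 _ (by lia)]
  · rw [hR _ (by lia)]
    exact (congrArg (c.F x₂).1 (by lia)).trans hb1

end OrbitMap

/-- If the zero sequence is not sent to the zero sequence, then the gap set is cofinite. -/
lemma OrbitMap.IsLeftInverse.map_zero {S R : Set ℕ} (hS : ¬ IsSofic (gapShift S))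
    (hR : ¬ IsSofic (gapShift R)) {c : OrbitMap (gapShift S) (gapShift R)}
    {d : OrbitMap (gapShift R) (gapShift S)} (h : d.IsLeftInverse c)
    {x : (gapShift S).carrier} (hx : ∀ j, x.1 j = 0) (j : ℤ) : (c.F x).1 j = 0 := by
  have hSi := infinite_of_not_isSofic hS
  have hRi := infinite_of_not_isSofic hR
  obtain ⟨k, hk, hk'⟩ := h
  have hfix : ∀ i, shiftBy (gapShift S) i x = x := fun i => by
    ext j; rw [shiftBy_apply, hx, hx]
  set q := c.F x with hq_def
  set p := c.N 1 x with hp_def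
  have hp : 1 ≤ p := by
    obtain ⟨n, hn⟩ := c.growth 1
    have h1 := hn (n + 1) (by lia) x
    have h2 := c.N_of_fixed (hfix 1) (n + 1)
    rw [one_mul] at h2
    rw [h2] at h1
    by_contra hcon
    nlinarith
  have hqp : shiftBy (gapShift R) p q = q := by rw [← c.F_shift, hfix]
  have hGq : d.F q = x := by rw [hk, hfix]
  have hGq0 : ∀ j, (d.F q).1 j = 0 := by rw [hGq]; exact hx
  have hM : d.N p q = 1 := by rw [hk', hfix]; lia
  by_contra hj
  have hj1 := (eq_zero_or_eq_one _).resolve_left hj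
  obtain ⟨w, hw⟩ := c.exists_isWindow
  obtain ⟨w', hw'⟩ := d.exists_isWindow
  obtain ⟨K, hK1, hK⟩ := hw'.exists_hasGap_of_isSplice hp hqp hGq0 hM
  have hw0 := hw.nonneg
  -- Moving the single one just outside the window gives images that agree with `q` on a half-line,
  -- while `d` maps them to sequences that contain a one.
  obtain ⟨x₀, hx₀⟩ : ∃ x₀ : (gapShift S).carrier, ∀ j, x₀.1 j = if j = 0 then 1 else 0 := by
    refine ⟨⟨fun j => if j = 0 then 1 else 0, (mem_gapShift_iff hSi).mpr fun i g hg => ?_⟩,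
      fun j => rfl⟩
    have h1 := hg.1
    have h2 := hg.2.2
    simp only [ite_eq_left_iff, zero_ne_one, imp_false, not_not] at h1 h2
    lia
  have hne : ∀ i, ∃ j, (d.F (c.F (shiftBy _ i x₀))).1 j = 1 := by
    intro i
    rw [hk, shiftBy_shiftBy]
    exact ⟨-(k (shiftBy _ i x₀) + i), by rw [shiftBy_apply, hx₀]; simp⟩
  set y₁ := c.F (shiftBy _ (w + 1) x₀)
  set y₂ := c.F (shiftBy _ (-w - 1) x₀)
  have hy1 : ∀ j, 0 ≤ j → y₁.1 j = q.1 j := hw.right _ _ fun j hj => by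
    rw [shiftBy_apply, hx₀, hx, if_neg (by lia)]
  have hy2 : ∀ j ≤ 0, y₂.1 j = q.1 j := hw.left _ _ fun j hj => by
    rw [shiftBy_apply, hx₀, hx, if_neg (by lia)]
  obtain ⟨b, hb⟩ := hK y₁ y₂ hy1 hy2 (hne _) (hne _)
  have hqn : ∀ n m, q.1 (m + p * n) = q.1 m := fun n m => by
    rw [add_comm, ← shiftBy_apply, shiftBy_mul_eq hqp]
  have hmem : ∀ n : ℤ, K ≤ n → ∃ g ∈ S, (g : ℤ) = n + b := by
    intro n hn
    have hspl := isSplice_of_eq (k := p * n) hy1 hy2 (hqn n)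
    set z : ℤ → Fin 2 := fun j => if j ≤ p * n then y₁.1 j else y₂.1 (j - p * n) with hz
    have hzmem : z ∈ (gapShift R).carrier := by
      refine (mem_gapShift_iff hRi).mpr fun i g hg => ?_
      by_cases h1 : i + g + 1 ≤ p * n
      · refine (mem_gapShift_iff hRi).mp y₁.2 i g ⟨?_, fun j hj hj' => ?_, ?_⟩
        · rw [← hspl.1 _ (by lia)]; exact hg.1
        · rw [← hspl.1 _ (by lia)]; exact hg.2.1 j hj hj'
        · rw [← hspl.1 _ (by lia)]; exact hg.2.2
      by_cases h2 : 0 ≤ i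
      · refine (mem_gapShift_iff hRi).mp y₂.2 (i - p * n) g ⟨?_, fun j hj hj' => ?_, ?_⟩
        · rw [← hspl.2 _ (by lia), add_sub_cancel]; exact hg.1
        · rw [← hspl.2 _ (by lia)]; exact hg.2.1 _ (by lia) (by lia)
        · rw [← hspl.2 _ (by lia)]; exact (congrArg z (by lia)).trans hg.2.2
      -- A gap straddling both halves would cover a full period of `q`, which contains a one.
      exfalso
      have h3 : q.1 (j % p) = 1 := by
        rw [← hqn (j / p), Int.emod_add_mul_ediv, hj1]
      have h4 := Int.emod_nonneg j (show p ≠ 0 by lia)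
      have h5 := Int.emod_lt_of_pos j (show 0 < p by lia)
      have h6 : p ≤ p * n := le_mul_of_one_le_right (by lia) (by lia)
      have h7 := hg.2.1 (j % p) (by lia) (by lia)
      rw [hspl.1 _ (by lia), hy1 _ h4, h3] at h7
      exact one_ne_zero h7
    obtain ⟨i, g, hg, hgap⟩ := hb n hn ⟨z, hzmem⟩ hspl
    exact ⟨g, (mem_gapShift_iff hSi).mp (d.F _).2 i g hgap, hg⟩
  have hcof : ∀ s : ℕ, (K + b).toNat ≤ s → s ∈ S := by
    intro s hs
    obtain ⟨g, hg, hgs⟩ := hmem (s - b) (by lia)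
    rwa [show s = g by lia]
  exact hS (isSofic_gapShift_of_eventually_periodic hSi one_pos fun s hs =>
    iff_of_true (hcof s hs) (hcof _ (by lia)))

/-! ### Long gaps are shifted by a constant -/

lemma zero_mem_gapShift {S : Set ℕ} (hS : S.Infinite) : (fun _ => 0) ∈ (gapShift S).carrier :=
  (mem_gapShift_iff hS).mpr fun _ _ h => absurd h.1 zero_ne_one

/-- The two halves of a sequence cut in the middle of a gap. -/
structure IsTailPair (x₁ x₂ : ℤ → Fin 2) : Prop where
  left_one : x₁ (-1) = 1
  left_zero : ∀ j, 0 ≤ j → x₁ j = 0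
  right_one : x₂ 1 = 1
  right_zero : ∀ j ≤ 0, x₂ j = 0

lemma HasGap.of_forall_eq {x y : ℤ → Fin 2} {i e : ℤ} {g : ℕ} (h : HasGap x i g)
    (he : ∀ j, i ≤ j → j ≤ i + g + 1 → x j = y (e + j)) : HasGap y (e + i) g := by
  refine ⟨?_, fun j hj hj' => ?_, ?_⟩
  · rw [← he i le_rfl (by lia)]; exact h.1
  · rw [show j = e + (j - e) by lia, ← he _ (by lia) (by lia)]
    exact h.2.1 _ (by lia) (by lia)
  · rw [add_assoc e, add_assoc e, ← he _ (by lia) le_rfl]; exact h.2.2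

/-- With splice parameter `s - 1` the boundary ones sit at `-1` and `s`; the only new gap is `s`
itself. -/
lemma IsTailPair.exists_splice {S : Set ℕ} (hS : S.Infinite) {x₁ x₂ : (gapShift S).carrier}
    (h : IsTailPair x₁.1 x₂.1) {s : ℕ} (hs : s ∈ S) (hs1 : 1 ≤ s) :
    ∃ x : (gapShift S).carrier, IsSplice (s - 1 : ℤ) x.1 x₁.1 x₂.1 := by
  have hspl := isSplice_of_eq (k := (s - 1 : ℤ)) h.left_zero h.right_zero fun _ => rfl
  set z : ℤ → Fin 2 := fun j => if j ≤ (s - 1 : ℤ) then x₁.1 j else x₂.1 (j - (s - 1)) with hz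
  refine ⟨⟨z, (mem_gapShift_iff hS).mpr fun i g hg => ?_⟩, hspl⟩
  by_cases h1 : i + g + 1 ≤ s - 1
  · exact (mem_gapShift_iff hS).mp x₁.2 _ g (hg.of_forall_eq (e := 0) fun j _ _ => by
      rw [zero_add, hspl.1 _ (by lia)])
  by_cases h2 : 0 ≤ i
  · exact (mem_gapShift_iff hS).mp x₂.2 _ g (hg.of_forall_eq (e := -(s - 1)) fun j _ _ => by
      rw [← hspl.2 _ (by lia)]
      exact congrArg z (by lia))
  have h3 : i = -1 := by
    by_contra hcon
    have h4 := hg.2.1 (-1) (by lia) (by lia)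
    rw [hspl.1 _ (by lia), h.left_one] at h4
    exact one_ne_zero h4
  have h5 : HasGap z (-1) s := by
    refine ⟨by rw [hspl.1 _ (by lia), h.left_one], fun j hj hj' => ?_, ?_⟩
    · rw [hspl.1 _ (by lia), h.left_zero _ (by lia)]
    · rw [← h.right_one, ← hspl.2 _ (by lia)]
      exact congrArg z (by lia)
  rw [h3] at hg
  rwa [hg.unique h5]

lemma HasGap.exists_isTailPair {S : Set ℕ} (hS : S.Infinite) {x : (gapShift S).carrier} {i : ℤ}
    {s : ℕ} (h : HasGap x.1 i s) : ∃ x₁ x₂ : (gapShift S).carrier, IsTailPair x₁.1 x₂.1 ∧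
      IsSplice (s - 1 : ℤ) (shiftBy _ (i + 1) x).1 x₁.1 x₂.1 := by
  have hmem := (mem_gapShift_iff hS).mp x.2
  refine ⟨⟨fun j => if j < 0 then x.1 (i + 1 + j) else 0, (mem_gapShift_iff hS).mpr fun l g hg =>
    hmem (i + 1 + l) g (hg.of_forall_eq fun j hj hj' => ?_)⟩,
    ⟨fun j => if 0 < j then x.1 (i + s + j) else 0, (mem_gapShift_iff hS).mpr fun l g hg =>
    hmem (i + s + l) g (hg.of_forall_eq fun j hj hj' => ?_)⟩, ⟨?_, ?_, ?_, ?_⟩, ?_, ?_⟩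
  · refine if_pos ?_
    have := hg.2.2
    by_contra hcon
    simp [show ¬ (l + g + 1 < 0) by lia] at this
  · refine if_pos ?_
    have := hg.1
    by_contra hcon
    simp [show ¬ (0 < l) by lia] at this
  · simpa using h.1
  · intro j hj
    exact if_neg (by lia)
  · simpa using h.2.2
  · intro j hj
    exact if_neg (by lia)
  · intro j hj
    simp only [shiftBy_apply]
    split_ifs with hj0
    · rfl
    · exact h.2.1 _ (by lia) (by lia)
  · intro j hj
    simp only [shiftBy_apply]
    split_ifs with hj0
    · exact congrArg x.1 (by lia)
    · exact h.2.1 _ (by lia) (by lia)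

lemma exists_isTailPair {S : Set ℕ} (hS : S.Infinite) :
    ∃ x₁ x₂ : (gapShift S).carrier, IsTailPair x₁.1 x₂.1 := by
  have hmem : ∀ i : ℤ, (fun j => if j = i then 1 else 0) ∈ (gapShift S).carrier := fun i => by
    refine (mem_gapShift_iff hS).mpr fun l g hg => ?_
    have h1 := hg.1
    have h2 := hg.2.2
    simp only [ite_eq_left_iff, zero_ne_one, imp_false, not_not] at h1 h2
    lia
  exact ⟨⟨_, hmem (-1)⟩, ⟨_, hmem 1⟩, by simp, fun j hj => if_neg (by lia), by simp,
    fun j hj => if_neg (by lia)⟩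

variable {S R : Set ℕ} {c : OrbitMap (gapShift S) (gapShift R)}
  {d : OrbitMap (gapShift R) (gapShift S)}

/-- If the image were zero, applying `map_zero` to the inverse would make a shift of `x` zero. -/
lemma OrbitMap.IsLeftInverse.exists_one (hS : ¬ IsSofic (gapShift S))
    (hR : ¬ IsSofic (gapShift R)) (h : d.IsLeftInverse c) (h' : c.IsLeftInverse d)
    {x : (gapShift S).carrier} (hx : ∃ j, x.1 j = 1) : ∃ j, (c.F x).1 j = 1 := by
  by_contra! hcon
  obtain ⟨j, hj⟩ := hx
  obtain ⟨k, hk, -⟩ := h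
  have h0 := h'.map_zero hR hS (x := c.F x) (fun i => eq_zero_iff_ne_one.mpr (hcon i)) (j - k x)
  rw [hk, shiftBy_apply, add_sub_cancel, hj] at h0
  exact one_ne_zero h0

/-- On fixed points the cocycles are linear, so those of `c` and `d` multiply to `1`; growth makes
the first one positive. -/
lemma OrbitMap.IsLeftInverse.N_one_zero (hS : ¬ IsSofic (gapShift S))
    (hR : ¬ IsSofic (gapShift R)) (h : d.IsLeftInverse c)
    {x : (gapShift S).carrier} (hx : ∀ j, x.1 j = 0) : c.N 1 x = 1 := by
  have hF := h.map_zero hS hR hx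
  obtain ⟨k, -, hk⟩ := h
  have hfix : shiftBy (gapShift S) 1 x = x := by
    ext j; rw [shiftBy_apply, hx, hx]
  have hfix' : shiftBy (gapShift R) 1 (c.F x) = c.F x := by
    ext j; rw [shiftBy_apply, hF, hF]
  have hp : 0 < c.N 1 x := by
    obtain ⟨n, hn⟩ := c.growth 1
    have h1 := hn (n + 1) (by lia) x
    have h2 := c.N_of_fixed hfix (n + 1)
    rw [one_mul] at h2
    rw [h2] at h1
    by_contra hcon
    nlinarith
  have h3 := hk 1 x
  have h4 := d.N_of_fixed hfix' (c.N 1 x)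
  rw [hfix] at h3
  rw [one_mul] at h4
  exact Int.eq_one_of_mul_eq_one_right hp.le (b := d.N 1 (c.F x)) (by lia)

/-- The splicing lemma along the zero sequence, with period `1`. The bound `K` is uniform, while `b`
may still depend on the tails. -/
lemma OrbitMap.IsLeftInverse.exists_offset (hS : ¬ IsSofic (gapShift S))
    (hR : ¬ IsSofic (gapShift R)) (h : d.IsLeftInverse c) (h' : c.IsLeftInverse d) :
    ∃ K : ℕ, 1 ≤ K ∧ ∀ x₁ x₂ : (gapShift S).carrier, IsTailPair x₁.1 x₂.1 →
      ∃ b : ℤ, ∀ s : ℕ, K ≤ s → ∀ x : (gapShift S).carrier, IsSplice (s - 1 : ℤ) x.1 x₁.1 x₂.1 →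
        ∃ (i : ℤ) (t : ℕ), (t : ℤ) = s + b ∧ HasGap (c.F x).1 i t := by
  have hSi := infinite_of_not_isSofic hS
  obtain ⟨w, hw⟩ := c.exists_isWindow
  obtain ⟨K, hK1, hK⟩ := hw.exists_hasGap_of_isSplice (q := ⟨_, zero_mem_gapShift hSi⟩) le_rfl
    (by ext j; rfl) (h.map_zero hS hR fun _ => rfl) (h.N_one_zero hS hR fun _ => rfl)
  refine ⟨(K + 1).toNat, by lia, fun x₁ x₂ hx => ?_⟩
  obtain ⟨b, hb⟩ := hK x₁ x₂ hx.left_zero hx.right_zero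
    (h.exists_one hS hR h' ⟨_, hx.left_one⟩) (h.exists_one hS hR h' ⟨_, hx.right_one⟩)
  refine ⟨b - 1, fun s hs x hxs => ?_⟩
  obtain ⟨i, g, hg, hgap⟩ := hb (s - 1) (by lia) x (by rwa [one_mul])
  exact ⟨i, g, by lia, hgap⟩

/-- There is a constant by which all long gaps are shifted. -/
theorem OrbitMap.IsLeftInverse.exists_gap_shift (hS : ¬ IsSofic (gapShift S))
    (hR : ¬ IsSofic (gapShift R)) (h : d.IsLeftInverse c) (h' : c.IsLeftInverse d) :
    ∃ (b : ℤ) (K : ℕ),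
      (∀ (x : (gapShift S).carrier) (i : ℤ) (s : ℕ), K ≤ s → HasGap x.1 i s →
        ∃ (i' : ℤ) (t : ℕ), (t : ℤ) = s + b ∧ HasGap (c.F x).1 i' t) ∧
      ∀ (y : (gapShift R).carrier) (i : ℤ) (t : ℕ), K ≤ t → HasGap y.1 i t →
        ∃ (i' : ℤ) (s : ℕ), (s : ℤ) = t - b ∧ HasGap (d.F y).1 i' s := by
  have hSi := infinite_of_not_isSofic hS
  have hRi := infinite_of_not_isSofic hR
  obtain ⟨K, hK1, hK⟩ := h.exists_offset hS hR h'
  obtain ⟨K', hK1', hK'⟩ := h'.exists_offset hR hS h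
  choose b hb using hK
  choose b' hb' using hK'
  -- Passing a large `s ∈ S` to `R` with one pair of tails and back with another translates it by
  -- this sum. As the pairs are independent, `b` and `b'` are constant and opposite.
  have hadd : ∀ x₁ x₂ hx y₁ y₂ hy, b x₁ x₂ hx + b' y₁ y₂ hy = 0 := by
    intro x₁ x₂ hx y₁ y₂ hy
    refine eq_zero_of_eventually_add_mem hS (K := K + K' + (b x₁ x₂ hx).natAbs) fun s hs hsK => ?_
    obtain ⟨x, hxs⟩ := hx.exists_splice hSi hs (by lia)
    obtain ⟨i, t, ht, htg⟩ := hb x₁ x₂ hx s (by lia) x hxs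
    obtain ⟨y, hys⟩ := hy.exists_splice hRi ((mem_gapShift_iff hRi).mp (c.F x).2 i t htg) (by lia)
    obtain ⟨i', s', hs', hsg⟩ := hb' y₁ y₂ hy t (by lia) y hys
    exact ⟨s', (mem_gapShift_iff hSi).mp (d.F y).2 i' s' hsg, by lia⟩
  obtain ⟨x₁, x₂, hx⟩ := exists_isTailPair hSi
  obtain ⟨y₁, y₂, hy⟩ := exists_isTailPair hRi
  refine ⟨b x₁ x₂ hx, K + K', fun x i s hs hg => ?_, fun y i t ht hg => ?_⟩
  · obtain ⟨u₁, u₂, hu, hus⟩ := hg.exists_isTailPair hSi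
    obtain ⟨i', t, ht, htg⟩ := hb u₁ u₂ hu s (by lia) _ hus
    have h1 := hadd u₁ u₂ hu y₁ y₂ hy
    have h2 := hadd x₁ x₂ hx y₁ y₂ hy
    rw [c.F_shift] at htg
    exact ⟨_, t, by lia, hasGap_shift.mp htg⟩
  · obtain ⟨u₁, u₂, hu, hus⟩ := hg.exists_isTailPair hRi
    obtain ⟨i', s, hs, hsg⟩ := hb' u₁ u₂ hu t (by lia) _ hus
    have h1 := hadd x₁ x₂ hx u₁ u₂ hu
    rw [d.F_shift] at hsg
    exact ⟨_, s, by lia, hasGap_shift.mp hsg⟩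

/-! ### Sequences with finitely many ones -/

/-- The sequence with finitely many ones, the first one at `0`, with given gaps. -/
def homoclinic : List ℕ → ℤ → Fin 2
  | [], j => if j = 0 then 1 else 0
  | a :: W, j => if j = 0 then 1 else homoclinic W (j - (a + 1))

/-- The position of the last one. -/
def homoclinicLength (W : List ℕ) : ℕ := (W.map (· + 1)).sum

@[simp] lemma homoclinicLength_cons (a : ℕ) (W : List ℕ) :
    homoclinicLength (a :: W) = a + 1 + homoclinicLength W := by simp [homoclinicLength]

@[simp] lemma homoclinicLength_nil : homoclinicLength [] = 0 := rfl

lemma length_le_homoclinicLength (W : List ℕ) : W.length ≤ homoclinicLength W := by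
  induction W with
  | nil => simp
  | cons a W ih => rw [List.length_cons, homoclinicLength_cons]; lia

@[simp] lemma homoclinic_zero (W : List ℕ) : homoclinic W 0 = 1 := by
  cases W <;> simp [homoclinic]

lemma homoclinic_of_neg (W : List ℕ) {j : ℤ} (hj : j < 0) : homoclinic W j = 0 := by
  induction W generalizing j with
  | nil => exact if_neg hj.ne
  | cons a W ih => rw [homoclinic, if_neg hj.ne]; exact ih (by lia)

lemma homoclinic_cons_add (a : ℕ) (W : List ℕ) {j : ℤ} (hj : -(a + 1) < j) :
    homoclinic (a :: W) (a + 1 + j) = homoclinic W j := by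
  rw [homoclinic, if_neg (by lia), add_sub_cancel_left]

@[simp] lemma homoclinic_length (W : List ℕ) : homoclinic W (homoclinicLength W) = 1 := by
  induction W with
  | nil => simp
  | cons a W ih =>
    rw [homoclinicLength_cons]
    push_cast
    rw [homoclinic_cons_add _ _ (by lia), ih]

lemma homoclinic_of_gt (W : List ℕ) {j : ℤ} (hj : homoclinicLength W < j) :
    homoclinic W j = 0 := by
  induction W generalizing j with
  | nil => exact if_neg (by simp at hj; lia)
  | cons a W ih =>
    rw [homoclinicLength_cons] at hj
    rw [homoclinic, if_neg (by lia)]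
    exact ih (by lia)

lemma hasGap_homoclinic_cons (a : ℕ) (W : List ℕ) : HasGap (homoclinic (a :: W)) 0 a := by
  refine ⟨homoclinic_zero _, fun j hj hj' => ?_, ?_⟩
  · rw [homoclinic, if_neg (by lia)]
    exact homoclinic_of_neg _ (by lia)
  · have := homoclinic_cons_add a W (j := 0) (by lia)
    rwa [homoclinic_zero, add_zero, ← zero_add (a : ℤ)] at this

lemma HasGap.homoclinic_cons {a : ℕ} {W : List ℕ} {i : ℤ} {k : ℕ} (h : HasGap (homoclinic W) i k) :
    HasGap (homoclinic (a :: W)) (a + 1 + i) k := by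
  have hi : 0 ≤ i := by
    by_contra hcon
    have := h.1
    rw [homoclinic_of_neg _ (by lia)] at this
    exact zero_ne_one this
  exact h.of_forall_eq fun j hj _ => (homoclinic_cons_add _ _ (by lia)).symm

lemma exists_hasGap_homoclinic {W : List ℕ} {k : ℕ} (hk : k ∈ W) :
    ∃ i, HasGap (homoclinic W) i k := by
  induction W with
  | nil => simp at hk
  | cons a W ih =>
    rcases List.mem_cons.mp hk with rfl | hk
    · exact ⟨0, hasGap_homoclinic_cons _ _⟩
    · obtain ⟨i, hi⟩ := ih hk
      exact ⟨_, hi.homoclinic_cons⟩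

lemma HasGap.mem_of_homoclinic {W : List ℕ} {i : ℤ} {k : ℕ} (h : HasGap (homoclinic W) i k) :
    k ∈ W := by
  induction W generalizing i with
  | nil =>
    have h1 := h.1
    have h2 := h.2.2
    simp only [homoclinic, ite_eq_left_iff, zero_ne_one, imp_false, not_not] at h1 h2
    lia
  | cons a W ih =>
    by_cases hi0 : i = 0
    · subst hi0
      rw [h.unique (hasGap_homoclinic_cons a W)]
      exact List.mem_cons_self
    · have hge : a + 1 ≤ i := by
        by_contra hcon
        have h1 := h.1
        rw [homoclinic, if_neg hi0, homoclinic_of_neg _ (by lia)] at h1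
        exact zero_ne_one h1
      refine List.mem_cons_of_mem _ (ih (i := -(a + 1) + i) (h.of_forall_eq fun j hj _ => ?_))
      rw [← homoclinic_cons_add a W (by lia), add_neg_cancel_left]

lemma homoclinic_mem_iff {S : Set ℕ} (hS : S.Infinite) {W : List ℕ} :
    homoclinic W ∈ (gapShift S).carrier ↔ ∀ a ∈ W, a ∈ S := by
  rw [mem_gapShift_iff hS]
  refine ⟨fun h a ha => ?_, fun h i k hk => h k hk.mem_of_homoclinic⟩
  obtain ⟨i, hi⟩ := exists_hasGap_homoclinic ha
  exact h i a hi

lemma homoclinic_injective : Function.Injective homoclinic := by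
  have hnil : ∀ (a : ℕ) (V : List ℕ), homoclinic [] ≠ homoclinic (a :: V) := by
    intro a V h
    obtain ⟨i, hi⟩ := exists_hasGap_homoclinic (W := a :: V) List.mem_cons_self
    rw [← h] at hi
    exact absurd hi.mem_of_homoclinic List.not_mem_nil
  intro W
  induction W with
  | nil =>
    intro V h
    rcases V with _ | ⟨a, V⟩
    · rfl
    · exact absurd h (hnil a V)
  | cons b W ih =>
    intro V h
    rcases V with _ | ⟨a, V⟩
    · exact absurd h.symm (hnil b W)
    · have hab : b = a := by
        refine (hasGap_homoclinic_cons b W).unique ?_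
        rw [h]
        exact hasGap_homoclinic_cons a V
      subst hab
      rw [ih (a₂ := V)]
      funext j
      rcases lt_or_ge j 0 with hj | hj
      · rw [homoclinic_of_neg _ hj, homoclinic_of_neg _ hj]
      · rw [← homoclinic_cons_add b W (by lia), ← homoclinic_cons_add b V (by lia), h]

lemma eq_of_homoclinic_shift {V W : List ℕ} {n : ℤ}
    (h : ∀ j, homoclinic V (n + j) = homoclinic W j) : V = W := by
  have hn : n = 0 := by
    have h1 := h 0
    have h2 := h (-n)
    rw [homoclinic_zero, add_zero] at h1
    rw [add_neg_cancel, homoclinic_zero] at h2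
    by_contra hcon
    rcases lt_or_gt_of_ne hcon with h3 | h3
    · rw [homoclinic_of_neg _ h3] at h1
      exact zero_ne_one h1
    · rw [homoclinic_of_neg _ (by lia)] at h2
      exact one_ne_zero h2
  subst hn
  exact homoclinic_injective (funext fun j => by rw [← h j, zero_add])

lemma exists_eq_homoclinic_of_bound (b : ℕ) (x : ℤ → Fin 2) (h0 : x 0 = 1)
    (hneg : ∀ j < 0, x j = 0) (hb : ∀ j : ℤ, b < j → x j = 0) : ∃ V, x = homoclinic V := by
  induction b using Nat.strong_induction_on generalizing x with
  | _ b ih =>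
    by_cases hex : ∃ j, 0 < j ∧ x j = 1
    · obtain ⟨j, hj, hj1⟩ := hex
      obtain ⟨k, hk, hgap⟩ := exists_hasGap h0 hj hj1
      have hkb : k + 1 ≤ b := by
        by_contra hcon
        have := hgap.2.2
        rw [hb _ (by lia)] at this
        exact zero_ne_one this
      obtain ⟨V, hV⟩ := ih (b - (k + 1)) (by lia)
        (fun j => if j < 0 then 0 else x (k + 1 + j))
        (by simpa using hgap.2.2) (fun j hj => if_pos hj) (fun j hj => by
          rw [if_neg (by lia), hb _ (by lia)])
      refine ⟨k :: V, funext fun j => ?_⟩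
      rcases lt_trichotomy j 0 with hj | rfl | hj
      · rw [hneg j hj, homoclinic_of_neg _ hj]
      · rw [h0, homoclinic_zero]
      · rw [homoclinic, if_neg hj.ne', ← hV]
        simp only
        split_ifs with hlt
        · exact hgap.2.1 j hj (by lia)
        · rw [add_sub_cancel]
    · push Not at hex
      refine ⟨[], funext fun j => ?_⟩
      rw [homoclinic]
      split_ifs with hj
      · rw [hj, h0]
      · rcases lt_or_gt_of_ne hj with h | h
        · exact hneg j h
        · exact eq_zero_iff_ne_one.mpr (hex j h)

lemma exists_eq_homoclinic {x : ℤ → Fin 2} {e e' : ℤ} (hne : ∃ j, x j = 1)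
    (he : ∀ m ≤ 0, x (e + m) = 0) (he' : ∀ m, 0 ≤ m → x (e' + m) = 0) :
    ∃ (n : ℤ) (V : List ℕ), ∀ j, x j = homoclinic V (n + j) := by
  obtain ⟨b, -, hb1, hb0⟩ := exists_first_one hne he
  obtain ⟨a, -, ha1, ha0⟩ := exists_last_one hne he'
  obtain ⟨V, hV⟩ := exists_eq_homoclinic_of_bound (a - b).toNat (fun j => x (b + j))
    (by simpa using hb1) (fun j hj => hb0 _ (by lia)) (fun j hj => ha0 _ (by lia))
  refine ⟨-b, V, fun j => ?_⟩
  rw [← hV]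
  exact congrArg x (by lia)

lemma homoclinic_congr {m : ℕ} {W W' : List ℕ} (h : W.take m = W'.take m) {j : ℤ} (hj : j ≤ m) :
    homoclinic W j = homoclinic W' j := by
  induction m generalizing W W' j with
  | zero =>
    rcases hj.lt_or_eq with hj | rfl
    · rw [homoclinic_of_neg _ hj, homoclinic_of_neg _ hj]
    · simp
  | succ m ih =>
    rcases W with _ | ⟨a, W⟩ <;> rcases W' with _ | ⟨a', W'⟩
    · rfl
    · simp at h
    · simp at h
    · simp only [List.take_succ_cons, List.cons.injEq] at h
      obtain ⟨rfl, h⟩ := h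
      rw [homoclinic, homoclinic]
      split_ifs
      · rfl
      · exact ih h (by lia)

/-! ### The bijection of homoclinic points -/

/-- The gaps in `S` of length less than `M`. -/
abbrev ShortGap (S : Set ℕ) (M : ℕ) : Type := {a : ℕ // a ∈ S ∧ a < M}

noncomputable instance (S : Set ℕ) (M : ℕ) : Fintype (ShortGap S M) :=
  ((finite_lt_nat M).subset fun _ h => h.2 : {a | a ∈ S ∧ a < M}.Finite).fintype

/-- The points of `X(S)` with finitely many ones and short gaps. -/
def homoclinicPoint {S : Set ℕ} (hS : S.Infinite) {M : ℕ} (W : List (ShortGap S M)) :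
    (gapShift S).carrier :=
  ⟨homoclinic (W.map Subtype.val), (homoclinic_mem_iff hS).mpr fun a ha => by
    obtain ⟨e, -, rfl⟩ := List.mem_map.mp ha
    exact e.2.1⟩

section

variable {S R : Set ℕ} {c : OrbitMap (gapShift S) (gapShift R)}
  {d : OrbitMap (gapShift R) (gapShift S)}

/-- Far out the point looks like the zero sequence, which is preserved, so the image has finitely
many ones. A long gap of the image would be mapped back to a gap of length at least `M` in a shift
of the original. -/
lemma OrbitMap.IsLeftInverse.map_homoclinicPoint (hS : ¬ IsSofic (gapShift S))
    (hR : ¬ IsSofic (gapShift R)) (hSi : S.Infinite) (hRi : R.Infinite)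
    (h : d.IsLeftInverse c) (h' : c.IsLeftInverse d)
    {b : ℤ} {M M' : ℕ} (hM : (M' : ℤ) = M + b)
    (hgap : ∀ (y : (gapShift R).carrier) (i : ℤ) (t : ℕ), M' ≤ t → HasGap y.1 i t →
      ∃ (i' : ℤ) (s : ℕ), (s : ℤ) = t - b ∧ HasGap (d.F y).1 i' s)
    (W : List (ShortGap S M)) : ∃ (n : ℤ) (V : List (ShortGap R M')),
      c.F (homoclinicPoint hSi W) = shiftBy _ n (homoclinicPoint hRi V) := by
  obtain ⟨w, hw⟩ := c.exists_isWindow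
  have hw0 := hw.nonneg
  set x := homoclinicPoint hSi W with hx
  set z : (gapShift S).carrier := ⟨_, zero_mem_gapShift hSi⟩
  have hFz : ∀ j, (c.F z).1 j = 0 := h.map_zero hS hR fun _ => rfl
  have hone := h.exists_one hS hR h' (x := x) ⟨0, homoclinic_zero _⟩
  obtain ⟨n, V, hV⟩ := exists_eq_homoclinic hone
    (e := c.N (-w - 1) x) (e' := c.N (w + 1 + homoclinicLength (W.map Subtype.val)) x)
    (fun m hm => by
      rw [hw.left_at (x' := z) (-w - 1) 0 (fun j hj => homoclinic_of_neg _ (by lia)) hm, hFz])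
    (fun m hm => by
      rw [hw.right_at (x' := z) _ 0 (fun j hj => homoclinic_of_gt _ (by lia)) hm, hFz])
  have hVgap : ∀ k ∈ V, k ∈ R ∧ k < M' := by
    intro k hk
    obtain ⟨i, hi⟩ := exists_hasGap_homoclinic hk
    have hi' : HasGap (c.F x).1 (-n + i) k := hi.of_forall_eq fun j _ _ => by
      rw [hV, add_neg_cancel_left]
    refine ⟨(mem_gapShift_iff hRi).mp (c.F x).2 _ _ hi', ?_⟩
    by_contra hcon
    obtain ⟨i', s, hs, hsg⟩ := hgap _ _ _ (by lia) hi'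
    obtain ⟨l, hl, -⟩ := h
    rw [hl] at hsg
    have hmem := (hasGap_shift.mp hsg).mem_of_homoclinic
    obtain ⟨e, -, he⟩ := List.mem_map.mp hmem
    have := e.2.2
    lia
  lift V to List (ShortGap R M') using hVgap
  exact ⟨n, V, Subtype.ext (funext hV)⟩

lemma homoclinicPoint_shift_injective (hSi : S.Infinite) {M : ℕ} {V W : List (ShortGap S M)}
    {n m : ℤ} (h : shiftBy _ n (homoclinicPoint hSi V) = shiftBy _ m (homoclinicPoint hSi W)) :
    V = W := by
  refine List.map_injective_iff.mpr Subtype.val_injective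
    (eq_of_homoclinic_shift (n := n - m) fun j => ?_)
  have := congrFun (congrArg Subtype.val h) (-m + j)
  simp only [shiftBy_apply, ← add_assoc, ← sub_eq_add_neg] at this
  simpa [homoclinicPoint] using this

/-- An orbit map with an inverse induces a bijection of homoclinic points. -/
lemma OrbitMap.IsLeftInverse.exists_equiv (hS : ¬ IsSofic (gapShift S))
    (hR : ¬ IsSofic (gapShift R)) (hSi : S.Infinite) (hRi : R.Infinite)
    (h : d.IsLeftInverse c) (h' : c.IsLeftInverse d) {b : ℤ} {M M' : ℕ} (hM : (M' : ℤ) = M + b)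
    (hgap : ∀ (x : (gapShift S).carrier) (i : ℤ) (s : ℕ), M ≤ s → HasGap x.1 i s →
      ∃ (i' : ℤ) (t : ℕ), (t : ℤ) = s + b ∧ HasGap (c.F x).1 i' t)
    (hgap' : ∀ (y : (gapShift R).carrier) (i : ℤ) (t : ℕ), M' ≤ t → HasGap y.1 i t →
      ∃ (i' : ℤ) (s : ℕ), (s : ℤ) = t - b ∧ HasGap (d.F y).1 i' s) :
    ∃ (β : List (ShortGap S M) ≃ List (ShortGap R M')) (n : List (ShortGap S M) → ℤ),
      ∀ W, c.F (homoclinicPoint hSi W) = shiftBy _ (n W) (homoclinicPoint hRi (β W)) := by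
  choose n β hβ using h.map_homoclinicPoint hS hR hSi hRi h' hM hgap'
  choose n' β' hβ' using h'.map_homoclinicPoint hR hS hRi hSi h (b := -b) (M := M') (M' := M)
    (by lia) (by simpa only [sub_neg_eq_add] using hgap)
  refine ⟨⟨β, β', fun W => ?_, fun V => ?_⟩, n, hβ⟩
  · obtain ⟨k, hk, -⟩ := h
    have h1 := hk (homoclinicPoint hSi W)
    rw [hβ, d.F_shift, hβ', shiftBy_shiftBy] at h1
    exact homoclinicPoint_shift_injective hSi h1
  · obtain ⟨k, hk, -⟩ := h'
    have h1 := hk (homoclinicPoint hRi V)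
    rw [hβ', c.F_shift, hβ, shiftBy_shiftBy] at h1
    exact homoclinicPoint_shift_injective hRi h1

/-- Compactness of the set of points with a one at `0` bounds the distance to a one of the image. -/
lemma OrbitMap.exists_one_near (c : OrbitMap (gapShift S) (gapShift R))
    (hc : ∀ x : (gapShift S).carrier, (∃ j, x.1 j = 1) → ∃ j, (c.F x).1 j = 1) :
    ∃ D : ℕ, ∀ x : (gapShift S).carrier, x.1 0 = 1 → ∃ j : ℤ, |j| ≤ D ∧ (c.F x).1 j = 1 := by
  have hX : CompactSpace (gapShift S).carrier :=
    isCompact_iff_compactSpace.mp (gapShift S).isClosed.isCompact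
  have hev : ∀ j : ℤ, Continuous fun x : (gapShift S).carrier => (c.F x).1 j := fun j =>
    (continuous_apply j).comp (continuous_subtype_val.comp c.continuous_F)
  have hK : IsCompact {x : (gapShift S).carrier | x.1 0 = 1} :=
    (isClosed_eq ((continuous_apply (0 : ℤ)).comp continuous_subtype_val)
      continuous_const).isCompact
  obtain ⟨t, ht⟩ := hK.elim_finite_subcover (fun j : ℤ => {x | (c.F x).1 j = 1})
    (fun j => (isOpen_discrete {(1 : Fin 2)}).preimage (hev j))
    (fun x hx => mem_iUnion.mpr (hc x ⟨0, hx⟩))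
  refine ⟨t.sup Int.natAbs, fun x hx => ?_⟩
  obtain ⟨j, hj, hj1⟩ := mem_iUnion₂.mp (ht hx)
  refine ⟨j, ?_, hj1⟩
  rw [Int.abs_eq_natAbs]
  exact_mod_cast Finset.le_sup (f := Int.natAbs) hj

/-- The increment of the length of the image of a homoclinic point by a new first gap depends only
on boundedly many gaps. -/
lemma OrbitMap.length_sub_length_eq (c : OrbitMap (gapShift S) (gapShift R))
    (hc : ∀ x : (gapShift S).carrier, (∃ j, x.1 j = 1) → ∃ j, (c.F x).1 j = 1)
    (hSi : S.Infinite) (hRi : R.Infinite) {M M' : ℕ}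
    (β : List (ShortGap S M) → List (ShortGap R M')) (n : List (ShortGap S M) → ℤ)
    (hβ : ∀ W, c.F (homoclinicPoint hSi W) = shiftBy _ (n W) (homoclinicPoint hRi (β W))) :
    ∃ m : ℕ, ∀ a W W', W.take m = W'.take m →
      (homoclinicLength ((β (a :: W)).map Subtype.val) : ℤ) -
          homoclinicLength ((β W).map Subtype.val) =
        homoclinicLength ((β (a :: W')).map Subtype.val) -
          homoclinicLength ((β W').map Subtype.val) := by
  obtain ⟨w, hw⟩ := c.exists_isWindow
  have hw0 := hw.nonneg
  obtain ⟨D, hD⟩ := c.exists_one_near hc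
  obtain ⟨n₀, hn₀⟩ := c.growth D
  set pt : List (ShortGap S M) → (gapShift S).carrier := homoclinicPoint hSi with hpt
  set len : List (ShortGap S M) → ℕ := fun W => homoclinicLength (W.map Subtype.val) with hlen
  set ℓ : List (ShortGap S M) → ℕ := fun W => homoclinicLength ((β W).map Subtype.val) with hℓ
  have hF : ∀ W j, (c.F (pt W)).1 j = homoclinic ((β W).map Subtype.val) (n W + j) := fun W j => by
    rw [hβ]; rfl
  have hfirst : ∀ W j, (c.F (pt W)).1 j = 1 → -n W ≤ j := by
    intro W j hj
    by_contra hcon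
    rw [hF, homoclinic_of_neg _ (by lia)] at hj
    exact zero_ne_one hj
  have hlast : ∀ W j, (c.F (pt W)).1 j = 1 → j ≤ -n W + ℓ W := by
    intro W j hj
    by_contra hcon
    rw [hF, homoclinic_of_gt _ (by lia)] at hj
    exact zero_ne_one hj
  have hfirst1 : ∀ W, (c.F (pt W)).1 (-n W) = 1 := fun W => by
    rw [hF, add_neg_cancel, homoclinic_zero]
  have hlast1 : ∀ W, (c.F (pt W)).1 (-n W + ℓ W) = 1 := fun W => by
    rw [hF, add_neg_cancel_left, homoclinic_length]
  have hagree : ∀ (m : ℕ) W W', W.take m = W'.take m → ∀ j : ℤ, j ≤ m → (pt W).1 j = (pt W').1 j :=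
    fun m W W' h j hj => homoclinic_congr (by rw [← List.map_take, h, List.map_take]) hj
  have hcons : ∀ a W (j : ℤ), -(a.1 + 1) < j → (pt (a :: W)).1 (a.1 + 1 + j) = (pt W).1 j :=
    fun a W j hj => homoclinic_cons_add _ _ hj
  -- The first one of the image is at most `D`, and by time `n₀` the cocycle has passed `D`; so it
  -- is determined by a bounded initial part.
  have hn_le : ∀ W W', W.take (n₀ + 2 * w.toNat) = W'.take (n₀ + 2 * w.toNat) → n W ≤ n W' := by
    intro W W' h
    have h1 := hagree _ W W' h
    obtain ⟨j, hj, hj1⟩ := hD (pt W) (homoclinic_zero _)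
    have h2 := hfirst W j hj1
    have h3 := hn₀ n₀ le_rfl (pt W)
    have h4 := hw.left_at (x := pt W) (x' := pt W') n₀ n₀ (fun j hj => h1 _ (by lia))
      (m := -n W - c.N n₀ (pt W)) (by have := abs_le.mp hj; lia)
    rw [← hw.N_congr n₀ (pt W) (pt W') fun j _ hj => h1 _ (by lia), add_sub_cancel, hfirst1] at h4
    have := hfirst W' _ h4.symm
    lia
  -- The image has a one within `D` of the image time of the last one. At least `n₀` before that,
  -- the image time is smaller by at least `D`.
  have hlast_ge : ∀ W (e t : ℤ), n₀ ≤ t → (len W : ℤ) = e + t → c.N e (pt W) ≤ -n W + ℓ W := by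
    intro W e t ht he
    obtain ⟨j, hj, hj1⟩ := hD (shiftBy _ (len W) (pt W)) (by
      rw [shiftBy_apply, add_zero]; exact homoclinic_length _)
    rw [F_shift_apply] at hj1
    have h1 := hlast W _ hj1
    have h2 := c.N_add e t (pt W)
    rw [← he] at h2
    have h3 := hn₀ t ht (shiftBy _ e (pt W))
    have := abs_le.mp hj
    lia
  -- To the right of the new gap both points agree, so their images have the last one at the same
  -- distance from corresponding image times. The increment of `ℓ` is thus reduced to `n` and `N`,
  -- which see only a bounded prefix.
  have hstep : ∀ a W, n₀ + 2 * w.toNat ≤ W.length → -n (a :: W) + (ℓ (a :: W) : ℤ) -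
      c.N (w + a.1 + 1) (pt (a :: W)) = -n W + ℓ W - c.N w (pt W) := by
    intro a W hW
    have hlenW : W.length ≤ len W := by
      have := length_le_homoclinicLength (W.map Subtype.val)
      rwa [List.length_map] at this
    have hlena : len (a :: W) = a.1 + 1 + len W := by simp [hlen]
    have h1 : ∀ m, 0 ≤ m → (c.F (pt (a :: W))).1 (c.N (w + a.1 + 1) (pt (a :: W)) + m) =
        (c.F (pt W)).1 (c.N w (pt W) + m) := fun m hm =>
      hw.right_at _ _ (fun j hj => by
        rw [← hcons a W _ (by lia)]
        exact congrArg _ (by lia)) hm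
    have h2 := hlast_ge (a :: W) (w + a.1 + 1) (len W - w) (by lia) (by lia)
    have h3 := hlast_ge W w (len W - w) (by lia) (by lia)
    have h4 := h1 (-n (a :: W) + ℓ (a :: W) - c.N (w + a.1 + 1) (pt (a :: W))) (by lia)
    have h5 := h1 (-n W + ℓ W - c.N w (pt W)) (by lia)
    rw [add_sub_cancel, hlast1] at h4
    rw [add_sub_cancel, hlast1] at h5
    have h6 := hlast _ _ h4.symm
    have h7 := hlast _ _ h5
    lia
  refine ⟨n₀ + 2 * w.toNat, fun a W W' h => ?_⟩
  -- If one list is shorter than the common prefix length, the lists coincide.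
  by_cases hl : W.length < n₀ + 2 * w.toNat ∨ W'.length < n₀ + 2 * w.toNat
  · have : W = W' := by
      have hlen' := congrArg List.length h
      simp only [List.length_take] at hlen'
      rwa [List.take_of_length_le (by lia), List.take_of_length_le (by lia)] at h
    rw [this]
  · have h1 := hstep a W (by lia)
    have h2 := hstep a W' (by lia)
    have h3 := hagree _ W W' h
    have h4 := hw.N_congr w (pt W) (pt W') fun j _ _ => h3 j (by lia)
    have h5 := hw.N_congr (w + a.1 + 1) (pt (a :: W)) (pt (a :: W')) fun j _ _ => by
      rcases lt_or_ge j 0 with hj | hj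
      · exact (homoclinic_of_neg _ hj).trans (homoclinic_of_neg _ hj).symm
      rcases hj.eq_or_lt with rfl | hj
      · exact (homoclinic_zero _).trans (homoclinic_zero _).symm
      rw [show j = a.1 + 1 + (j - (a.1 + 1)) by lia, hcons _ _ _ (by lia), hcons _ _ _ (by lia)]
      exact h3 _ (by lia)
    have hnW := le_antisymm (hn_le W W' h) (hn_le W' W h.symm)
    have htake : (a :: W).take (n₀ + 2 * w.toNat) = (a :: W').take (n₀ + 2 * w.toNat) :=
      congrArg Subtype.val (prefixOf_cons_congr (a := a) h)
    have hnaW := le_antisymm (hn_le _ _ htake) (hn_le _ _ htake.symm)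
    change (ℓ (a :: W) : ℤ) - ℓ W = ℓ (a :: W') - ℓ W'
    lia

end

/-- Flow equivalent non-sofic gap shifts have gap sets that are translates of each other up to
finite sets of the same size. -/
theorem exists_translate_of_flowEquivalent {S R : Set ℕ} (hS : ¬ IsSofic (gapShift S))
    (hR : ¬ IsSofic (gapShift R)) (h : FlowEquivalent (gapShift S) (gapShift R)) :
    ∃ S' R' : Set ℕ, S' ⊆ S ∧ R' ⊆ R ∧ (S \ S').Finite ∧ (R \ R').Finite ∧
      (S \ S').ncard = (R \ R').ncard ∧
      ∃ r : ℤ, (fun s : ℕ => (s : ℤ) + r) '' S' = (fun s : ℕ => (s : ℤ)) '' R' := by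
  have hSi := infinite_of_not_isSofic hS
  have hRi := infinite_of_not_isSofic hR
  obtain ⟨c, d, hdc, hcd⟩ := h.exists_orbitMaps
  obtain ⟨b, K, hK, hK'⟩ := hdc.exists_gap_shift hS hR hcd
  obtain ⟨a₁, ha₁⟩ := hSi.nonempty
  obtain ⟨a₂, ha₂, ha₁₂⟩ := hSi.exists_gt a₁
  -- Both `M` and `M' = M + b` are at least `K`, and `a₁`, `a₂` lie below `M`, so the alphabet has
  -- more than one letter.
  obtain ⟨M, hM⟩ : ∃ M : ℕ, M = a₂ + 1 + K + b.natAbs := ⟨_, rfl⟩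
  obtain ⟨M', hM'⟩ : ∃ M' : ℕ, (M' : ℤ) = M + b := ⟨(M + b).toNat, by lia⟩
  obtain ⟨β, n, hβ⟩ := hdc.exists_equiv hS hR hSi hRi hcd hM'
    (fun x i s hs => hK x i s (by lia)) (fun y i t ht => hK' y i t (by lia))
  obtain ⟨m, hm⟩ := c.length_sub_length_eq (fun x hx => hdc.exists_one hS hR hcd hx) hSi hRi β n hβ
  have hcard := card_eq_of_list_equiv β (fun r => r.1 + 1) (fun r => by lia)
    (fun W => homoclinicLength ((β W).map Subtype.val))
    (fun W => by simp [homoclinicLength]) m hm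
    (Fintype.one_lt_card_iff.mpr ⟨⟨a₁, ha₁, by lia⟩, ⟨a₂, ha₂, by lia⟩, by
      simpa using ha₁₂.ne⟩)
  have hdiff : ∀ (T : Set ℕ) (L : ℕ), T \ {a | a ∈ T ∧ L ≤ a} = {a | a ∈ T ∧ a < L} := by
    intro T L
    ext a
    simp only [mem_sdiff, mem_ofPred_eq]
    grind
  have hfin : ∀ (T : Set ℕ) (L : ℕ), {a | a ∈ T ∧ a < L}.Finite := fun T L =>
    (finite_lt_nat L).subset fun _ h => h.2
  refine ⟨{a | a ∈ S ∧ M ≤ a}, {a | a ∈ R ∧ M' ≤ a}, fun a ha => ha.1, fun a ha => ha.1, ?_, ?_,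
    ?_, b, ?_⟩
  · rw [hdiff]; exact hfin S M
  · rw [hdiff]; exact hfin R M'
  · rw [hdiff, hdiff, ← Nat.card_coe_set_eq, ← Nat.card_coe_set_eq]
    rw [← Nat.card_eq_fintype_card, ← Nat.card_eq_fintype_card] at hcard
    exact hcard.symm
  · ext z
    simp only [mem_image, mem_ofPred_eq]
    constructor
    · rintro ⟨s, ⟨hs, hsM⟩, rfl⟩
      -- The sequence whose only gap is `s` witnesses that `s + b` belongs to `R`.
      obtain ⟨i, t, ht, htg⟩ := hK
        ⟨homoclinic [s], (homoclinic_mem_iff hSi).mpr (by simpa using hs)⟩ 0 s (by lia)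
        (hasGap_homoclinic_cons s [])
      exact ⟨t, ⟨(mem_gapShift_iff hRi).mp (c.F _).2 i t htg, by lia⟩, ht⟩
    · rintro ⟨t, ⟨ht, htM⟩, rfl⟩
      obtain ⟨i, s, hs, hsg⟩ := hK'
        ⟨homoclinic [t], (homoclinic_mem_iff hRi).mpr (by simpa using ht)⟩ 0 t (by lia)
        (hasGap_homoclinic_cons t [])
      exact ⟨s, ⟨(mem_gapShift_iff hSi).mp (d.F _).2 i s hsg, by lia⟩, by lia⟩

end GapShift

theorem mainTheorem2 (S R : Set ℕ)
    (hS : ¬ GapShift.IsSofic (GapShift.gapShift S))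
    (hR : ¬ GapShift.IsSofic (GapShift.gapShift R)) :
    GapShift.FlowEquivalent (GapShift.gapShift S) (GapShift.gapShift R) ↔
      ∃ S' R' : Set ℕ, S' ⊆ S ∧ R' ⊆ R ∧ (S \ S').Finite ∧ (R \ R').Finite ∧
        (S \ S').ncard = (R \ R').ncard ∧
        ∃ r : ℤ, (fun s : ℕ => (s : ℤ) + r) '' S' = (fun s : ℕ => (s : ℤ)) '' R' := by
  refine ⟨GapShift.exists_translate_of_flowEquivalent hS hR, ?_⟩
  rintro ⟨S', R', hS', hR', hfS, hfR, hcard, r, hr⟩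
  exact GapShift.flowEquivalent_of_translate (GapShift.infinite_of_not_isSofic hS)
    (GapShift.infinite_of_not_isSofic hR) hS' hR' hfS hfR hcard hr
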